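/- Let $\mathcal H$ be a real separable Hilbert space, let $W=\{W(h):h\in\mathcal H\}$ be an isonormal Gaussian process over $\mathcal H$ on a probability space $(\Omega,\mathcal F,\mathbb P)$, and let $n\ge 1$. Let $X_t=I_n(f_t)$, $0\le t\le 1$, be a process with almost surely continuous paths in the $n$-th Wiener chaos of $W$, where $I_n$ is the multiple Wiener--Itô integral (normalized by $\mathbb E[I_n(f)^2]=n!\,\|f\|^2_{\mathcal H^{\otimes n}}$ for symmetric $f$) and the kernels $f_t\in\mathcal H^{\otimes n}$ are symmetric. Let $DX_t$ be the Malliavin derivative of $X_t$, taken in a version for which $t\mapsto DX_t\in\mathcal H$ is almost surely continuous on $[0,1]$. Write $f_{s,t}=f_t-f_s$ and assume: 1. $f_0=0$, and there are $\theta>1$ and $C_0>0$ with $0<\|f_t-f_s\|_{\mathcal H^{\otimes n}}\le C_0|t-s|^{\theta/2}$ for all $0\le s<t\le 1$. 2. There is $\beta\in(0,1)$ such that for all $0=u_0<\dots<u_k=t_0<t_1<\dots<t_m=r_0<r_1<\dots<r_l\le 1$ (with $m\ge 1$, $k,l\ge 0$) and all $(a_1,\dots,a_m)\neq 0$, the vector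 $\Gamma=\sum_{i=1}^m a_i f_{t_{i-1},t_i}$ satisfies $\|\Gamma-P\Gamma\|^2_{\mathcal H^{\otimes n}}>\beta\|\Gamma\|^2_{\mathcal H^{\otimes n}}$, where $P$ is the orthogonal projection onto the closed span of $\{f_{u_{i-1},u_i}\}_{1\le i\le k}\cup\{f_{r_{i-1},r_i}\}_{1\le i\le l}$. 3. $\langle f_v-f_u,f_t-f_s\rangle_{\mathcal H^{\otimes n}}\ge 0$ whenever $[u,v]\subset[s,t]\subset[0,1]$. 4. There are $\eta,C>0$ with $\mathbb E[(X_t-X_s)^2]\ge C|t-s|^\eta$ for all $0\le s<t\le 1$. Let $g:[0,1]\to\mathbb R$ be a deterministic $\tau$-Hölder continuous function with $\tau+\rho>1$ for some $\rho<\theta/2$, and suppose that $\|g\|_\tau=\sup_{s\ne t}|g_t-g_s|/|t-s|^\tau\neq 0$. Then almost surely the $\mathcal H$-valued Young integral $\int_0^1 g_t\,dDX_t$ exists (as the limit of Riemann sums over tagged partitions whose mesh tends to $0$), it is square integrable, and $$\sup_{r\in[0,1]}|g_r|\le\max\left\{\frac{2}{\sqrt{n\beta}}\big(\mathbb E X_1^2\big)^{-\frac12}\Big(\mathbb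 E\Big\|\int_0^1 g_t\,dDX_t\Big\|^2_{\mathcal H}\Big)^{\frac12},\ \frac{2}{(n\beta C)^{\frac{\tau}{2\tau+\eta}}}\Big(\mathbb E\Big\|\int_0^1 g_t\,dDX_t\Big\|^2_{\mathcal H}\Big)^{\frac{\tau}{2\tau+\eta}}\|g\|_\tau^{\frac{\eta}{2\tau+\eta}}\right\}.$$ -/

import Mathlib

open MeasureTheory ProbabilityTheory Filter Topology
open scoped TensorProduct NNReal ENNReal InnerProductSpace

noncomputable section

namespace WienerChaos

/-! ### The Hilbert tensor power of a real Hilbert space -/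

section TensorPower

variable (H : Type*) [NormedAddCommGroup H] [InnerProductSpace ℝ H] (n : ℕ)

/-- The bilinear form on the algebraic tensor power that is determined by
`⟨v₁ ⊗ ⋯ ⊗ vₙ, w₁ ⊗ ⋯ ⊗ wₙ⟩ = ∏ i, ⟨vᵢ, wᵢ⟩`. -/
def tensorForm : (⨂[ℝ] _ : Fin n, H) →ₗ[ℝ] Module.Dual ℝ (⨂[ℝ] _ : Fin n, H) :=
  (PiTensorProduct.dualDistrib (R := ℝ) (M := fun _ : Fin n => H)) ∘ₗ
    PiTensorProduct.map (fun _ : Fin n => (innerₗ H : H →ₗ[ℝ] Module.Dual ℝ H))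

variable {H n}

theorem tensorForm_tprod (v w : Fin n → H) :
    tensorForm H n (PiTensorProduct.tprod ℝ v) (PiTensorProduct.tprod ℝ w)
      = ∏ i, ⟪v i, w i⟫_ℝ := by
  rw [tensorForm, LinearMap.comp_apply, PiTensorProduct.map_tprod,
    PiTensorProduct.dualDistrib_apply]
  rfl

theorem exists_sum_tprod (x : ⨂[ℝ] _ : Fin n, H) :
    ∃ (k : ℕ) (c : Fin k → ℝ) (v : Fin k → Fin n → H),
      x = ∑ a, c a • PiTensorProduct.tprod ℝ (v a) := by
  induction x using PiTensorProduct.induction_on with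
  | smul_tprod r f => exact ⟨1, fun _ => r, fun _ => f, by simp⟩
  | add x y hx hy =>
    obtain ⟨k, c, v, rfl⟩ := hx
    obtain ⟨l, d, w, rfl⟩ := hy
    refine ⟨k + l, Fin.append c d, Fin.append v w, ?_⟩
    rw [Fin.sum_univ_add]
    simp only [Fin.append_left, Fin.append_right]

theorem tensorForm_symm (x y : ⨂[ℝ] _ : Fin n, H) :
    tensorForm H n x y = tensorForm H n y x := by
  obtain ⟨k, c, v, rfl⟩ := exists_sum_tprod x
  obtain ⟨l, d, w, rfl⟩ := exists_sum_tprod y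
  simp only [map_sum, map_smul, LinearMap.sum_apply, LinearMap.smul_apply,
    tensorForm_tprod, smul_eq_mul, Finset.mul_sum]
  rw [Finset.sum_comm]
  refine Finset.sum_congr rfl fun a _ => Finset.sum_congr rfl fun b _ => ?_
  simp only [real_inner_comm]
  ring

theorem posSemidef_prod_inner {k : ℕ} (v : Fin k → Fin n → H) (s : Finset (Fin n)) :
    (Matrix.of fun a b : Fin k => ∏ i ∈ s, ⟪v a i, v b i⟫_ℝ).PosSemidef := by
  classical
  induction s using Finset.induction_on with
  | empty =>
    have h := Matrix.posSemidef_gram (𝕜 := ℝ) (fun _ : Fin k => (1 : ℝ))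
    have e : (Matrix.of fun a b : Fin k => ∏ i ∈ (∅ : Finset (Fin n)), ⟪v a i, v b i⟫_ℝ) =
        Matrix.gram ℝ (fun _ : Fin k => (1 : ℝ)) := by
      ext a b
      simp [Matrix.gram]
    rw [e]
    exact h
  | insert i s hi ih =>
    have h := (Matrix.posSemidef_gram (𝕜 := ℝ) (fun a : Fin k => v a i)).hadamard ih
    have e : (Matrix.of fun a b : Fin k => ∏ j ∈ insert i s, ⟪v a j, v b j⟫_ℝ) =
        Matrix.hadamard (Matrix.gram ℝ (fun a : Fin k => v a i))
          (Matrix.of fun a b : Fin k => ∏ j ∈ s, ⟪v a j, v b j⟫_ℝ) := by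
      ext a b
      simp [Matrix.gram, Matrix.hadamard, Finset.prod_insert hi]
    rw [e]
    exact h

theorem tensorForm_self_nonneg (x : ⨂[ℝ] _ : Fin n, H) : 0 ≤ tensorForm H n x x := by
  obtain ⟨k, c, v, rfl⟩ := exists_sum_tprod x
  have h := (posSemidef_prod_inner v Finset.univ).dotProduct_mulVec_nonneg c
  refine h.trans_eq ?_
  simp only [map_sum, map_smul, LinearMap.sum_apply, LinearMap.smul_apply,
    tensorForm_tprod, smul_eq_mul, dotProduct, Matrix.mulVec, Matrix.of_apply,
    star_trivial, Finset.mul_sum]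
  rw [Finset.sum_comm]
  refine Finset.sum_congr rfl fun a _ => Finset.sum_congr rfl fun b _ => ?_
  simp only [real_inner_comm]
  ring

variable (H n)

/-- The algebraic `n`-th tensor power of `H`, to be equipped with its inner product. -/
def AlgTensorPower : Type _ := ⨂[ℝ] _ : Fin n, H

instance : AddCommGroup (AlgTensorPower H n) :=
  inferInstanceAs (AddCommGroup (⨂[ℝ] _ : Fin n, H))

instance : Module ℝ (AlgTensorPower H n) :=
  inferInstanceAs (Module ℝ (⨂[ℝ] _ : Fin n, H))

/-- The inner product data of the algebraic tensor power. -/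
@[reducible]
def tensorCore : PreInnerProductSpace.Core ℝ (AlgTensorPower H n) where
  inner x y := tensorForm H n x y
  conj_inner_symm x y := tensorForm_symm y x
  re_inner_nonneg x := tensorForm_self_nonneg x
  add_left x y z := (tensorForm H n).map_add₂ x y z
  smul_left x y r := (tensorForm H n).map_smul₂ r x y

instance : SeminormedAddCommGroup (AlgTensorPower H n) :=
  InnerProductSpace.Core.toSeminormedAddCommGroup (𝕜 := ℝ) (c := tensorCore H n)

instance : InnerProductSpace ℝ (AlgTensorPower H n) :=
  InnerProductSpace.ofCore (tensorCore H n)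

variable {H n}

/-- The elementary tensor `v₁ ⊗ ⋯ ⊗ vₙ` in the algebraic tensor power. -/
def algTensor (v : Fin n → H) : AlgTensorPower H n :=
  (PiTensorProduct.tprod ℝ v : ⨂[ℝ] _ : Fin n, H)

variable (H n)

/-- The Hilbert tensor power `H^{⊗ n}`: the completion of the algebraic tensor power for the
inner product `⟨v₁ ⊗ ⋯ ⊗ vₙ, w₁ ⊗ ⋯ ⊗ wₙ⟩ = ∏ i, ⟨vᵢ, wᵢ⟩`. -/
abbrev TensorPower : Type _ := UniformSpace.Completion (AlgTensorPower H n)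

variable {H n}

/-- The elementary tensor `v₁ ⊗ ⋯ ⊗ vₙ` in `H^{⊗ n}`. -/
def pureTensor (v : Fin n → H) : TensorPower H n :=
  ((algTensor v : AlgTensorPower H n) : UniformSpace.Completion (AlgTensorPower H n))

theorem inner_pureTensor (v w : Fin n → H) :
    ⟪pureTensor v, pureTensor w⟫_ℝ = ∏ i, ⟪v i, w i⟫_ℝ := by
  rw [pureTensor, pureTensor, UniformSpace.Completion.inner_coe]
  exact tensorForm_tprod v w

/-- The symmetrization `(1 / n!) ∑ σ, v_{σ(1)} ⊗ ⋯ ⊗ v_{σ(n)}` of `v₁ ⊗ ⋯ ⊗ vₙ`. -/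
def symTensor (v : Fin n → H) : TensorPower H n :=
  (n.factorial : ℝ)⁻¹ • ∑ σ : Equiv.Perm (Fin n), pureTensor (fun i => v (σ i))

end TensorPower

/-! ### Isonormal Gaussian processes, multiple integrals, Malliavin derivatives -/

section Wiener

variable {H : Type*} [NormedAddCommGroup H] [InnerProductSpace ℝ H]
  {Ω : Type*} [MeasurableSpace Ω]

/-- `W` is an isonormal Gaussian process over `H` on the probability space `(Ω, P)`. -/
structure IsIsonormal (W : H → Ω → ℝ) (P : Measure Ω) : Prop where
  gaussian : IsGaussianProcess W P
  mean_zero : ∀ h, ∫ ω, W h ω ∂P = 0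
  covariance : ∀ h k, ∫ ω, W h ω * W k ω ∂P = ⟪h, k⟫_ℝ

/-- The pairs `(f, F)` where `f = e_{j(1)} ⊗̂ ⋯ ⊗̂ e_{j(n)}` is a symmetrized product of members of
a (finite) orthonormal family and `F = ∏ₐ H_{kₐ}(W(eₐ))`, where `kₐ` is the number of times that
`eₐ` occurs in the product and `H_k` is the `k`-th (probabilists') Hermite polynomial. -/
def multipleIntegralBasic (W : H → Ω → ℝ) (n : ℕ) : Set (TensorPower H n × (Ω → ℝ)) :=
  {p | ∃ (m : ℕ) (e : Fin m → H) (j : Fin n → Fin m), Orthonormal ℝ e ∧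
    p.1 = symTensor (fun i => e (j i)) ∧
    p.2 = fun ω => ∏ a : Fin m, Polynomial.aeval (W (e a) ω)
      (Polynomial.hermite (Finset.univ.filter fun i => j i = a).card)}

/-- `F = I_n(f)`: the symmetric tensor `f` and the random variable `F` are the limits, in
`H^{⊗ n}` and in `L²(Ω)`, of linear combinations of the basic tensors and of the same linear
combinations of their multiple integrals. -/
def IsMultipleIntegral (W : H → Ω → ℝ) (P : Measure Ω) (n : ℕ) (f : TensorPower H n)
    (F : Ω → ℝ) : Prop :=
  MemLp F 2 P ∧ ∃ p : ℕ → TensorPower H n × (Ω → ℝ),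
    (∀ k, p k ∈ Submodule.span ℝ (multipleIntegralBasic W n)) ∧
    Tendsto (fun k => (p k).1) atTop (𝓝 f) ∧
    Tendsto (fun k => eLpNorm (fun ω => (p k).2 ω - F ω) 2 P) atTop (𝓝 0)

/-- The pairs `(F, DF)` where `F = φ(W(h₁), …, W(h_m))` is a cylindrical random variable, with `φ`
smooth and bounded with all its derivatives, and `DF = ∑ i, ∂ᵢφ(W(h₁), …, W(h_m)) hᵢ`. -/
def cylindricalDerivative (W : H → Ω → ℝ) : Set ((Ω → ℝ) × (Ω → H)) :=
  {p | ∃ (m : ℕ) (h : Fin m → H) (φ : (Fin m → ℝ) → ℝ), ContDiff ℝ (⊤ : ℕ∞) φ ∧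
    (∀ k : ℕ, ∃ B : ℝ, ∀ x, ‖iteratedFDeriv ℝ k φ x‖ ≤ B) ∧
    p.1 = (fun ω => φ fun i => W (h i) ω) ∧
    p.2 = fun ω => ∑ i, fderiv ℝ φ (fun l => W (h l) ω) (Pi.single i 1) • h i}

/-- `F ∈ 𝔻^{1,2}` and `DF` is (a version of) its Malliavin derivative: the derivative operator on
`𝔻^{1,2}` is the closure of the one on cylindrical random variables. -/
def IsMalliavinDerivative (W : H → Ω → ℝ) (P : Measure Ω) (F : Ω → ℝ) (DF : Ω → H) : Prop :=
  MemLp F 2 P ∧ MemLp DF 2 P ∧ ∃ p : ℕ → (Ω → ℝ) × (Ω → H),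
    (∀ k, p k ∈ cylindricalDerivative W) ∧
    Tendsto (fun k => eLpNorm (fun ω => (p k).1 ω - F ω) 2 P) atTop (𝓝 0) ∧
    Tendsto (fun k => eLpNorm (fun ω => (p k).2 ω - DF ω) 2 P) atTop (𝓝 0)

end Wiener

/-! ### Young integrals -/

section Young

variable {E : Type*} [NormedAddCommGroup E] [NormedSpace ℝ E]

/-- `I = ∫_a^b g dx`: the Riemann sums `∑ g(ξᵢ) (x(tᵢ₊₁) - x(tᵢ))` over tagged partitions of `[a,b]`
converge to `I` as the mesh tends to `0`. -/
def HasYoungIntegral (g : ℝ → ℝ) (x : ℝ → E) (a b : ℝ) (I : E) : Prop :=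
  ∀ ε > 0, ∃ δ > 0, ∀ (N : ℕ) (t : Fin (N + 1) → ℝ) (ξ : Fin N → ℝ),
    Monotone t → t 0 = a → t (Fin.last N) = b →
    (∀ i : Fin N, ξ i ∈ Set.Icc (t i.castSucc) (t i.succ)) →
    (∀ i : Fin N, t i.succ - t i.castSucc < δ) →
    ‖∑ i : Fin N, g (ξ i) • (x (t i.succ) - x (t i.castSucc)) - I‖ < ε

open Classical in
/-- The Young integral `∫_a^b g dx` (`0` if the Riemann sums do not converge). -/
def youngIntegral (g : ℝ → ℝ) (x : ℝ → E) (a b : ℝ) : E :=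
  if h : ∃ I, HasYoungIntegral g x a b I then h.choose else 0

end Young

/-! ### The assumptions on the kernels -/

section Kernels

variable {K : Type*} [NormedAddCommGroup K] [InnerProductSpace ℝ K]

/-- `f₀ = 0` and `0 < ‖f_t - f_s‖ ≤ C |t - s|^{θ/2}` for `0 ≤ s < t ≤ 1`, with `C > 0`, `θ > 1`. -/
def KernelRegularity (f : ℝ → K) (θ : ℝ) : Prop :=
  f 0 = 0 ∧ 1 < θ ∧ ∃ C : ℝ, 0 < C ∧ ∀ s t : ℝ, 0 ≤ s → s < t → t ≤ 1 →
    0 < ‖f t - f s‖ ∧ ‖f t - f s‖ ≤ C * |t - s| ^ (θ / 2)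

/-- The closed linear span of the increments of `f` along the two finite sequences
`u₀, …, u_k` and `r₀, …, r_l`. -/
def incrementSpan (f : ℝ → K) {k l : ℕ} (u : Fin (k + 1) → ℝ) (r : Fin (l + 1) → ℝ) :
    Submodule ℝ K :=
  (Submodule.span ℝ (Set.range (fun i : Fin k => f (u i.succ) - f (u i.castSucc)) ∪
    Set.range (fun i : Fin l => f (r i.succ) - f (r i.castSucc)))).topologicalClosure

instance [CompleteSpace K] (f : ℝ → K) {k l : ℕ} (u : Fin (k + 1) → ℝ) (r : Fin (l + 1) → ℝ) :
    (incrementSpan f u r).HasOrthogonalProjection := by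
  unfold incrementSpan
  infer_instance

/-- Quantitative linear independence of the increments, with constant `β`: for
`0 = u₀ < ⋯ < u_k = t₀ < t₁ < ⋯ < t_m = r₀ < r₁ < ⋯ < r_l ≤ 1` and `(a₁, …, a_m) ≠ 0`, the vector
`Γ = ∑ aᵢ (f_{tᵢ} - f_{tᵢ₋₁})` satisfies `‖Γ - P Γ‖² > β ‖Γ‖²`, where `P` is the orthogonal projection
onto the closed span of the increments of `f` along `u` and along `r`. -/
def KernelNondeterminism [CompleteSpace K] (f : ℝ → K) (β : ℝ) : Prop :=
  ∀ (m k l : ℕ) (a : Fin m → ℝ) (t : Fin (m + 1) → ℝ) (u : Fin (k + 1) → ℝ)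
    (r : Fin (l + 1) → ℝ), a ≠ 0 → StrictMono t → StrictMono u → StrictMono r →
    u 0 = 0 → u (Fin.last k) = t 0 → t (Fin.last m) = r 0 → r (Fin.last l) ≤ 1 →
    ∀ Γ : K, Γ = ∑ i, a i • (f (t i.succ) - f (t i.castSucc)) →
      β * ‖Γ‖ ^ 2 < ‖Γ - (incrementSpan f u r).starProjection Γ‖ ^ 2

/-- `⟨f_v - f_u, f_t - f_s⟩ ≥ 0` whenever `[u, v] ⊆ [s, t] ⊆ [0, 1]`. -/
def KernelNonnegRowSums (f : ℝ → K) : Prop :=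
  ∀ s u v t : ℝ, 0 ≤ s → s ≤ u → u ≤ v → v ≤ t → t ≤ 1 → 0 ≤ ⟪f v - f u, f t - f s⟫_ℝ

end Kernels

end WienerChaos

end

/-! The maps `f ↦ I_n(f)` and `f ↦ D I_n(f)` multiply squared norms by `n!` and `n * n!`. Hence the
mean square of `∫ g dDX` equals `n * n! * ‖∫ g df‖²`, where `∫ g df` is a deterministic Young
integral in the Hilbert tensor power. Both integrals come from a single Young integral in the
closure of the space of triples `(f, I_n(f), D I_n(f))` (`chaosTriples`), by applying the continuous
coordinate projections.

Lower bound: let `g ≥ b > 0` on `[s, t]`. A Riemann sum of `∫ g df` splits into pieces over `[0,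
s]`, `[s, t]` and `[t, 1]`. Nondeterminism discards the two outer pieces at the price of `β`, and
nonnegative row sums bound the middle piece below by `b * ‖f t - f s‖`
(`KernelNondeterminism.norm_young_ge`). Multiplied by `n * n!`, this says `n β b² E(X_t - X_s)² ≤
E‖∫ g dDX‖²`. The final estimate (`abs_le_max_of_local_lower_bound`) uses it with `b = |g r| / 2`,
either on all of `[0, 1]` or on an interval at `r` whose length comes from the Hölder constant;
there the variance lower bound enters.

Pathwise existence: Kolmogorov's criterion (`ae_exists_holderUnit`) needs high moments of `DX_t -
DX_s`. They are controlled by `‖f t - f s‖` through hypercontractivity on a fixed chaos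
(`exists_hypercontractive_const`), proved by induction on the degree from Gaussian integration by
parts. The pathwise integral then agrees almost surely with the `L²` one
(`HasYoungIntegral.youngIntegral_ae_eq`).

The Malliavin derivative is a closure over bounded cylindrical functionals, whereas `I_n` is built
from Hermite polynomials. Both kinds are smooth functionals of temperate growth (`IsSmoothPair`), on
which the gradient takes values in the domain of its adjoint and is therefore closable. So `DX_t` is
the limit of the polynomial gradients (`mem_closure_chaosTriples`). -/

noncomputable section

namespace WienerChaos

/-! ### Young integration of Hölder functions along Hölder paths. -/

section YoungTheory

variable {E : Type*} [NormedAddCommGroup E]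

/-- `x` is `r`-Hölder on `[0, 1]` with constant `A`. -/
def HolderUnit (x : ℝ → E) (A r : ℝ) : Prop :=
  ∀ s t : ℝ, 0 ≤ s → s ≤ t → t ≤ 1 → ‖x t - x s‖ ≤ A * (t - s) ^ r

theorem HolderUnit.continuousOn {x : ℝ → E} {A r : ℝ} (hx : HolderUnit x A r) (hr : 0 < r) :
    ContinuousOn x (Set.Icc 0 1) := by
  have key : ∀ s ∈ Set.Icc (0 : ℝ) 1, ∀ t ∈ Set.Icc (0 : ℝ) 1, ‖x t - x s‖ ≤ A * |t - s| ^ r := by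
    intro s hs t ht
    rcases le_total s t with h | h
    · rw [abs_of_nonneg (sub_nonneg.2 h)]
      exact hx s t hs.1 h ht.2
    · rw [abs_sub_comm, norm_sub_rev, abs_of_nonneg (sub_nonneg.2 h)]
      exact hx t s ht.1 h hs.2
  intro s hs
  rw [ContinuousWithinAt, tendsto_iff_norm_sub_tendsto_zero]
  have h0 : Tendsto (fun t : ℝ => A * |t - s| ^ r) (𝓝[Set.Icc 0 1] s) (𝓝 0) := by
    have : ContinuousAt (fun t : ℝ => A * |t - s| ^ r) s := by
      refine continuousAt_const.mul (ContinuousAt.rpow_const (by fun_prop) (Or.inr hr.le))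
    have h1 := this.tendsto
    simp only [sub_self, abs_zero, Real.zero_rpow hr.ne', mul_zero] at h1
    exact h1.mono_left nhdsWithin_le_nhds
  refine squeeze_zero' (Eventually.of_forall fun _ => norm_nonneg _) ?_ h0
  filter_upwards [self_mem_nhdsWithin] with t ht using key s hs t ht

variable [NormedSpace ℝ E]

/-- Discrete sewing. A block of `m` steps is cut into two blocks of length `m / 2`, with one middle
step left over when `m` is odd. Moving the evaluation point of `a` from `i` to the start of the
middle step and of the last block costs at most `A * B * (m * h) ^ (τ + ρ)` each. As `τ + ρ > 1`,
the two halves together carry a factor below `1`, so a strong induction closes with a constant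
independent of `N`. -/
theorem norm_sum_smul_increment_sub_le (a : ℕ → ℝ) (y : ℕ → E) {A B h τ ρ : ℝ} (hA : 0 ≤ A)
    (hB : 0 ≤ B) (hh : 0 ≤ h) (hτ : 0 ≤ τ) (hρ : 0 ≤ ρ) (hτρ : 1 < τ + ρ) (N : ℕ)
    (ha : ∀ i j, i ≤ j → j ≤ N → |a j - a i| ≤ A * (((j - i : ℕ) : ℝ) * h) ^ τ)
    (hy : ∀ i j, i ≤ j → j ≤ N → ‖y j - y i‖ ≤ B * (((j - i : ℕ) : ℝ) * h) ^ ρ) (m i : ℕ)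
    (hm : i + m ≤ N) :
    ‖∑ k ∈ Finset.Ico i (i + m), a k • (y (k + 1) - y k) - a i • (y (i + m) - y i)‖ ≤
      2 * A * B / (1 - 2 ^ (1 - (τ + ρ))) * ((m : ℝ) * h) ^ (τ + ρ) := by
  set α := τ + ρ with hα
  have h2 : (2 : ℝ) ^ (1 - α) < 1 := Real.rpow_lt_one_of_one_lt_of_neg (by norm_num) (by linarith)
  have hD : 0 < 1 - (2 : ℝ) ^ (1 - α) := by linarith
  -- `D` is the fixed point of the halving recursion `D = 2 * D * 2 ^ (-α) + 2 * A * B`.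
  set D := 2 * A * B / (1 - (2 : ℝ) ^ (1 - α)) with hDdef
  have hDnn : 0 ≤ D := by positivity
  induction m using Nat.strong_induction_on generalizing i with
  | _ m ih =>
    have hAB : ∀ j l, i ≤ j → j ≤ l → l ≤ i + m →
        ‖(a j - a i) • (y l - y j)‖ ≤ A * B * ((m : ℝ) * h) ^ α := by
      intro j l hj hjl hl
      rw [norm_smul, Real.norm_eq_abs, hα, Real.rpow_add_of_nonneg (by positivity) hτ hρ]
      have e1 : |a j - a i| ≤ A * ((m : ℝ) * h) ^ τ := by
        refine (ha i j hj (by omega)).trans ?_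
        gcongr
        omega
      have e2 : ‖y l - y j‖ ≤ B * ((m : ℝ) * h) ^ ρ := by
        refine (hy j l hjl (by omega)).trans ?_
        gcongr
        omega
      calc |a j - a i| * ‖y l - y j‖ ≤ (A * ((m : ℝ) * h) ^ τ) * (B * ((m : ℝ) * h) ^ ρ) := by
            gcongr
        _ = _ := by ring
    rcases Nat.lt_or_ge m 2 with hm2 | hm2
    · have : m = 0 ∨ m = 1 := by omega
      rcases this with rfl | rfl
      · simp
        positivity
      · simp
        positivity
    · set p := m / 2 with hp
      set q := m - p with hq
      have hpq : m = q + p := by omega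
      have hpm : 2 * p ≤ m := by omega
      set S : ℕ → ℕ → E := fun u v => ∑ k ∈ Finset.Ico u v, a k • (y (k + 1) - y k) with hS
      have hsplit : S i (i + m) = S i (i + p) + S (i + p) (i + q) + S (i + q) (i + m) := by
        simp only [hS]
        rw [Finset.sum_Ico_consecutive _ (by omega) (by omega),
          Finset.sum_Ico_consecutive _ (by omega) (by omega)]
      have hmid : S (i + p) (i + q) = a (i + p) • (y (i + q) - y (i + p)) := by
        have : q = p ∨ q = p + 1 := by omega
        rcases this with e | e
        · simp [hS, e]
        · simp [hS, e, ← add_assoc]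
      have i1 := ih p (by omega) i (by omega)
      have i2 := ih p (by omega) (i + q) (by omega)
      rw [show i + q + p = i + m by omega] at i2
      have e3 : ((p : ℝ) * h) ^ α ≤ 2 ^ (-α) * ((m : ℝ) * h) ^ α := by
        have : (2 : ℝ) ^ (-α) = (1 / 2 : ℝ) ^ α := by
          rw [Real.rpow_neg (by norm_num), one_div, Real.inv_rpow (by norm_num)]
        rw [this, ← Real.mul_rpow (by norm_num) (by positivity)]
        have : (2 * p : ℝ) ≤ m := by exact_mod_cast hpm
        apply Real.rpow_le_rpow (by positivity) _ (by linarith)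
        nlinarith
      have key : S i (i + m) - a i • (y (i + m) - y i) =
          (S i (i + p) - a i • (y (i + p) - y i)) +
          (S (i + q) (i + m) - a (i + q) • (y (i + m) - y (i + q))) +
          (a (i + p) - a i) • (y (i + q) - y (i + p)) +
          (a (i + q) - a i) • (y (i + m) - y (i + q)) := by
        rw [hsplit, hmid]
        module
      have hb1 := hAB (i + p) (i + q) (by omega) (by omega) (by omega)
      have hb2 := hAB (i + q) (i + m) (by omega) (by omega) (by omega)
      change ‖S i (i + m) - _‖ ≤ _
      rw [key]
      have hDe : D * (1 - (2 : ℝ) ^ (1 - α)) = 2 * A * B := by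
        rw [hDdef]; field_simp
      have h2e : (2 : ℝ) ^ (1 - α) = 2 * 2 ^ (-α) := by
        rw [sub_eq_add_neg, Real.rpow_add (by norm_num), Real.rpow_one]
      calc _ ≤ D * ((p : ℝ) * h) ^ α + D * ((p : ℝ) * h) ^ α + A * B * ((m : ℝ) * h) ^ α
            + A * B * ((m : ℝ) * h) ^ α :=
            (norm_add_le _ _).trans (add_le_add ((norm_add_le _ _).trans
              (add_le_add ((norm_add_le _ _).trans (add_le_add i1 i2)) hb1)) hb2)
        _ ≤ D * (2 ^ (-α) * ((m : ℝ) * h) ^ α) + D * (2 ^ (-α) * ((m : ℝ) * h) ^ α)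
            + A * B * ((m : ℝ) * h) ^ α + A * B * ((m : ℝ) * h) ^ α := by gcongr
        _ = (D * 2 ^ (1 - α) + 2 * A * B) * ((m : ℝ) * h) ^ α := by rw [h2e]; ring
        _ = _ := by rw [← hDe]; ring

/-- The left endpoint of the dyadic interval of length `2⁻ⁿ` containing `t`. -/
def dyadicFloor (n : ℕ) (t : ℝ) : ℝ := (⌊t * 2 ^ n⌋₊ : ℝ) / 2 ^ n

theorem dyadicFloor_le (n : ℕ) {t : ℝ} (ht : 0 ≤ t) : dyadicFloor n t ≤ t := by
  rw [dyadicFloor, div_le_iff₀ (by positivity)]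
  exact Nat.floor_le (by positivity)

theorem dyadicFloor_nonneg (n : ℕ) (t : ℝ) : 0 ≤ dyadicFloor n t := by
  unfold dyadicFloor; positivity

theorem sub_dyadicFloor_le (n : ℕ) (t : ℝ) : t - dyadicFloor n t ≤ (1 / 2) ^ n := by
  have := Nat.lt_floor_add_one (t * 2 ^ n)
  rw [dyadicFloor, sub_le_iff_le_add, one_div, inv_pow, ← one_div, ← add_div,
    le_div_iff₀ (by positivity)]
  linarith

theorem tendsto_dyadicFloor {t : ℝ} (ht : 0 ≤ t) :
    Tendsto (fun n => dyadicFloor n t) atTop (𝓝 t) := by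
  have h : Tendsto (fun n : ℕ => t - (1 / 2 : ℝ) ^ n) atTop (𝓝 t) := by
    simpa using tendsto_const_nhds.sub
      (tendsto_pow_atTop_nhds_zero_of_lt_one (r := (1 / 2 : ℝ)) (by norm_num) (by norm_num))
  exact tendsto_of_tendsto_of_tendsto_of_le_of_le h tendsto_const_nhds
    (fun n => by have := sub_dyadicFloor_le n t; simp only; linarith)
    (fun n => dyadicFloor_le n ht)

theorem tendsto_comp_dyadicFloor {F : Type*} [TopologicalSpace F] {y : ℝ → F}
    (hy : ContinuousOn y (Set.Icc 0 1)) (r : ℝ) (hr : 0 ≤ r) (hr1 : r ≤ 1) :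
    Tendsto (fun n => y (dyadicFloor n r)) atTop (𝓝 (y r)) :=
  (hy r ⟨hr, hr1⟩).tendsto.comp (tendsto_nhdsWithin_iff.2 ⟨tendsto_dyadicFloor hr,
    Eventually.of_forall fun n =>
      ⟨dyadicFloor_nonneg n r, (dyadicFloor_le n hr).trans hr1⟩⟩)

theorem floor_mul_two_pow_succ (n : ℕ) {t : ℝ} (ht : 0 ≤ t) :
    ⌊t * 2 ^ (n + 1)⌋₊ = 2 * ⌊t * 2 ^ n⌋₊ ∨ ⌊t * 2 ^ (n + 1)⌋₊ = 2 * ⌊t * 2 ^ n⌋₊ + 1 := by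
  have h0 : 0 ≤ t * 2 ^ n := by positivity
  have h1 := Nat.floor_le h0
  have h2 := Nat.lt_floor_add_one (t * 2 ^ n)
  have h3 : 2 * ⌊t * 2 ^ n⌋₊ ≤ ⌊t * 2 ^ (n + 1)⌋₊ := by
    apply Nat.le_floor
    push_cast
    rw [pow_succ]
    linarith
  have h4 : ⌊t * 2 ^ (n + 1)⌋₊ < 2 * ⌊t * 2 ^ n⌋₊ + 2 := by
    rw [Nat.floor_lt (by positivity)]
    push_cast
    rw [pow_succ]
    linarith
  omega

theorem floor_mul_two_pow_le (n : ℕ) {t : ℝ} (ht : t ≤ 1) :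
    ⌊t * 2 ^ n⌋₊ ≤ 2 ^ n := by
  have : t * 2 ^ n ≤ ((2 ^ n : ℕ) : ℝ) := by
    push_cast
    have : (0 : ℝ) < 2 ^ n := by positivity
    nlinarith
  exact Nat.floor_le_of_le this

/-- The left Riemann sums along the dyadic grid. -/
def dyadicSum (g : ℝ → ℝ) (x : ℝ → E) (n : ℕ) (t : ℝ) : E :=
  ∑ k ∈ Finset.range ⌊t * 2 ^ n⌋₊,
    g ((k : ℝ) / 2 ^ n) • (x (((k + 1 : ℕ) : ℝ) / 2 ^ n) - x ((k : ℝ) / 2 ^ n))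

/-- Each coarse block gains its midpoint, which changes its term by `(g(mid) - g(left)) • (x(right)
- x(mid))`; at most `2 ^ n` blocks give the first summand. The second pays for the extra fine step
present when `⌊t * 2 ^ (n + 1)⌋₊` is odd. -/
theorem norm_dyadicSum_succ_sub_le {g : ℝ → ℝ} {x : ℝ → E} {A B τ ρ G : ℝ} (hA : 0 ≤ A)
    (hB : 0 ≤ B) (hτ : 0 ≤ τ) (hρ : 0 ≤ ρ)
    (hg : HolderUnit g A τ) (hx : HolderUnit x B ρ) (hG : ∀ t ∈ Set.Icc (0 : ℝ) 1, |g t| ≤ G)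
    (n : ℕ) {t : ℝ} (ht : 0 ≤ t) (ht1 : t ≤ 1) :
    ‖dyadicSum g x (n + 1) t - dyadicSum g x n t‖ ≤
      A * B * (2 ^ (1 - (τ + ρ))) ^ n + G * B * (2 ^ (-ρ)) ^ n := by
  set u : ℕ → ℝ := fun k => (k : ℝ) / 2 ^ (n + 1) with hu
  have hu2 : ∀ k : ℕ, (k : ℝ) / 2 ^ n = u (2 * k) := by
    intro k
    simp only [hu, pow_succ]
    push_cast
    field_simp
  set K := ⌊t * 2 ^ n⌋₊ with hK
  set h : ℝ := 1 / 2 ^ (n + 1) with hh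
  have hK2 : K ≤ 2 ^ n := floor_mul_two_pow_le n ht1
  have hu0 : ∀ k, 0 ≤ u k := fun k => by simp only [hu]; positivity
  have hu1 : ∀ k, k ≤ 2 ^ (n + 1) → u k ≤ 1 := fun k hk => by
    simp only [hu]
    rw [div_le_one (by positivity)]
    exact_mod_cast hk
  have hus : ∀ k, u (k + 1) - u k = h := fun k => by
    simp only [hu, hh]; push_cast; ring
  have hule : ∀ k, u k ≤ u (k + 1) := fun k => by
    have := hus k; have : 0 ≤ h := by positivity
    linarith
  have hgs : ∀ k, k + 1 ≤ 2 ^ (n + 1) → |g (u (k + 1)) - g (u k)| ≤ A * h ^ τ := fun k hk => by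
    simpa [hus] using hg _ _ (hu0 k) (hule k) (hu1 _ hk)
  have hxs : ∀ k, k + 1 ≤ 2 ^ (n + 1) → ‖x (u (k + 1)) - x (u k)‖ ≤ B * h ^ ρ := fun k hk => by
    simpa [hus] using hx _ _ (hu0 k) (hule k) (hu1 _ hk)
  have hhpow : ∀ r : ℝ, 0 ≤ r → h ^ r ≤ (2 ^ (-r)) ^ n := by
    intro r hr
    have e : ((2 : ℝ) ^ (-r)) ^ n = (1 / 2 ^ n : ℝ) ^ r := by
      rw [← Real.rpow_natCast, ← Real.rpow_mul (by norm_num), one_div,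
        Real.inv_rpow (by positivity), ← Real.rpow_natCast, ← Real.rpow_mul (by norm_num),
        ← Real.rpow_neg (by norm_num)]
      ring_nf
    rw [e]
    apply Real.rpow_le_rpow (by positivity) _ hr
    rw [hh]
    gcongr
    · norm_num
    · omega
  have hs1 : dyadicSum g x n t = ∑ k ∈ Finset.range K,
      (g (u (2 * k)) • (x (u (2 * k + 1)) - x (u (2 * k))) +
        g (u (2 * k)) • (x (u (2 * k + 1 + 1)) - x (u (2 * k + 1)))) := by
    unfold dyadicSum
    refine Finset.sum_congr rfl fun k _ => ?_
    rw [hu2, hu2, show 2 * (k + 1) = 2 * k + 1 + 1 by ring]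
    module
  have hs2 : ∀ K : ℕ, ∑ k ∈ Finset.range (2 * K), g (u k) • (x (u (k + 1)) - x (u k)) =
      ∑ k ∈ Finset.range K, (g (u (2 * k)) • (x (u (2 * k + 1)) - x (u (2 * k))) +
        g (u (2 * k + 1)) • (x (u (2 * k + 1 + 1)) - x (u (2 * k + 1)))) := by
    intro K
    induction K with
    | zero => simp
    | succ K ih =>
      rw [Finset.sum_range_succ, ← ih, show 2 * (K + 1) = 2 * K + 1 + 1 by ring,
        Finset.sum_range_succ, Finset.sum_range_succ, add_assoc]
  have hmain : ‖∑ k ∈ Finset.range (2 * K), g (u k) • (x (u (k + 1)) - x (u k)) -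
      dyadicSum g x n t‖ ≤ A * B * (2 ^ (1 - (τ + ρ))) ^ n := by
    rw [hs1, hs2, ← Finset.sum_sub_distrib]
    have : ∀ k ∈ Finset.range K, ‖(g (u (2 * k)) • (x (u (2 * k + 1)) - x (u (2 * k))) +
        g (u (2 * k + 1)) • (x (u (2 * k + 1 + 1)) - x (u (2 * k + 1)))) -
        (g (u (2 * k)) • (x (u (2 * k + 1)) - x (u (2 * k))) +
        g (u (2 * k)) • (x (u (2 * k + 1 + 1)) - x (u (2 * k + 1))))‖ ≤
        A * B * (2 ^ (-(τ + ρ))) ^ n := by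
      intro k hk
      rw [Finset.mem_range] at hk
      have hk' : 2 * k + 1 + 1 ≤ 2 ^ (n + 1) := by rw [pow_succ]; omega
      rw [add_sub_add_left_eq_sub, ← sub_smul, norm_smul, Real.norm_eq_abs]
      calc _ ≤ (A * h ^ τ) * (B * h ^ ρ) := by
            gcongr
            · exact hgs _ (by omega)
            · exact hxs _ hk'
        _ = A * B * h ^ (τ + ρ) := by rw [Real.rpow_add_of_nonneg (by positivity) hτ hρ]; ring
        _ ≤ _ := by gcongr; exact hhpow _ (by linarith)
    refine (norm_sum_le_of_le _ this).trans ?_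
    rw [Finset.sum_const, Finset.card_range, nsmul_eq_mul]
    have e : ((2 : ℝ) ^ (1 - (τ + ρ))) ^ n = 2 ^ n * (2 ^ (-(τ + ρ))) ^ n := by
      rw [← mul_pow, sub_eq_add_neg, Real.rpow_add (by norm_num), Real.rpow_one]
    rw [e]
    have : (K : ℝ) ≤ 2 ^ n := by exact_mod_cast hK2
    calc (K : ℝ) * (A * B * (2 ^ (-(τ + ρ))) ^ n) ≤ 2 ^ n * (A * B * (2 ^ (-(τ + ρ))) ^ n) := by
          gcongr
      _ = _ := by ring
  have hG0 : 0 ≤ G := (abs_nonneg _).trans (hG 0 (by simp))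
  rcases floor_mul_two_pow_succ n ht with e | e
  · have : dyadicSum g x (n + 1) t =
        ∑ k ∈ Finset.range (2 * K), g (u k) • (x (u (k + 1)) - x (u k)) := by
      rw [dyadicSum, e]
    rw [this]
    have : 0 ≤ G * B * ((2 : ℝ) ^ (-ρ)) ^ n := by positivity
    linarith
  · have hK3 : 2 * K + 1 ≤ 2 ^ (n + 1) := by
      rw [← e]; exact floor_mul_two_pow_le (n + 1) ht1
    have : dyadicSum g x (n + 1) t =
        ∑ k ∈ Finset.range (2 * K), g (u k) • (x (u (k + 1)) - x (u k)) +
        g (u (2 * K)) • (x (u (2 * K + 1)) - x (u (2 * K))) := by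
      rw [dyadicSum, e, Finset.sum_range_succ]
    rw [this, add_sub_right_comm]
    refine (norm_add_le _ _).trans (add_le_add hmain ?_)
    rw [norm_smul, Real.norm_eq_abs, mul_assoc]
    gcongr
    · exact hG _ ⟨hu0 _, hu1 _ (by omega)⟩
    · exact (hxs _ hK3).trans (by gcongr; exact hhpow _ hρ)

/-- `J` is the limit of the dyadic sums, whose successive differences are geometrically summable.
The estimate passes to the limit from the discrete one between the dyadic floors of `s` and `t`,
whose constant is the same at every level. -/
theorem exists_young_primitive [CompleteSpace E] {g : ℝ → ℝ} {x : ℝ → E} {A B τ ρ : ℝ}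
    (hA : 0 ≤ A) (hB : 0 ≤ B) (hτ : 0 < τ) (hρ : 0 < ρ) (hτρ : 1 < τ + ρ)
    (hg : HolderUnit g A τ) (hx : HolderUnit x B ρ) :
    ∃ (J : ℝ → E) (D : ℝ), 0 ≤ D ∧ ∀ s t : ℝ, 0 ≤ s → s ≤ t → t ≤ 1 →
      ‖J t - J s - g s • (x t - x s)‖ ≤ D * (t - s) ^ (τ + ρ) := by
  obtain ⟨G, hG⟩ : ∃ G, ∀ t ∈ Set.Icc (0 : ℝ) 1, |g t| ≤ G := by
    obtain ⟨G, hG⟩ := isCompact_Icc.exists_bound_of_continuousOn (hg.continuousOn hτ)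
    exact ⟨G, fun t ht => by simpa using hG t ht⟩
  have hG0 : 0 ≤ G := (abs_nonneg _).trans (hG 0 (by simp))
  have h2 : (2 : ℝ) ^ (1 - (τ + ρ)) < 1 :=
    Real.rpow_lt_one_of_one_lt_of_neg (by norm_num) (by linarith)
  have h2' : (2 : ℝ) ^ (-ρ) < 1 :=
    Real.rpow_lt_one_of_one_lt_of_neg (by norm_num) (by linarith)
  have hlim : ∀ t : ℝ, ∃ y, 0 ≤ t → t ≤ 1 → Tendsto (fun n => dyadicSum g x n t) atTop (𝓝 y) := by
    intro t
    by_cases ht : 0 ≤ t ∧ t ≤ 1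
    · have hc : CauchySeq (fun n => dyadicSum g x n t) := by
        refine cauchySeq_of_dist_le_of_summable
          (fun n => A * B * (2 ^ (1 - (τ + ρ))) ^ n + G * B * (2 ^ (-ρ)) ^ n) (fun n => ?_) ?_
        · rw [dist_comm, dist_eq_norm]
          exact norm_dyadicSum_succ_sub_le hA hB hτ.le hρ.le hg hx hG n ht.1 ht.2
        · exact ((summable_geometric_of_lt_one (by positivity) h2).mul_left _).add
            ((summable_geometric_of_lt_one (by positivity) h2').mul_left _)
      obtain ⟨y, hy⟩ := cauchySeq_tendsto_of_complete hc
      exact ⟨y, fun _ _ => hy⟩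
    · exact ⟨0, fun h h' => absurd ⟨h, h'⟩ ht⟩
  choose J hJ using hlim
  set D := 2 * A * B / (1 - (2 : ℝ) ^ (1 - (τ + ρ))) with hD
  have hD0 : 0 ≤ D := by
    have : 0 < 1 - (2 : ℝ) ^ (1 - (τ + ρ)) := by linarith
    positivity
  refine ⟨J, D, hD0, fun s t hs hst ht => ?_⟩
  have hs1 : s ≤ 1 := hst.trans ht
  have ht0 : 0 ≤ t := hs.trans hst
  have hgc := tendsto_comp_dyadicFloor (hg.continuousOn hτ) s hs hs1
  have hxs := tendsto_comp_dyadicFloor (hx.continuousOn hρ) s hs hs1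
  have hxt := tendsto_comp_dyadicFloor (hx.continuousOn hρ) t ht0 ht
  have hL : Tendsto (fun n => ‖dyadicSum g x n t - dyadicSum g x n s -
      g (dyadicFloor n s) • (x (dyadicFloor n t) - x (dyadicFloor n s))‖) atTop
      (𝓝 ‖J t - J s - g s • (x t - x s)‖) :=
    (((hJ t ht0 ht).sub (hJ s hs hs1)).sub (hgc.smul (hxt.sub hxs))).norm
  have hR : Tendsto (fun n => D * (dyadicFloor n t - dyadicFloor n s) ^ (τ + ρ)) atTop
      (𝓝 (D * (t - s) ^ (τ + ρ))) :=
    (((tendsto_dyadicFloor ht0).sub (tendsto_dyadicFloor hs)).rpow_const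
      (Or.inr (by linarith))).const_mul D
  refine le_of_tendsto_of_tendsto' hL hR fun n => ?_
  have hij : ⌊s * 2 ^ n⌋₊ ≤ ⌊t * 2 ^ n⌋₊ := Nat.floor_mono (by gcongr)
  have hu : ∀ i j : ℕ, i ≤ j → j ≤ 2 ^ n → 0 ≤ (i : ℝ) / 2 ^ n ∧ (i : ℝ) / 2 ^ n ≤ (j : ℝ) / 2 ^ n ∧
      (j : ℝ) / 2 ^ n ≤ 1 := fun i j hij hj =>
    ⟨by positivity, by gcongr, by rw [div_le_one (by positivity)]; exact_mod_cast hj⟩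
  have hdiff : ∀ i j : ℕ, i ≤ j →
      (j : ℝ) / 2 ^ n - (i : ℝ) / 2 ^ n = ((j - i : ℕ) : ℝ) * (1 / 2 ^ n) := fun i j hij => by
    rw [Nat.cast_sub hij]; ring
  have key := norm_sum_smul_increment_sub_le (fun k => g ((k : ℝ) / 2 ^ n))
    (fun k => x ((k : ℝ) / 2 ^ n)) (h := 1 / 2 ^ n) hA hB (by positivity) hτ.le hρ.le hτρ (2 ^ n)
    (fun i j hij hj => by
      have := hg _ _ (hu i j hij hj).1 (hu i j hij hj).2.1 (hu i j hij hj).2.2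
      rwa [hdiff i j hij] at this)
    (fun i j hij hj => by
      have := hx _ _ (hu i j hij hj).1 (hu i j hij hj).2.1 (hu i j hij hj).2.2
      rwa [hdiff i j hij] at this)
    (⌊t * 2 ^ n⌋₊ - ⌊s * 2 ^ n⌋₊) ⌊s * 2 ^ n⌋₊
    (by rw [Nat.add_sub_cancel' hij]; exact floor_mul_two_pow_le n ht)
  rw [Nat.add_sub_cancel' hij, ← hdiff _ _ hij] at key
  rw [dyadicSum, dyadicSum, ← Finset.sum_Ico_eq_sub _ hij]
  exact key

theorem sum_fin_sub_eq {F : Type*} [AddCommGroup F] (N : ℕ) (y : Fin (N + 1) → F) :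
    ∑ i : Fin N, (y i.succ - y i.castSucc) = y (Fin.last N) - y 0 := by
  induction N with
  | zero => simp
  | succ N ih =>
    rw [Fin.sum_univ_castSucc]
    have := ih (fun i => y i.castSucc)
    simp only [Fin.castSucc_zero] at this
    simp only [← Fin.castSucc_succ] at this ⊢
    rw [this]
    simp

/-- Young's theorem: all integrals of a Hölder function along a Hölder path are increments of one
function. -/
theorem exists_hasYoungIntegral [CompleteSpace E] {g : ℝ → ℝ} {x : ℝ → E} {A B τ ρ : ℝ}
    (hA : 0 ≤ A) (hB : 0 ≤ B) (hτ : 0 < τ) (hρ : 0 < ρ) (hτρ : 1 < τ + ρ)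
    (hg : HolderUnit g A τ) (hx : HolderUnit x B ρ) :
    ∃ J : ℝ → E, ∀ a b : ℝ, 0 ≤ a → a ≤ b → b ≤ 1 → HasYoungIntegral g x a b (J b - J a) := by
  obtain ⟨J, D, hD, hJ⟩ := exists_young_primitive hA hB hτ hρ hτρ hg hx
  refine ⟨J, fun a b ha hab hb ε hε => ?_⟩
  set M := D + A * B + 1 with hM
  have hMpos : 0 < M := by positivity
  have hα : 0 < τ + ρ - 1 := by linarith
  -- This mesh satisfies `M * δ ^ (τ + ρ - 1) = ε / 2`. A step of length `d` then errs by at most `ε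
  -- / 2 * d`, and the steps add up to `b - a ≤ 1`.
  refine ⟨(ε / (2 * M)) ^ (1 / (τ + ρ - 1)), by positivity, fun N t ξ hmono h0 hN hξ hmesh => ?_⟩
  set δ := (ε / (2 * M)) ^ (1 / (τ + ρ - 1)) with hδ
  have hδpow : δ ^ (τ + ρ - 1) = ε / (2 * M) := by
    rw [hδ, ← Real.rpow_mul (by positivity), one_div_mul_cancel hα.ne', Real.rpow_one]
  have htel : J b - J a = ∑ i : Fin N, (J (t i.succ) - J (t i.castSucc)) := by
    rw [sum_fin_sub_eq N (fun i => J (t i)), h0, hN]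
  have htel' : b - a = ∑ i : Fin N, (t i.succ - t i.castSucc) := by
    rw [sum_fin_sub_eq N t, h0, hN]
  have hbound : ∀ i : Fin N, ‖g (ξ i) • (x (t i.succ) - x (t i.castSucc)) -
      (J (t i.succ) - J (t i.castSucc))‖ ≤ ε / 2 * (t i.succ - t i.castSucc) := by
    intro i
    have hi0 : 0 ≤ t i.castSucc := ha.trans (h0 ▸ hmono (Fin.zero_le _))
    have hi1 : t i.succ ≤ 1 := (hN ▸ hmono (Fin.le_last _) : t i.succ ≤ b).trans hb
    have hi : t i.castSucc ≤ t i.succ := hmono (Fin.castSucc_lt_succ).le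
    set d := t i.succ - t i.castSucc with hd
    have hd0 : 0 ≤ d := sub_nonneg.2 hi
    have h1 := hJ _ _ hi0 hi hi1
    have h2 : ‖(g (ξ i) - g (t i.castSucc)) • (x (t i.succ) - x (t i.castSucc))‖ ≤
        A * B * d ^ (τ + ρ) := by
      rw [norm_smul, Real.rpow_add_of_nonneg hd0 hτ.le hρ.le]
      have e1 : ‖g (ξ i) - g (t i.castSucc)‖ ≤ A * d ^ τ := by
        refine (hg _ _ hi0 (hξ i).1 ((hξ i).2.trans hi1)).trans ?_
        have := (hξ i).1
        have := (hξ i).2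
        gcongr
        · linarith
      calc _ ≤ (A * d ^ τ) * (B * d ^ ρ) := by
            gcongr
            exact hx _ _ hi0 hi hi1
        _ = _ := by ring
    have e : g (ξ i) • (x (t i.succ) - x (t i.castSucc)) - (J (t i.succ) - J (t i.castSucc)) =
        (g (ξ i) - g (t i.castSucc)) • (x (t i.succ) - x (t i.castSucc)) -
        (J (t i.succ) - J (t i.castSucc) - g (t i.castSucc) •
          (x (t i.succ) - x (t i.castSucc))) := by module
    rw [e]
    have hpow : d ^ (τ + ρ) ≤ ε / (2 * M) * d := by
      rcases hd0.eq_or_lt with h | h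
      · rw [← h, Real.zero_rpow (by linarith)]; simp
      · have : d ^ (τ + ρ) = d ^ (τ + ρ - 1) * d := by
          rw [← Real.rpow_add_one h.ne']; congr 1; ring
        rw [this, ← hδpow]
        gcongr
        exact (hmesh i).le
    calc _ ≤ A * B * d ^ (τ + ρ) + D * d ^ (τ + ρ) := (norm_sub_le _ _).trans (add_le_add h2 h1)
      _ = (D + A * B) * d ^ (τ + ρ) := by ring
      _ ≤ M * d ^ (τ + ρ) := by
          have : 0 ≤ d ^ (τ + ρ) := by positivity
          rw [hM]; nlinarith
      _ ≤ M * (ε / (2 * M) * d) := by gcongr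
      _ = _ := by field_simp
  rw [htel, ← Finset.sum_sub_distrib]
  refine (norm_sum_le_of_le _ fun i _ => hbound i).trans_lt ?_
  rw [← Finset.mul_sum, ← htel']
  nlinarith

end YoungTheory

/-! ### From dyadic increments to Hölder continuity. -/

section Chaining

variable {E : Type*} [NormedAddCommGroup E]

/-- A continuous path whose increments along the dyadic grids are `O(2^{-nρ})` is `ρ`-Hölder. -/
theorem holderUnit_of_dyadic {x : ℝ → E} {M ρ : ℝ} (hM : 0 ≤ M) (hρ : 0 < ρ)
    (hcont : ContinuousOn x (Set.Icc 0 1))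
    (hdy : ∀ n k : ℕ, k < 2 ^ n →
      ‖x (((k + 1 : ℕ) : ℝ) / 2 ^ n) - x ((k : ℝ) / 2 ^ n)‖ ≤ M * (2 ^ (-ρ)) ^ n) :
    ∃ B : ℝ, 0 ≤ B ∧ HolderUnit x B ρ := by
  set q : ℝ := 2 ^ (-ρ) with hq
  have hq0 : 0 < q := by positivity
  have hq1 : q < 1 := Real.rpow_lt_one_of_one_lt_of_neg (by norm_num) (by linarith)
  have hstep : ∀ n t, 0 ≤ t → t ≤ 1 →
      ‖x (dyadicFloor (n + 1) t) - x (dyadicFloor n t)‖ ≤ M * q ^ n := by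
    intro n t ht ht1
    have e0 : dyadicFloor n t = ((2 * ⌊t * 2 ^ n⌋₊ : ℕ) : ℝ) / 2 ^ (n + 1) := by
      rw [dyadicFloor, pow_succ]; push_cast; field_simp
    rcases floor_mul_two_pow_succ n ht with e | e
    · rw [e0, dyadicFloor, e, sub_self, norm_zero]; positivity
    · have hle := floor_mul_two_pow_le (n + 1) ht1
      rw [e] at hle
      rw [e0, dyadicFloor, e]
      exact (hdy (n + 1) (2 * ⌊t * 2 ^ n⌋₊) hle).trans
        (mul_le_mul_of_nonneg_left (pow_le_pow_of_le_one hq0.le hq1.le n.le_succ) hM)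
  have htail : ∀ n t, 0 ≤ t → t ≤ 1 → ‖x t - x (dyadicFloor n t)‖ ≤ M * q ^ n / (1 - q) := by
    intro n t ht ht1
    have := dist_le_of_le_geometric_of_tendsto q M hq1 (f := fun n => x (dyadicFloor n t))
      (fun n => by rw [dist_comm, dist_eq_norm]; exact hstep n t ht ht1)
      (tendsto_comp_dyadicFloor hcont t ht ht1) n
    rwa [dist_comm, dist_eq_norm] at this
  set D := M / (1 - q) * 2 + M with hD
  have h1q : 0 < 1 - q := by linarith
  have hD0 : 0 ≤ D := by positivity
  refine ⟨D * 2 ^ ρ, by positivity, fun s t hs hst ht => ?_⟩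
  rcases hst.eq_or_lt with rfl | hlt
  · simp only [sub_self, norm_zero]; positivity
  have hs1 := hst.trans ht
  have ht0 := hs.trans hst
  -- At the level with `(1/2) ^ (n+1) < t - s ≤ (1/2) ^ n` the dyadic floors of `s` and `t` coincide
  -- or are neighbours. The factor `2 ^ ρ` in the constant pays for `n + 1` against `n`.
  obtain ⟨n, hn1, hn2⟩ := exists_nat_pow_near_of_lt_one (sub_pos.2 hlt) (by linarith : t - s ≤ 1)
    (by norm_num : (0 : ℝ) < 1 / 2) (by norm_num)
  have hmid : ‖x (dyadicFloor n t) - x (dyadicFloor n s)‖ ≤ M * q ^ n := by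
    have hij : ⌊s * 2 ^ n⌋₊ ≤ ⌊t * 2 ^ n⌋₊ := Nat.floor_mono (by gcongr)
    have h2n : (0 : ℝ) < 2 ^ n := by positivity
    have hlen : (t - s) * 2 ^ n ≤ 1 := by
      have : (1 / 2 : ℝ) ^ n * 2 ^ n = 1 := by rw [← mul_pow]; norm_num
      nlinarith
    have : ⌊t * 2 ^ n⌋₊ < ⌊s * 2 ^ n⌋₊ + 2 := by
      rw [Nat.floor_lt (by positivity)]
      push_cast
      have := Nat.lt_floor_add_one (s * 2 ^ n)
      linarith
    have : ⌊t * 2 ^ n⌋₊ = ⌊s * 2 ^ n⌋₊ ∨ ⌊t * 2 ^ n⌋₊ = ⌊s * 2 ^ n⌋₊ + 1 := by omega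
    rcases this with e | e
    · rw [dyadicFloor, dyadicFloor, e, sub_self, norm_zero]; positivity
    · have hle := floor_mul_two_pow_le n ht
      rw [dyadicFloor, dyadicFloor, e]
      exact hdy n _ (by omega)
  have h1 := htail n t ht0 ht
  have h2 := htail n s hs hs1
  have hqn : q ^ n ≤ 2 ^ ρ * (t - s) ^ ρ := by
    have e : q ^ n = 2 ^ ρ * ((1 / 2 : ℝ) ^ (n + 1)) ^ ρ := by
      rw [hq, ← Real.rpow_natCast, ← Real.rpow_mul (by norm_num), one_div, inv_pow,
        Real.inv_rpow (by positivity), ← Real.rpow_natCast, ← Real.rpow_mul (by norm_num),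
        ← Real.rpow_neg (by norm_num), ← Real.rpow_add (by norm_num)]
      push_cast
      ring_nf
    rw [e]
    gcongr
  have e : x t - x s = (x t - x (dyadicFloor n t)) - (x s - x (dyadicFloor n s)) +
      (x (dyadicFloor n t) - x (dyadicFloor n s)) := by abel
  rw [e]
  calc _ ≤ M * q ^ n / (1 - q) + M * q ^ n / (1 - q) + M * q ^ n :=
        (norm_add_le _ _).trans (add_le_add ((norm_sub_le _ _).trans (add_le_add h1 h2)) hmid)
    _ = D * q ^ n := by rw [hD]; ring
    _ ≤ D * (2 ^ ρ * (t - s) ^ ρ) := by gcongr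
    _ = _ := by ring

end Chaining

/-! ### Lower bounds for Young integrals along the kernels. -/

section LowerBound

/-- Uniform grids with left tags. `KernelNondeterminism` demands strictly increasing grids, so `a =
b` has to be served by the one-point grid. -/
theorem HasYoungIntegral.exists_partition {E : Type*} [NormedAddCommGroup E] [NormedSpace ℝ E]
    {g : ℝ → ℝ} {x : ℝ → E} {a b : ℝ} {I : E} (h : HasYoungIntegral g x a b I) (hab : a ≤ b)
    {ε : ℝ} (hε : 0 < ε) :
    ∃ (k : ℕ) (u : Fin (k + 1) → ℝ), StrictMono u ∧ u 0 = a ∧ u (Fin.last k) = b ∧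
      ‖∑ i : Fin k, g (u i.castSucc) • (x (u i.succ) - x (u i.castSucc)) - I‖ < ε := by
  obtain ⟨δ, hδ, H⟩ := h ε hε
  rcases hab.eq_or_lt with rfl | hlt
  · refine ⟨0, fun _ => a, Fin.strictMono_iff_lt_succ.2 fun i => i.elim0, rfl, rfl, ?_⟩
    exact H 0 (fun _ => a) (fun _ => a) monotone_const rfl rfl (fun i => i.elim0) (fun i => i.elim0)
  · obtain ⟨N, hN⟩ := exists_nat_gt ((b - a) / δ)
    have hba : 0 < b - a := sub_pos.2 hlt
    have hN0 : (0 : ℝ) < N := (by positivity : 0 < (b - a) / δ).trans hN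
    set u : Fin (N + 1) → ℝ := fun i => a + (b - a) * ((i : ℕ) / N) with hu
    have hmono : StrictMono u := by
      intro i j hij
      have : ((i : ℕ) : ℝ) < (j : ℕ) := by exact_mod_cast hij
      simp only [hu]
      gcongr
    have h0 : u 0 = a := by simp [hu]
    have h1 : u (Fin.last N) = b := by simp [hu, hN0.ne']
    refine ⟨N, u, hmono, h0, h1, ?_⟩
    refine H N u (fun i => u i.castSucc) hmono.monotone h0 h1
      (fun i => ⟨le_rfl, hmono.monotone (Fin.castSucc_lt_succ).le⟩) (fun i => ?_)
    have : u i.succ - u i.castSucc = (b - a) / N := by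
      simp only [hu, Fin.val_succ, Fin.val_castSucc]; push_cast; field_simp; ring
    rw [this, div_lt_iff₀ hN0]
    rw [div_lt_iff₀ hδ] at hN
    linarith

variable {K : Type*} [NormedAddCommGroup K] [InnerProductSpace ℝ K]

/-- Nonnegative row sums: a combination of increments with coefficients at least `b ≥ 0` is at
least as long as `b` times the total increment. -/
theorem KernelNonnegRowSums.norm_sum_ge {f : ℝ → K} (hrow : KernelNonnegRowSums f) {m : ℕ}
    {a : Fin m → ℝ} {t : Fin (m + 1) → ℝ} (ht : Monotone t) (h0 : 0 ≤ t 0)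
    (h1 : t (Fin.last m) ≤ 1) {b : ℝ} (hb : 0 ≤ b) (ha : ∀ i, b ≤ a i) :
    b ^ 2 * ‖f (t (Fin.last m)) - f (t 0)‖ ^ 2 ≤
      ‖∑ i, a i • (f (t i.succ) - f (t i.castSucc))‖ ^ 2 := by
  set F := f (t (Fin.last m)) - f (t 0) with hF
  have e : ∑ i, a i • (f (t i.succ) - f (t i.castSucc)) =
      b • F + ∑ i, (a i - b) • (f (t i.succ) - f (t i.castSucc)) := by
    rw [hF, ← sum_fin_sub_eq m (fun i => f (t i)), Finset.smul_sum, ← Finset.sum_add_distrib]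
    exact Finset.sum_congr rfl fun i _ => by module
  -- Every increment lies inside `[t 0, t (Fin.last m)]`, so condition 3 applies with the whole
  -- interval as the outer one.
  have hin : 0 ≤ ⟪b • F, ∑ i, (a i - b) • (f (t i.succ) - f (t i.castSucc))⟫_ℝ := by
    rw [inner_sum]
    refine Finset.sum_nonneg fun i _ => ?_
    rw [inner_smul_left, inner_smul_right, real_inner_comm]
    have := hrow (t 0) (t i.castSucc) (t i.succ) (t (Fin.last m)) h0 (ht (Fin.zero_le _))
      (ht (Fin.castSucc_lt_succ).le) (ht (Fin.le_last _)) h1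
    have := sub_nonneg.2 (ha i)
    simp only [conj_trivial]
    positivity
  rw [e, norm_add_sq_real, norm_smul, mul_pow, Real.norm_eq_abs, sq_abs]
  nlinarith [sq_nonneg ‖∑ i, (a i - b) • (f (t i.succ) - f (t i.castSucc))‖]

variable [CompleteSpace K]

/-- Subtracting the projection onto the span of the outer increments annihilates both outer sums and
cannot lengthen a vector. What remains is the residual of the middle sum, to which nondeterminism
and then the row-sum bound apply. -/
theorem KernelNondeterminism.norm_sum_ge {f : ℝ → K} {β : ℝ} (hβ : 0 < β)
    (hnondet : KernelNondeterminism f β) (hrow : KernelNonnegRowSums f) {k m l : ℕ}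
    {α : Fin k → ℝ} {a : Fin m → ℝ} {γ : Fin l → ℝ} {u : Fin (k + 1) → ℝ} {t : Fin (m + 1) → ℝ}
    {r : Fin (l + 1) → ℝ} (hu : StrictMono u) (ht : StrictMono t) (hr : StrictMono r)
    (hu0 : u 0 = 0) (hut : u (Fin.last k) = t 0) (htr : t (Fin.last m) = r 0)
    (hr1 : r (Fin.last l) ≤ 1) {b : ℝ} (hb : 0 < b) (ha : ∀ i, b ≤ a i) :
    β * (b ^ 2 * ‖f (t (Fin.last m)) - f (t 0)‖ ^ 2) ≤
      ‖∑ i, α i • (f (u i.succ) - f (u i.castSucc)) + ∑ i, a i • (f (t i.succ) - f (t i.castSucc))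
        + ∑ i, γ i • (f (r i.succ) - f (r i.castSucc))‖ ^ 2 := by
  rcases Nat.eq_zero_or_pos m with rfl | hm
  · have : t (Fin.last 0) = t 0 := rfl
    rw [this, sub_self, norm_zero]
    simp only [ne_eq, OfNat.ofNat_ne_zero, not_false_eq_true, zero_pow, mul_zero]
    positivity
  have ha0 : a ≠ 0 := fun h => by
    have := ha ⟨0, hm⟩
    rw [h] at this
    exact absurd this (not_le.2 hb)
  set Γ := ∑ i, a i • (f (t i.succ) - f (t i.castSucc)) with hΓ
  set U := incrementSpan f u r with hU
  have h1 := hnondet m k l a t u r ha0 ht hu hr hu0 hut htr hr1 Γ hΓ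
  have h2 := hrow.norm_sum_ge (a := a) ht.monotone (hut ▸ hu0 ▸ hu.monotone (Fin.zero_le _))
    ((htr ▸ hr.monotone (Fin.zero_le _) : t (Fin.last m) ≤ r (Fin.last l)).trans hr1) hb.le ha
  set A := ∑ i, α i • (f (u i.succ) - f (u i.castSucc)) with hA
  set B := ∑ i, γ i • (f (r i.succ) - f (r i.castSucc)) with hB
  have hAU : A ∈ U := Submodule.le_topologicalClosure _ <| Submodule.sum_mem _ fun i _ =>
    Submodule.smul_mem _ _ (Submodule.subset_span (Or.inl ⟨i, rfl⟩))
  have hBU : B ∈ U := Submodule.le_topologicalClosure _ <| Submodule.sum_mem _ fun i _ =>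
    Submodule.smul_mem _ _ (Submodule.subset_span (Or.inr ⟨i, rfl⟩))
  have h3 : Γ - U.starProjection Γ = (A + Γ + B) - U.starProjection (A + Γ + B) := by
    rw [map_add, map_add, Submodule.starProjection_eq_self_iff.2 hAU,
      Submodule.starProjection_eq_self_iff.2 hBU]
    abel
  have h4 : ‖Γ - U.starProjection Γ‖ ≤ ‖A + Γ + B‖ := by
    rw [h3]
    have := U.starProjection_norm_le
    rw [← Submodule.starProjection_orthogonal_val]
    exact (Uᗮ.starProjection.le_opNorm _).trans
      (mul_le_of_le_one_left (norm_nonneg _) Uᗮ.starProjection_norm_le)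
  calc β * (b ^ 2 * ‖f (t (Fin.last m)) - f (t 0)‖ ^ 2) ≤ β * ‖Γ‖ ^ 2 := by gcongr
    _ ≤ ‖Γ - U.starProjection Γ‖ ^ 2 := h1.le
    _ ≤ _ := by gcongr

/-- Lower bound for a Young integral along a nondeterministic kernel. -/
theorem KernelNondeterminism.norm_young_ge {f : ℝ → K} {β : ℝ} (hβ : 0 < β)
    (hnondet : KernelNondeterminism f β) (hrow : KernelNonnegRowSums f) {g : ℝ → ℝ}
    {I₁ I₂ I₃ : K} {s t b : ℝ} (hs : 0 ≤ s) (hst : s ≤ t) (ht : t ≤ 1) (hb : 0 < b)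
    (h₁ : HasYoungIntegral g f 0 s I₁) (h₂ : HasYoungIntegral g f s t I₂)
    (h₃ : HasYoungIntegral g f t 1 I₃) (hg : ∀ q ∈ Set.Icc s t, b ≤ g q) :
    β * (b ^ 2 * ‖f t - f s‖ ^ 2) ≤ ‖I₁ + I₂ + I₃‖ ^ 2 := by
  have hpos : ∀ n : ℕ, (0 : ℝ) < 1 / (n + 1) := fun n => Nat.one_div_pos_of_nat
  choose k₁ u hu hu0 hus A using fun n : ℕ => h₁.exists_partition hs (hpos n)
  choose k₂ v hv hvs hvt B using fun n : ℕ => h₂.exists_partition hst (hpos n)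
  choose k₃ w hw hwt hw1 C using fun n : ℕ => h₃.exists_partition ht (hpos n)
  have hlim : ∀ {F : ℕ → K} {I : K}, (∀ n, ‖F n - I‖ < 1 / ((n : ℝ) + 1)) →
      Tendsto F atTop (𝓝 I) := fun h =>
    tendsto_iff_norm_sub_tendsto_zero.2 (squeeze_zero (fun _ => norm_nonneg _)
      (fun n => (h n).le) tendsto_one_div_add_atTop_nhds_zero_nat)
  refine ge_of_tendsto' ((((hlim A).add (hlim B)).add (hlim C)).norm.pow 2) fun n => ?_
  have := hnondet.norm_sum_ge hβ hrow (α := fun i => g (u n i.castSucc))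
    (a := fun i => g (v n i.castSucc)) (γ := fun i => g (w n i.castSucc)) (hu n) (hv n) (hw n)
    (hu0 n) ((hus n).trans (hvs n).symm) ((hvt n).trans (hwt n).symm) (hw1 n).le hb
    (fun i => hg _ ⟨hvs n ▸ (hv n).monotone (Fin.zero_le _),
      hvt n ▸ (hv n).monotone (Fin.le_last _)⟩)
  rwa [hvt n, hvs n] at this

theorem HasYoungIntegral.neg {E : Type*} [NormedAddCommGroup E] [NormedSpace ℝ E]
    {g : ℝ → ℝ} {x : ℝ → E} {a b : ℝ} {I : E} (h : HasYoungIntegral g x a b I) :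
    HasYoungIntegral (fun t => -g t) x a b (-I) := by
  intro ε hε
  obtain ⟨δ, hδ, H⟩ := h ε hε
  refine ⟨δ, hδ, fun N t ξ h1 h2 h3 h4 h5 => ?_⟩
  have := H N t ξ h1 h2 h3 h4 h5
  rw [← norm_neg, neg_sub'] at this
  simpa [Finset.sum_neg_distrib] using this

end LowerBound

/-! ### From local lower bounds to a bound on the supremum. -/

section Interpolation

/-- The interpolation argument behind the final inequality. -/
theorem abs_le_max_of_local_lower_bound {g : ℝ → ℝ} {V : ℝ → ℝ → ℝ} {κ G τ η C Y : ℝ}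
    (hκ : 0 < κ) (hG : 0 < G) (hτ : 0 < τ) (hη : 0 < η) (hC : 0 < C)
    (hg : HolderUnit g G τ)
    (hV : ∀ s t, 0 ≤ s → s < t → t ≤ 1 → C * |t - s| ^ η ≤ V s t)
    (hlow : ∀ s t b, 0 ≤ s → s < t → t ≤ 1 → 0 < b →
      ((∀ q ∈ Set.Icc s t, b ≤ g q) ∨ (∀ q ∈ Set.Icc s t, b ≤ -g q)) →
      κ * (b ^ 2 * V s t) ≤ Y)
    {r : ℝ} (hr : r ∈ Set.Icc (0 : ℝ) 1) :
    |g r| ≤ max (2 / √κ * V 0 1 ^ (-(1 / 2) : ℝ) * Y ^ (1 / 2 : ℝ))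
      (2 / (κ * C) ^ (τ / (2 * τ + η)) * Y ^ (τ / (2 * τ + η)) * G ^ (η / (2 * τ + η))) := by
  -- The hypothesis `hlow` is symmetric under `g ↦ -g`.
  wlog hpos : 0 ≤ g r generalizing g
  · have hg' : HolderUnit (fun t => -g t) G τ := fun s t h1 h2 h3 => by
      have := hg s t h1 h2 h3
      rwa [← norm_neg, neg_sub'] at this
    have := this hg' (fun s t b h1 h2 h3 h4 h5 => hlow s t b h1 h2 h3 h4 (by
      simp only [neg_neg] at h5; exact h5.symm)) (by linarith)
    simpa using this
  rw [abs_of_nonneg hpos]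
  have hV01 : 0 < V 0 1 := by
    have := hV 0 1 le_rfl one_pos le_rfl
    have h : 0 < C * |(1 : ℝ) - 0| ^ η := by simpa using hC
    linarith
  rcases hpos.eq_or_lt with h0 | hM
  · rw [← h0]
    -- The sign of `Y` is not known in this case; for negative `Y` the real power `1 / 2` is `0`.
    by_cases hY : 0 ≤ Y
    · exact le_max_of_le_left (by positivity)
    · have hYh : Y ^ (1 / 2 : ℝ) = 0 := by
        rw [← Real.sqrt_eq_rpow]; exact Real.sqrt_eq_zero_of_nonpos (not_le.1 hY).le
      exact le_max_of_le_left (by rw [hYh]; simp)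
  set M := g r with hMdef
  by_cases hall : ∀ q ∈ Set.Icc (0 : ℝ) 1, M / 2 ≤ g q
  · refine le_max_of_le_left ?_
    have h := hlow 0 1 (M / 2) le_rfl one_pos le_rfl (by positivity) (Or.inl hall)
    have hY : 0 ≤ Y := le_trans (by positivity) h
    rw [Real.rpow_neg hV01.le, ← Real.sqrt_eq_rpow, ← Real.sqrt_eq_rpow]
    have h2 : (M / 2) * (√κ * √(V 0 1)) ≤ √Y := by
      apply Real.le_sqrt_of_sq_le
      rw [mul_pow, mul_pow, Real.sq_sqrt hκ.le, Real.sq_sqrt hV01.le]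
      linarith
    have hk : 0 < √κ := Real.sqrt_pos.2 hκ
    have hv : 0 < √(V 0 1) := Real.sqrt_pos.2 hV01
    have e : 2 / √κ * (√(V 0 1))⁻¹ * √Y = 2 * √Y / (√κ * √(V 0 1)) := by field_simp
    rw [e, le_div_iff₀ (by positivity)]
    linarith
  · refine le_max_of_le_right ?_
    push Not at hall
    obtain ⟨q, hq, hqM⟩ := hall
    have habs : ∀ p ∈ Set.Icc (0 : ℝ) 1, |g r - g p| ≤ G * |r - p| ^ τ := by
      intro p hp
      rcases le_total p r with h | h
      · rw [abs_of_nonneg (sub_nonneg.2 h)]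
        exact hg p r hp.1 h hr.2
      · rw [abs_sub_comm, abs_sub_comm r, abs_of_nonneg (sub_nonneg.2 h)]
        exact hg r p hr.1 h hp.2
    -- The distance from `r` within which the Hölder bound keeps `g` above `M / 2`.
    set ℓ := (M / (2 * G)) ^ (1 / τ) with hℓ
    have hℓ0 : 0 < ℓ := by positivity
    have hℓτ : G * ℓ ^ τ = M / 2 := by
      rw [hℓ, ← Real.rpow_mul (by positivity), one_div_mul_cancel hτ.ne', Real.rpow_one]
      field_simp
    have hfar : ℓ ≤ |r - q| := by
      by_contra hlt
      push Not at hlt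
      have h1 := (le_abs_self _).trans (habs q hq)
      have h2 : G * |r - q| ^ τ ≤ G * ℓ ^ τ := by gcongr
      linarith
    have hnear : ∀ p ∈ Set.Icc (0 : ℝ) 1, |r - p| ≤ ℓ → M / 2 ≤ g p := by
      intro p hp hle
      have h1 := (le_abs_self _).trans (habs p hp)
      have h2 : G * |r - p| ^ τ ≤ G * ℓ ^ τ := by gcongr
      linarith
    -- Since `q` is at distance at least `ℓ` from `r`, the interval of length `ℓ` at `r` on the side
    -- of `q` stays inside `[0, 1]`.
    have hYlow : κ * ((M / 2) ^ 2 * (C * ℓ ^ η)) ≤ Y := by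
      rcases le_total q r with h | h
      · rw [abs_of_nonneg (sub_nonneg.2 h)] at hfar
        have h1 := hlow (r - ℓ) r (M / 2) (by linarith [hq.1]) (by linarith) hr.2 (by positivity)
          (Or.inl fun p hp => hnear p ⟨by linarith [hq.1, hp.1], by linarith [hp.2, hr.2]⟩
            (by rw [abs_of_nonneg (by linarith [hp.2])]; linarith [hp.1]))
        have h2 := hV (r - ℓ) r (by linarith [hq.1]) (by linarith) hr.2
        rw [sub_sub_cancel, abs_of_pos hℓ0] at h2
        refine le_trans ?_ h1
        gcongr
      · rw [abs_sub_comm, abs_of_nonneg (sub_nonneg.2 h)] at hfar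
        have h1 := hlow r (r + ℓ) (M / 2) hr.1 (by linarith) (by linarith [hq.2]) (by positivity)
          (Or.inl fun p hp => hnear p ⟨by linarith [hr.1, hp.1], by linarith [hp.2, hq.2]⟩
            (by rw [abs_sub_comm, abs_of_nonneg (by linarith [hp.1])]; linarith [hp.2]))
        have h2 := hV r (r + ℓ) hr.1 (by linarith) (by linarith [hq.2])
        rw [add_sub_cancel_left, abs_of_pos hℓ0] at h2
        refine le_trans ?_ h1
        gcongr
    -- Chosen so that `e * (2 + η / τ) = 1`: raising the bound on `Y` to the power `e` leaves `M /
    -- 2` to the first power.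
    set e := τ / (2 * τ + η) with he
    have h2τ : 0 < 2 * τ + η := by positivity
    have he0 : 0 < e := by positivity
    have hee : e * (2 + η / τ) = 1 := by rw [he]; field_simp
    have hℓη : ℓ ^ η = (M / 2) ^ (η / τ) * G ^ (-(η / τ)) := by
      rw [hℓ, ← Real.rpow_mul (by positivity), show M / (2 * G) = (M / 2) * G⁻¹ by field_simp,
        Real.mul_rpow (by positivity) (by positivity), Real.inv_rpow hG.le, ← Real.rpow_neg hG.le]
      ring_nf
    have hYe : (κ * C) ^ e * (M / 2) * G ^ (-(η / (2 * τ + η))) ≤ Y ^ e := by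
      refine le_trans (le_of_eq ?_) (Real.rpow_le_rpow (by positivity) hYlow he0.le)
      have e1 : κ * ((M / 2) ^ 2 * (C * ℓ ^ η)) =
          (κ * C) * (M / 2) ^ (2 + η / τ) * G ^ (-(η / τ)) := by
        rw [hℓη, Real.rpow_add (by positivity), Real.rpow_two]; ring
      have e3 : ∀ a b c : ℝ, 0 ≤ a → 0 ≤ b → 0 ≤ c → (a * b * c) ^ e = a ^ e * b ^ e * c ^ e :=
        fun a b c ha hb hc => by
          rw [Real.mul_rpow (mul_nonneg ha hb) hc, Real.mul_rpow ha hb]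
      rw [e1, e3 _ _ _ (by positivity) (by positivity) (by positivity),
        ← Real.rpow_mul (by positivity), ← Real.rpow_mul hG.le, mul_comm (2 + η / τ) e, hee,
        Real.rpow_one]
      congr 2
      rw [he]; field_simp
    rw [Real.rpow_neg hG.le] at hYe
    have hGp : 0 < G ^ (η / (2 * τ + η)) := by positivity
    have hκC : 0 < (κ * C) ^ e := by positivity
    rw [← div_eq_mul_inv, div_le_iff₀ hGp] at hYe
    have e2 : 2 / (κ * C) ^ e * Y ^ e * G ^ (η / (2 * τ + η)) =
      2 * (Y ^ e * G ^ (η / (2 * τ + η))) / (κ * C) ^ e := by field_simp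
    rw [e2, le_div_iff₀ hκC]
    linarith

end Interpolation

/-! ### Random variables with all moments, and temperate growth. -/

section Moments

variable {Ω : Type*} [MeasurableSpace Ω] {P : Measure Ω}

/-- `F` has finite moments of all orders. -/
def AllMoments {E : Type*} [NormedAddCommGroup E] (F : Ω → E) (P : Measure Ω) : Prop :=
  ∀ p : ℝ≥0∞, p ≠ ∞ → MemLp F p P

variable {E : Type*} [NormedAddCommGroup E]

theorem AllMoments.memLp_two {F : Ω → E} (hF : AllMoments F P) : MemLp F 2 P := hF 2 (by simp)

theorem AllMoments.integrable {F : Ω → E} (hF : AllMoments F P) : Integrable F P :=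
  memLp_one_iff_integrable.1 (hF 1 (by simp))

theorem AllMoments.add {F G : Ω → E} (hF : AllMoments F P) (hG : AllMoments G P) :
    AllMoments (fun ω => F ω + G ω) P := fun p hp => (hF p hp).add (hG p hp)

theorem AllMoments.sub {F G : Ω → E} (hF : AllMoments F P) (hG : AllMoments G P) :
    AllMoments (fun ω => F ω - G ω) P := fun p hp => (hF p hp).sub (hG p hp)

theorem AllMoments.const [IsProbabilityMeasure P] (c : E) : AllMoments (fun _ : Ω => c) P :=
  fun _ _ => memLp_const c

theorem AllMoments.sum {κ : Type*} {s : Finset κ} {F : κ → Ω → E}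
    (hF : ∀ i ∈ s, AllMoments (F i) P) : AllMoments (fun ω => ∑ i ∈ s, F i ω) P :=
  fun p hp => memLp_finsetSum s fun i hi => hF i hi p hp

theorem AllMoments.norm {F : Ω → E} (hF : AllMoments F P) : AllMoments (fun ω => ‖F ω‖) P :=
  fun p hp => (hF p hp).norm

/-- Hölder with exponents `2p` and `2p`. Asking for all moments at once makes the class stable under
products, which settles integrability from here on. -/
theorem AllMoments.smul [NormedSpace ℝ E] {F : Ω → ℝ} {G : Ω → E} (hF : AllMoments F P)
    (hG : AllMoments G P) : AllMoments (fun ω => F ω • G ω) P := by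
  intro p hp
  have h2 : 2 * p ≠ ∞ := ENNReal.mul_ne_top (by simp) hp
  have : ENNReal.HolderTriple (2 * p) (2 * p) p := ⟨by
    rw [ENNReal.mul_inv (by simp) (by simp), ← add_mul, ENNReal.inv_two_add_inv_two, one_mul]⟩
  exact (hG _ h2).smul (hF _ h2)

theorem AllMoments.mul {F G : Ω → ℝ} (hF : AllMoments F P) (hG : AllMoments G P) :
    AllMoments (fun ω => F ω * G ω) P := hF.smul hG

theorem AllMoments.pow [IsProbabilityMeasure P] {F : Ω → ℝ} (hF : AllMoments F P) (k : ℕ) :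
    AllMoments (fun ω => F ω ^ k) P := by
  induction k with
  | zero => simpa using AllMoments.const (1 : ℝ)
  | succ k ih => simpa only [pow_succ] using ih.mul hF

theorem AllMoments.mono {F : Ω → E} {G : Ω → ℝ} (hG : AllMoments G P)
    (hF : AEStronglyMeasurable F P) (h : ∀ ω, ‖F ω‖ ≤ G ω) : AllMoments F P :=
  fun p hp => (hG p hp).mono hF
    (Eventually.of_forall fun ω => (h ω).trans (Real.le_norm_self _))

theorem AllMoments.inner [InnerProductSpace ℝ E] {F G : Ω → E} (hF : AllMoments F P)
    (hG : AllMoments G P) : AllMoments (fun ω => ⟪F ω, G ω⟫_ℝ) P :=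
  (hF.norm.mul hG.norm).mono ((hF 0 (by simp)).1.inner (hG 0 (by simp)).1)
    fun _ => norm_inner_le_norm _ _

theorem AllMoments.comp_temperate [IsProbabilityMeasure P] {V : Type*} [NormedAddCommGroup V]
    [NormedSpace ℝ V] [NormedSpace ℝ E] {Z : Ω → V} (hZ : AllMoments Z P) {φ : V → E}
    (hφ : φ.HasTemperateGrowth) : AllMoments (fun ω => φ (Z ω)) P := by
  obtain ⟨k, C, hC⟩ := hφ.2 0
  refine ((AllMoments.const C).mul (((AllMoments.const (1 : ℝ)).add hZ.norm).pow k)).mono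
    (hφ.1.continuous.comp_aestronglyMeasurable (hZ 0 (by simp)).1) fun ω => ?_
  simpa using hC (Z ω)

end Moments

theorem _root_.Function.HasTemperateGrowth.fderiv {V E : Type*} [NormedAddCommGroup V]
    [NormedSpace ℝ V] [NormedAddCommGroup E] [NormedSpace ℝ E] {φ : V → E}
    (hφ : φ.HasTemperateGrowth) : (_root_.fderiv ℝ φ).HasTemperateGrowth := by
  refine ⟨(contDiff_infty_iff_fderiv.1 hφ.1).2, fun n => ?_⟩
  obtain ⟨k, C, hC⟩ := hφ.2 (n + 1)
  exact ⟨k, C, fun x => by rw [norm_iteratedFDeriv_fderiv]; exact hC x⟩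

theorem _root_.Function.HasTemperateGrowth.fderiv_apply {V E : Type*} [NormedAddCommGroup V]
    [NormedSpace ℝ V] [NormedAddCommGroup E] [NormedSpace ℝ E] {φ : V → E}
    (hφ : φ.HasTemperateGrowth) (v : V) :
    (fun x => _root_.fderiv ℝ φ x v).HasTemperateGrowth :=
  (ContinuousLinearMap.apply ℝ E v).hasTemperateGrowth.comp hφ.fderiv

theorem _root_.Function.HasTemperateGrowth.differentiable {V E : Type*} [NormedAddCommGroup V]
    [NormedSpace ℝ V] [NormedAddCommGroup E] [NormedSpace ℝ E] {φ : V → E}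
    (hφ : φ.HasTemperateGrowth) : Differentiable ℝ φ := hφ.1.differentiable (by simp)

/-! ### Stein's identity in one dimension. -/

section Stein

theorem allMoments_id_gaussianReal (v : ℝ≥0) : AllMoments (fun x : ℝ => x) (gaussianReal 0 v) :=
  fun _ hp => (IsGaussian.hasGaussianLaw_id (μ := gaussianReal 0 v)).memLp hp

theorem hasDerivAt_gaussianPDFReal {v : ℝ≥0} (hv : v ≠ 0) (x : ℝ) :
    HasDerivAt (gaussianPDFReal 0 v) (-(x / v) * gaussianPDFReal 0 v x) x := by
  have hv' : (v : ℝ) ≠ 0 := by exact_mod_cast hv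
  have h1 : HasDerivAt (fun x : ℝ => -(x - 0) ^ 2 / (2 * v)) (-(x / v)) x := by
    refine ((((hasDerivAt_id' x).sub_const 0).pow 2).neg.div_const (2 * (v : ℝ))).congr_deriv ?_
    field_simp
    simp [mul_comm]
  rw [gaussianPDFReal_def]
  refine (h1.exp.const_mul ((√(2 * Real.pi * v))⁻¹)).congr_deriv ?_
  simp only
  ring

theorem integrable_gaussianReal_iff {v : ℝ≥0} (hv : v ≠ 0) {u : ℝ → ℝ} :
    Integrable u (gaussianReal 0 v) ↔ Integrable (fun x => gaussianPDFReal 0 v x * u x) := by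
  rw [gaussianReal_of_var_ne_zero _ hv, integrable_withDensity_iff_integrable_smul'
    (measurable_gaussianPDF _ _) (ae_of_all _ fun _ => gaussianPDF_lt_top)]
  simp

/-- Stein's identity. -/
theorem integral_id_mul_gaussianReal (v : ℝ≥0) {u : ℝ → ℝ} (hu : u.HasTemperateGrowth) :
    ∫ x, x * u x ∂(gaussianReal 0 v) = v * ∫ x, deriv u x ∂(gaussianReal 0 v) := by
  rcases eq_or_ne v 0 with rfl | hv
  · simp
  have hv' : (v : ℝ) ≠ 0 := by exact_mod_cast hv
  have hid := allMoments_id_gaussianReal v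
  have hd : (deriv u).HasTemperateGrowth := by
    have := hu.fderiv_apply 1
    simpa only [fderiv_apply_one_eq_deriv] using this
  have i1 := (integrable_gaussianReal_iff hv).1 (hid.mul (hid.comp_temperate hu)).integrable
  have i2 := (integrable_gaussianReal_iff hv).1 (hid.comp_temperate hd).integrable
  have i3 := (integrable_gaussianReal_iff hv).1 (hid.comp_temperate hu).integrable
  have key := integral_mul_deriv_eq_deriv_mul_of_integrable
    (u := u) (v := gaussianPDFReal 0 v) (u' := deriv u)
    (v' := fun x => -(x / v) * gaussianPDFReal 0 v x)
    (fun x _ => (hu.differentiable x).hasDerivAt)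
    (fun x _ => hasDerivAt_gaussianPDFReal hv x)
    ((i1.const_mul (-(1 / (v : ℝ)))).congr (ae_of_all _ fun x => by
      simp only [Pi.mul_apply]; field_simp))
    (i2.congr (ae_of_all _ fun x => by simp only [Pi.mul_apply]; ring))
    (i3.congr (ae_of_all _ fun x => by simp only [Pi.mul_apply]; ring))
  rw [integral_gaussianReal_eq_integral_smul hv, integral_gaussianReal_eq_integral_smul hv]
  simp only [smul_eq_mul]
  have e1 : ∫ x, u x * (-(x / v) * gaussianPDFReal 0 v x) =
      -(1 / (v : ℝ)) * ∫ x, gaussianPDFReal 0 v x * (x * u x) := by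
    rw [← integral_const_mul]
    congr 1
    ext x
    field_simp
  have e2 : ∫ x, deriv u x * gaussianPDFReal 0 v x = ∫ x, gaussianPDFReal 0 v x * deriv u x := by
    congr 1
    ext x
    ring
  rw [e1, e2] at key
  generalize (∫ x, gaussianPDFReal 0 v x * (x * u x)) = I₁ at key ⊢
  field_simp at key
  linarith

end Stein

/-! ### Gaussian integration by parts. -/

section GaussianIBP

variable {H : Type*} [NormedAddCommGroup H] [InnerProductSpace ℝ H]
  {Ω : Type*} [MeasurableSpace Ω] {P : Measure Ω} {W : H → Ω → ℝ}

theorem IsIsonormal.allMoments (hW : IsIsonormal W P) (h : H) : AllMoments (W h) P :=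
  fun _ hp => (hW.gaussian.hasGaussianLaw_eval h).memLp hp

theorem IsIsonormal.allMoments_pi (hW : IsIsonormal W P) {ι : Type*} [Fintype ι] (h : ι → H) :
    AllMoments (fun ω i => W (h i) ω) P :=
  fun p hp => MemLp.of_eval fun i => hW.allMoments (h i) p hp

theorem IsIsonormal.map_eq (hW : IsIsonormal W P) (h : H) :
    P.map (W h) = gaussianReal 0 (‖h‖₊ ^ 2) := by
  have hl := hW.gaussian.hasGaussianLaw_eval h
  rw [hl.map_eq_gaussianReal, hW.mean_zero,
    variance_of_integral_eq_zero hl.aemeasurable (hW.mean_zero h)]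
  congr 1
  simp_rw [pow_two]
  rw [hW.covariance, real_inner_self_eq_norm_mul_norm]
  ext
  simp [mul_self_nonneg]

variable [IsProbabilityMeasure P]

/-- Regress the vector on `W v`: the remainder `R` is uncorrelated with `W v`, hence independent of
it by joint Gaussianity. By Fubini it can be frozen, and Stein's identity applies in the variable `W
v` alone. -/
theorem IsIsonormal.integral_mul_temperate (hW : IsIsonormal W P) {ι : Type*} [Fintype ι]
    (h : ι → H) {Φ : (ι → ℝ) → ℝ} (hΦ : Φ.HasTemperateGrowth) (v : H) :
    ∫ ω, W v ω * Φ (fun i => W (h i) ω) ∂P =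
      ∫ ω, fderiv ℝ Φ (fun i => W (h i) ω) (fun i => ⟪h i, v⟫_ℝ) ∂P := by
  classical
  rcases eq_or_ne v 0 with rfl | hv
  · have h0 : W 0 =ᵐ[P] 0 := by
      have h1 : ∫ ω, W 0 ω ^ 2 ∂P = 0 := by
        simp_rw [pow_two]; rw [hW.covariance, inner_zero_left]
      have h2 := (integral_eq_zero_iff_of_nonneg (fun ω => sq_nonneg (W 0 ω))
        ((hW.allMoments 0).pow 2).integrable).1 h1
      filter_upwards [h2] with ω hω
      simpa using hω
    have e1 : ∫ ω, W 0 ω * Φ (fun i => W (h i) ω) ∂P = 0 := by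
      rw [integral_eq_zero_of_ae]
      filter_upwards [h0] with ω hω
      simp [hω]
    rw [e1]
    simp only [inner_zero_right]
    have : (fun _ : ι => (0 : ℝ)) = 0 := rfl
    simp [this]
  set s : ℝ≥0 := ‖v‖₊ ^ 2 with hs
  have hs0 : (s : ℝ) ≠ 0 := by
    have : s ≠ 0 := pow_ne_zero _ (nnnorm_ne_zero_iff.2 hv)
    exact_mod_cast this
  have hsv : (s : ℝ) = ⟪v, v⟫_ℝ := by rw [real_inner_self_eq_norm_sq, hs]; simp
  -- The regression coefficients; `s` is the variance of `W v`, which is why `v = 0` was treated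
  -- apart.
  set c : ι → ℝ := fun i => ⟪h i, v⟫_ℝ / s with hc
  set R : Ω → ι → ℝ := fun ω i => W (h i) ω - c i * W v ω with hR
  have hRm : AllMoments R P := fun p hp => MemLp.of_eval fun i =>
    ((hW.allMoments (h i)).sub ((AllMoments.const (c i)).mul (hW.allMoments v))) p hp
  have hind : IndepFun (W v) R P := by
    have hg : IsGaussianProcess (Sum.elim (fun _ : Unit => W v)
        (fun i ω => W (h i) ω - c i * W v ω)) P := by
      refine hW.gaussian.of_isGaussianProcess fun z => ?_
      rcases z with _ | i
      · exact ⟨{v}, ContinuousLinearMap.proj ⟨v, by simp⟩, fun ω => rfl⟩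
      · exact ⟨{h i, v}, ContinuousLinearMap.proj ⟨h i, by simp⟩ -
          c i • ContinuousLinearMap.proj ⟨v, by simp⟩, fun ω => rfl⟩
    have := hg.indepFun_of_covariance_eq_zero (X := fun _ : Unit => W v)
      (Y := fun i ω => W (h i) ω - c i * W v ω) (fun _ => (hW.allMoments v).memLp_two.1.aemeasurable)
      (fun i => ((hW.allMoments (h i)).sub
        ((AllMoments.const (c i)).mul (hW.allMoments v))).memLp_two.1.aemeasurable) fun _ i => by
        rw [covariance_eq_sub (hW.allMoments v).memLp_two ((hW.allMoments (h i)).sub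
          ((AllMoments.const (c i)).mul (hW.allMoments v))).memLp_two, hW.mean_zero, zero_mul,
          sub_zero]
        have e : W v * (fun ω => W (h i) ω - c i * W v ω) =
            fun ω => W v ω * W (h i) ω - c i * (W v ω * W v ω) := by
          ext ω; simp only [Pi.mul_apply]; ring
        rw [e, integral_sub ((hW.allMoments v).mul (hW.allMoments (h i))).integrable
          (((hW.allMoments v).mul (hW.allMoments v)).integrable.const_mul _), integral_const_mul,
          hW.covariance, hW.covariance, real_inner_comm, ← hsv, hc]
        rw [div_mul_cancel₀ _ hs0, sub_self]
    exact this.comp (φ := fun x : Unit → ℝ => x ()) (ψ := fun y => y) (by fun_prop) measurable_id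
  have hmap := (indepFun_iff_map_prod_eq_prod_map_map (hW.allMoments v).memLp_two.1.aemeasurable
    hRm.memLp_two.1.aemeasurable).1 hind
  rw [hW.map_eq v] at hmap
  have hZ : ∀ ω, (fun i => W (h i) ω) = W v ω • c + R ω := by
    intro ω; ext i; simp only [hR, Pi.add_apply, Pi.smul_apply, smul_eq_mul]; ring
  have hpm : AEMeasurable (fun ω => (W v ω, R ω)) P :=
    (hW.allMoments v).memLp_two.1.aemeasurable.prodMk hRm.memLp_two.1.aemeasurable
  have hZm := hW.allMoments_pi h
  set w : ι → ℝ := fun i => ⟪h i, v⟫_ℝ with hw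
  have hwc : w = (s : ℝ) • c := by
    ext i; simp only [hw, hc, Pi.smul_apply, smul_eq_mul]; field_simp
  set A : ℝ × (ι → ℝ) → ℝ := fun y => y.1 * Φ (y.1 • c + y.2) with hA
  set B : ℝ × (ι → ℝ) → ℝ := fun y => fderiv ℝ Φ (y.1 • c + y.2) c with hB
  have hAc : Continuous A := by
    have := hΦ.1.continuous
    fun_prop
  have hBc : Continuous B := by
    have := (hΦ.fderiv_apply c).1.continuous
    exact this.comp (by fun_prop)
  have iA : Integrable A ((gaussianReal 0 s).prod (P.map R)) := by
    rw [← hmap, integrable_map_measure hAc.aestronglyMeasurable hpm]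
    refine ((hW.allMoments v).mul (hZm.comp_temperate hΦ)).integrable.congr (ae_of_all _ fun ω => ?_)
    simp only [hA, Function.comp_apply, hZ ω]
  have iB : Integrable B ((gaussianReal 0 s).prod (P.map R)) := by
    rw [← hmap, integrable_map_measure hBc.aestronglyMeasurable hpm]
    refine (hZm.comp_temperate (hΦ.fderiv_apply c)).integrable.congr (ae_of_all _ fun ω => ?_)
    simp only [hB, Function.comp_apply, hZ ω]
  have hAB : ∫ y, A y ∂((gaussianReal 0 s).prod (P.map R)) =
      s * ∫ y, B y ∂((gaussianReal 0 s).prod (P.map R)) := by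
    have : IsProbabilityMeasure (P.map R) :=
      Measure.isProbabilityMeasure_map hRm.memLp_two.1.aemeasurable
    rw [integral_prod_symm _ iA, integral_prod_symm _ iB, ← integral_const_mul]
    congr 1
    ext r
    have hu : (fun x : ℝ => Φ (x • c + r)).HasTemperateGrowth := by
      have h1 : (fun x : ℝ => x • c + r).HasTemperateGrowth :=
        (((ContinuousLinearMap.id ℝ ℝ).smulRight c).hasTemperateGrowth).add
          (Function.HasTemperateGrowth.const r)
      exact hΦ.comp h1
    have := integral_id_mul_gaussianReal s hu
    simp only [hA, hB]
    rw [this]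
    congr 2
    ext x
    have h1 : HasDerivAt (fun x : ℝ => x • c + r) c x := by
      simpa using ((hasDerivAt_id x).smul_const c).add_const r
    exact ((hΦ.differentiable _).hasFDerivAt.comp_hasDerivAt x h1).deriv
  calc ∫ ω, W v ω * Φ (fun i => W (h i) ω) ∂P = ∫ ω, A (W v ω, R ω) ∂P := by
        simp only [hA, hZ]
    _ = ∫ y, A y ∂((gaussianReal 0 s).prod (P.map R)) := by
        rw [← hmap, integral_map hpm hAc.aestronglyMeasurable]
    _ = s * ∫ y, B y ∂((gaussianReal 0 s).prod (P.map R)) := hAB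
    _ = s * ∫ ω, B (W v ω, R ω) ∂P := by
        rw [← hmap, integral_map hpm hBc.aestronglyMeasurable]
    _ = _ := by
        rw [← integral_const_mul]
        congr 1
        ext ω
        rw [hwc, map_smul, smul_eq_mul, hZ]

end GaussianIBP

/-! ### Smooth functionals, their gradients and the divergence. -/

section SmoothPairs

variable {H : Type*} [NormedAddCommGroup H] [InnerProductSpace ℝ H]
  {Ω : Type*} {W : H → Ω → ℝ}

/-- `F = φ(W(h₁), …, W(h_m))` with `φ` smooth and of temperate growth, and `DF` is the
corresponding `H`-valued gradient. -/
def IsSmoothPair (W : H → Ω → ℝ) (F : Ω → ℝ) (DF : Ω → H) : Prop :=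
  ∃ (ι : Type) (_ : Fintype ι) (_ : DecidableEq ι) (h : ι → H) (φ : (ι → ℝ) → ℝ),
    φ.HasTemperateGrowth ∧ F = (fun ω => φ fun i => W (h i) ω) ∧
    DF = fun ω => ∑ i, fderiv ℝ φ (fun l => W (h l) ω) (Pi.single i 1) • h i

/-- Pairing with `u` gives a directional derivative, which no longer refers to coordinates;
gradients written over different Gaussian vectors are compared this way. -/
theorem inner_sum_fderiv_single {ι : Type} [Fintype ι] [DecidableEq ι] (h : ι → H)
    (L : (ι → ℝ) →L[ℝ] ℝ) (u : H) :
    ⟪∑ i, L (Pi.single i 1) • h i, u⟫_ℝ = L (fun i => ⟪h i, u⟫_ℝ) := by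
  have e : (fun i => ⟪h i, u⟫_ℝ) = ∑ i, ⟪h i, u⟫_ℝ • (Pi.single i (1 : ℝ) : ι → ℝ) := by
    ext j
    simp [Finset.sum_apply, Pi.single_apply]
  rw [e, map_sum, sum_inner]
  refine Finset.sum_congr rfl fun i _ => ?_
  rw [inner_smul_left, map_smul, smul_eq_mul, conj_trivial, mul_comm]

/-- Bounded derivatives are of temperate growth with exponent `0`. With `isSmoothPair_poly`, this
puts the functionals defining the Malliavin derivative and those defining `I_n` in one class. -/
theorem IsSmoothPair.of_cylindrical {p : (Ω → ℝ) × (Ω → H)} (hp : p ∈ cylindricalDerivative W) :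
    IsSmoothPair W p.1 p.2 := by
  obtain ⟨m, h, φ, hφ, hb, h1, h2⟩ := hp
  refine ⟨Fin m, inferInstance, inferInstance, h, φ, ⟨hφ, fun k => ?_⟩, h1, h2⟩
  obtain ⟨B, hB⟩ := hb k
  exact ⟨0, B, fun x => by simpa using hB x⟩

theorem IsSmoothPair.const (c : ℝ) : IsSmoothPair W (fun _ => c) (fun _ => 0) :=
  ⟨Empty, inferInstance, inferInstance, Empty.elim, fun _ => c, .const c, rfl, by simp⟩

theorem IsSmoothPair.eval (h : H) : IsSmoothPair W (W h) (fun _ => h) := by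
  refine ⟨Unit, inferInstance, inferInstance, fun _ => h, fun x => x (),
    (ContinuousLinearMap.proj (R := ℝ) (φ := fun _ : Unit => ℝ) ()).hasTemperateGrowth, rfl, ?_⟩
  ext ω
  have : fderiv ℝ (fun x : Unit → ℝ => x ()) (fun _ => W h ω) =
      ContinuousLinearMap.proj (R := ℝ) (φ := fun _ : Unit => ℝ) () :=
    (ContinuousLinearMap.proj (R := ℝ) (φ := fun _ : Unit => ℝ) ()).fderiv
  simp [this]

theorem temperate_reindex {ι κ : Type} [Fintype ι] [Fintype κ] [DecidableEq ι] [DecidableEq κ]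
    {φ : (ι → ℝ) → ℝ} (hφ : φ.HasTemperateGrowth) (f : ι → κ) :
    Function.HasTemperateGrowth (fun x : κ → ℝ => φ fun i => x (f i)) ∧
    ∀ x w : κ → ℝ, fderiv ℝ (fun x : κ → ℝ => φ fun i => x (f i)) x w =
      fderiv ℝ φ (fun i => x (f i)) (fun i => w (f i)) := by
  set L : (κ → ℝ) →L[ℝ] (ι → ℝ) := ContinuousLinearMap.pi fun i => ContinuousLinearMap.proj (f i)
  refine ⟨hφ.comp L.hasTemperateGrowth, fun x w => ?_⟩
  have := (hφ.differentiable (L x)).hasFDerivAt.comp x L.hasFDerivAt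
  exact congrArg (fun T => T w) this.fderiv

/-- Two smooth functionals can be written as functions of the same Gaussian vector. -/
theorem IsSmoothPair.common {F G : Ω → ℝ} {DF DG : Ω → H} (hF : IsSmoothPair W F DF)
    (hG : IsSmoothPair W G DG) :
    ∃ (ι : Type) (_ : Fintype ι) (_ : DecidableEq ι) (h : ι → H) (φ ψ : (ι → ℝ) → ℝ),
      φ.HasTemperateGrowth ∧ ψ.HasTemperateGrowth ∧
      F = (fun ω => φ fun i => W (h i) ω) ∧ G = (fun ω => ψ fun i => W (h i) ω) ∧
      (DF = fun ω => ∑ i, fderiv ℝ φ (fun l => W (h l) ω) (Pi.single i 1) • h i) ∧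
      DG = fun ω => ∑ i, fderiv ℝ ψ (fun l => W (h l) ω) (Pi.single i 1) • h i := by
  obtain ⟨ι, _, _, h, φ, hφ, rfl, rfl⟩ := hF
  obtain ⟨κ, _, _, k, ψ, hψ, rfl, rfl⟩ := hG
  have h1 := temperate_reindex hφ (Sum.inl : ι → ι ⊕ κ)
  have h2 := temperate_reindex hψ (Sum.inr : κ → ι ⊕ κ)
  refine ⟨ι ⊕ κ, inferInstance, inferInstance, Sum.elim h k, _, _, h1.1, h2.1, rfl, rfl, ?_, ?_⟩
  · ext ω
    refine ext_inner_right ℝ fun u => ?_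
    rw [inner_sum_fderiv_single, inner_sum_fderiv_single, h1.2]
    rfl
  · ext ω
    refine ext_inner_right ℝ fun u => ?_
    rw [inner_sum_fderiv_single, inner_sum_fderiv_single, h2.2]
    rfl

theorem IsSmoothPair.add {F G : Ω → ℝ} {DF DG : Ω → H} (hF : IsSmoothPair W F DF)
    (hG : IsSmoothPair W G DG) :
    IsSmoothPair W (fun ω => F ω + G ω) (fun ω => DF ω + DG ω) := by
  obtain ⟨ι, _, _, h, φ, ψ, hφ, hψ, rfl, rfl, rfl, rfl⟩ := hF.common hG
  refine ⟨ι, inferInstance, inferInstance, h, _, hφ.add hψ, rfl, ?_⟩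
  ext ω
  rw [← Finset.sum_add_distrib]
  refine Finset.sum_congr rfl fun i _ => ?_
  rw [fderiv_add (hφ.differentiable _) (hψ.differentiable _), add_apply, add_smul]

theorem IsSmoothPair.mul {F G : Ω → ℝ} {DF DG : Ω → H} (hF : IsSmoothPair W F DF)
    (hG : IsSmoothPair W G DG) :
    IsSmoothPair W (fun ω => F ω * G ω) (fun ω => F ω • DG ω + G ω • DF ω) := by
  obtain ⟨ι, _, _, h, φ, ψ, hφ, hψ, rfl, rfl, rfl, rfl⟩ := hF.common hG
  refine ⟨ι, inferInstance, inferInstance, h, _, hφ.mul hψ, rfl, ?_⟩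
  ext ω
  rw [Finset.smul_sum, Finset.smul_sum, ← Finset.sum_add_distrib]
  refine Finset.sum_congr rfl fun i _ => ?_
  rw [fderiv_mul (hφ.differentiable _) (hψ.differentiable _), add_apply,
    smul_apply, smul_apply, add_smul, smul_smul, smul_smul]
  rfl

variable [MeasurableSpace Ω] {P : Measure Ω} [IsProbabilityMeasure P]

theorem IsSmoothPair.allMoments (hW : IsIsonormal W P) {F : Ω → ℝ} {DF : Ω → H}
    (hF : IsSmoothPair W F DF) : AllMoments F P ∧ AllMoments DF P := by
  obtain ⟨ι, _, _, h, φ, hφ, rfl, rfl⟩ := hF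
  have hZ := hW.allMoments_pi h
  exact ⟨hZ.comp_temperate hφ, AllMoments.sum fun i _ =>
    (hZ.comp_temperate (hφ.fderiv_apply _)).smul (AllMoments.const (h i))⟩

theorem IsSmoothPair.integral_mul (hW : IsIsonormal W P) {F : Ω → ℝ} {DF : Ω → H}
    (hF : IsSmoothPair W F DF) (v : H) :
    ∫ ω, W v ω * F ω ∂P = ∫ ω, ⟪DF ω, v⟫_ℝ ∂P := by
  obtain ⟨ι, _, _, h, φ, hφ, rfl, rfl⟩ := hF
  simp only [inner_sum_fderiv_single]
  exact hW.integral_mul_temperate h hφ v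

/-- Integration by parts for the directional derivative. -/
theorem IsSmoothPair.integral_inner_mul (hW : IsIsonormal W P) {F G : Ω → ℝ} {DF DG : Ω → H}
    (hF : IsSmoothPair W F DF) (hG : IsSmoothPair W G DG) (v : H) :
    ∫ ω, ⟪DF ω, v⟫_ℝ * G ω ∂P = ∫ ω, F ω * (W v ω * G ω - ⟪DG ω, v⟫_ℝ) ∂P := by
  have h := (hF.mul hG).integral_mul hW v
  obtain ⟨mF, mDF⟩ := hF.allMoments hW
  obtain ⟨mG, mDG⟩ := hG.allMoments hW
  have mv : AllMoments (fun _ : Ω => v) P := AllMoments.const v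
  have e1 : ∀ ω, ⟪F ω • DG ω + G ω • DF ω, v⟫_ℝ = F ω * ⟪DG ω, v⟫_ℝ + ⟪DF ω, v⟫_ℝ * G ω := fun ω => by
    rw [inner_add_left, inner_smul_left, inner_smul_left]; simp [mul_comm]
  have e2 : ∀ ω, F ω * (W v ω * G ω - ⟪DG ω, v⟫_ℝ) = W v ω * (F ω * G ω) - F ω * ⟪DG ω, v⟫_ℝ :=
    fun ω => by ring
  simp_rw [e1] at h
  simp_rw [e2]
  rw [integral_sub ((hW.allMoments v).mul (mF.mul mG)).integrable (mF.mul (mDG.inner mv)).integrable,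
    h, integral_add (mF.mul (mDG.inner mv)).integrable ((mDF.inner mv).mul mG).integrable]
  ring

/-- The gradient of a smooth functional is in the domain of the divergence. -/
theorem IsSmoothPair.exists_divergence (hW : IsIsonormal W P) {G : Ω → ℝ} {DG : Ω → H}
    (hG : IsSmoothPair W G DG) :
    ∃ M : Ω → ℝ, AllMoments M P ∧ ∀ (F : Ω → ℝ) (DF : Ω → H), IsSmoothPair W F DF →
      ∫ ω, ⟪DF ω, DG ω⟫_ℝ ∂P = ∫ ω, F ω * M ω ∂P := by
  obtain ⟨ι, _, _, h, φ, hφ, rfl, rfl⟩ := hG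
  set G' : ι → Ω → ℝ := fun i ω => fderiv ℝ φ (fun l => W (h l) ω) (Pi.single i 1) with hG'
  set D' : ι → Ω → H := fun i ω => ∑ j, fderiv ℝ (fun x => fderiv ℝ φ x (Pi.single i 1))
    (fun l => W (h l) ω) (Pi.single j 1) • h j with hD'
  have hs : ∀ i, IsSmoothPair W (G' i) (D' i) := fun i =>
    ⟨ι, inferInstance, inferInstance, h, _, hφ.fderiv_apply (Pi.single i 1), rfl, rfl⟩
  have hm : ∀ i, AllMoments (fun ω => W (h i) ω * G' i ω - ⟪D' i ω, h i⟫_ℝ) P := fun i =>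
    ((hW.allMoments _).mul ((hs i).allMoments hW).1).sub
      (((hs i).allMoments hW).2.inner (AllMoments.const _))
  -- The divergence of `∑ G' i • h i`, read off term by term from integration by parts.
  refine ⟨fun ω => ∑ i, (W (h i) ω * G' i ω - ⟪D' i ω, h i⟫_ℝ), AllMoments.sum fun i _ => hm i,
    fun F DF hF => ?_⟩
  simp_rw [Finset.mul_sum, inner_sum]
  rw [integral_finsetSum _ fun i _ => ((hF.allMoments hW).1.mul (hm i)).integrable,
    integral_finsetSum _ fun i _ => ((hF.allMoments hW).2.inner
      (((hs i).allMoments hW).1.smul (AllMoments.const _))).integrable]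
  refine Finset.sum_congr rfl fun i _ => ?_
  rw [← hF.integral_inner_mul hW (hs i)]
  congr 1
  ext ω
  rw [inner_smul_right, mul_comm]

end SmoothPairs

/-! ### Hermite polynomials and their products. -/

section HermitePolynomials

/-- Differentiate `H_{k+2} = X H_{k+1} - H_{k+1}'`: by induction the terms other than `H_{k+1}` form
`k + 1` times `X H_k - H_k' = H_{k+1}`. -/
theorem derivative_hermite_succ (k : ℕ) :
    Polynomial.derivative (Polynomial.hermite (k + 1)) =
      ((k + 1 : ℕ) : Polynomial ℤ) * Polynomial.hermite k := by
  induction k with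
  | zero => simp
  | succ k ih =>
    have h1 := Polynomial.hermite_succ k
    rw [Polynomial.hermite_succ (k + 1), Polynomial.derivative_sub, Polynomial.derivative_mul, ih,
      Polynomial.derivative_X, Polynomial.derivative_mul, Polynomial.derivative_natCast]
    linear_combination (-((k + 1 : ℕ) : Polynomial ℤ)) * h1 +
      (Polynomial.hermite (k + 1)) * (by push_cast; ring :
        ((k + 1 + 1 : ℕ) : Polynomial ℤ) - (k + 1 : ℕ) - 1 = 0) * (-1)

theorem derivative_hermite (k : ℕ) :
    Polynomial.derivative (Polynomial.hermite k) =
      (k : Polynomial ℤ) * Polynomial.hermite (k - 1) := by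
  cases k with
  | zero => simp
  | succ k => rw [derivative_hermite_succ, Nat.add_sub_cancel]

variable {H : Type*}

/-- The product `∏ₐ H_{κ(a)}(X_{e(a)})` of Hermite polynomials. -/
def hermiteProd {m : ℕ} (e : Fin m → H) (κ : Fin m → ℕ) : MvPolynomial H ℝ :=
  ∏ a, Polynomial.aeval (MvPolynomial.X (R := ℝ) (e a)) (Polynomial.hermite (κ a))

theorem eval_hermiteProd {m : ℕ} (x : H → ℝ) (e : Fin m → H) (κ : Fin m → ℕ) :
    MvPolynomial.eval x (hermiteProd e κ) =
      ∏ a, Polynomial.aeval (x (e a)) (Polynomial.hermite (κ a)) := by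
  rw [hermiteProd, map_prod]
  refine Finset.prod_congr rfl fun a _ => ?_
  have := Polynomial.map_aeval_eq_aeval_map (R := ℤ) (S := MvPolynomial H ℝ) (T := ℤ) (U := ℝ)
    (φ := RingHom.id ℤ) (ψ := MvPolynomial.eval x) (RingHom.ext_int _ _) (Polynomial.hermite (κ a))
    (MvPolynomial.X (e a))
  simpa using this

theorem hermiteProd_zero {m : ℕ} (e : Fin m → H) : hermiteProd e 0 = 1 := by
  simp [hermiteProd]

theorem hermiteProd_update {m : ℕ} (e : Fin m → H) (κ : Fin m → ℕ) (a : Fin m) (k : ℕ) :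
    hermiteProd e (Function.update κ a k) =
      (∏ b ∈ Finset.univ.erase a,
        Polynomial.aeval (MvPolynomial.X (R := ℝ) (e b)) (Polynomial.hermite (κ b))) *
      Polynomial.aeval (MvPolynomial.X (R := ℝ) (e a)) (Polynomial.hermite k) := by
  rw [hermiteProd, ← Finset.prod_erase_mul _ _ (Finset.mem_univ a), Function.update_self]
  congr 1
  refine Finset.prod_congr rfl fun b hb => ?_
  rw [Function.update_of_ne (Finset.ne_of_mem_erase hb)]

end HermitePolynomials

/-! ### Polynomials in the Gaussian process: derivations, chaos, number operator. -/

section WienerPolynomials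

variable {H : Type*} [NormedAddCommGroup H] [InnerProductSpace ℝ H]

/-- The derivation `X_h ↦ ⟨h, u⟩` of the polynomial ring with variables indexed by `H`. -/
def dirDeriv (u : H) : Derivation ℝ (MvPolynomial H ℝ) (MvPolynomial H ℝ) :=
  MvPolynomial.mkDerivation ℝ fun h => MvPolynomial.C ⟪h, u⟫_ℝ

@[simp]
theorem dirDeriv_X (u h : H) : dirDeriv u (MvPolynomial.X h) = MvPolynomial.C ⟪h, u⟫_ℝ :=
  MvPolynomial.mkDerivation_X ..

/-- The module structure on `H` over polynomials given by evaluation at a point. -/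
@[reducible]
def evalModule (x : H → ℝ) : Module (MvPolynomial H ℝ) H :=
  Module.compHom H (MvPolynomial.eval x)

theorem evalModule_isScalarTower (x : H → ℝ) :
    letI := evalModule x
    IsScalarTower ℝ (MvPolynomial H ℝ) H :=
  letI := evalModule x
  ⟨fun r p h => by
    change (MvPolynomial.eval x (r • p)) • h = r • (MvPolynomial.eval x p) • h
    rw [MvPolynomial.smul_eval, mul_smul]⟩

/-- The gradient `∑ ∂_h P(x) h` of a polynomial. -/
def gradient (x : H → ℝ) : MvPolynomial H ℝ →ₗ[ℝ] H :=
  letI := evalModule x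
  letI := evalModule_isScalarTower x
  (MvPolynomial.mkDerivation ℝ fun h : H => h).toLinearMap

theorem gradient_X (x : H → ℝ) (h : H) : gradient x (MvPolynomial.X h) = h := by
  let := evalModule x
  let := evalModule_isScalarTower x
  exact MvPolynomial.mkDerivation_X ..

theorem gradient_C (x : H → ℝ) (c : ℝ) : gradient x (MvPolynomial.C c) = 0 := by
  let := evalModule x
  let := evalModule_isScalarTower x
  exact MvPolynomial.derivation_C ..

theorem gradient_mul (x : H → ℝ) (p q : MvPolynomial H ℝ) :
    gradient x (p * q) =
      MvPolynomial.eval x p • gradient x q + MvPolynomial.eval x q • gradient x p := by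
  let := evalModule x
  let := evalModule_isScalarTower x
  exact (MvPolynomial.mkDerivation ℝ fun h : H => h).leibniz p q

theorem inner_gradient (x : H → ℝ) (p : MvPolynomial H ℝ) (u : H) :
    ⟪gradient x p, u⟫_ℝ = MvPolynomial.eval x (dirDeriv u p) := by
  induction p using MvPolynomial.induction_on with
  | C a => rw [gradient_C, MvPolynomial.derivation_C]; simp
  | add p q hp hq => rw [map_add, map_add, inner_add_left, hp, hq, map_add]
  | mul_X p h hp =>
    rw [gradient_mul, gradient_X, Derivation.leibniz, dirDeriv_X, inner_add_left, inner_smul_left,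
      inner_smul_left, hp]
    simp

theorem derivation_prod {κ A : Type*} [CommRing A] [Algebra ℝ A] [DecidableEq κ]
    (D : Derivation ℝ A A) (f : κ → A) (s : Finset κ) :
    D (∏ i ∈ s, f i) = ∑ i ∈ s, (∏ j ∈ s.erase i, f j) * D (f i) := by
  induction s using Finset.induction_on with
  | empty => simp
  | insert a s ha ih =>
    rw [Finset.prod_insert ha, D.leibniz, ih, Finset.sum_insert ha, Finset.erase_insert ha,
      smul_eq_mul, smul_eq_mul, add_comm, Finset.mul_sum]
    congr 1
    refine Finset.sum_congr rfl fun i hi => ?_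
    have hia : i ≠ a := fun h => ha (h ▸ hi)
    rw [Finset.erase_insert_of_ne hia.symm, Finset.prod_insert (fun h => ha (Finset.mem_of_mem_erase h)),
      mul_assoc]

theorem dirDeriv_aeval (u : H) (q : MvPolynomial H ℝ) (p : Polynomial ℤ) :
    dirDeriv u (Polynomial.aeval q p) =
      Polynomial.aeval q (Polynomial.derivative p) * dirDeriv u q :=
  ((dirDeriv u).restrictScalars ℤ).map_aeval p q

theorem dirDeriv_hermiteProd {m : ℕ} (u : H) (e : Fin m → H) (κ : Fin m → ℕ) :
    dirDeriv u (hermiteProd e κ) =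
      ∑ a, (κ a * ⟪e a, u⟫_ℝ) • hermiteProd e (Function.update κ a (κ a - 1)) := by
  rw [hermiteProd, derivation_prod]
  refine Finset.sum_congr rfl fun a _ => ?_
  rw [dirDeriv_aeval, dirDeriv_X, derivative_hermite, hermiteProd_update, map_mul, map_natCast,
    MvPolynomial.smul_eq_C_mul, map_mul, map_natCast]
  ring

/-- The creation operator. Orthonormality leaves only the factor at `a` to differentiate, where the
formula is the Hermite recurrence. -/
theorem hermiteProd_update_succ {m : ℕ} {e : Fin m → H} (he : Orthonormal ℝ e) (κ : Fin m → ℕ)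
    (a : Fin m) :
    hermiteProd e (Function.update κ a (κ a + 1)) =
      MvPolynomial.X (e a) * hermiteProd e κ - dirDeriv (e a) (hermiteProd e κ) := by
  rw [dirDeriv_hermiteProd, Finset.sum_eq_single a]
  · have h0 : hermiteProd e κ = hermiteProd e (Function.update κ a (κ a)) := by
      rw [Function.update_eq_self]
    rw [h0, hermiteProd_update, hermiteProd_update, hermiteProd_update, Polynomial.hermite_succ,
      derivative_hermite, real_inner_self_eq_norm_sq, he.1 a, MvPolynomial.smul_eq_C_mul]
    simp only [map_sub, map_mul, map_natCast, Polynomial.aeval_X, one_pow, mul_one]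
    ring
  · intro b _ hb
    rw [he.2 hb, mul_zero, zero_smul]
  · simp

theorem gradient_hermiteProd {m : ℕ} (x : H → ℝ) (e : Fin m → H) (κ : Fin m → ℕ) :
    gradient x (hermiteProd e κ) =
      ∑ a, (κ a * MvPolynomial.eval x (hermiteProd e (Function.update κ a (κ a - 1)))) • e a := by
  refine ext_inner_right ℝ fun u => ?_
  rw [inner_gradient, dirDeriv_hermiteProd, map_sum, sum_inner]
  refine Finset.sum_congr rfl fun a _ => ?_
  rw [MvPolynomial.smul_eval, inner_smul_left, conj_trivial]
  ring

/-- The `n`-th homogeneous chaos of polynomials built on a subspace `V`. -/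
def polyChaos (n : ℕ) (V : Submodule ℝ H) : Submodule ℝ (MvPolynomial H ℝ) :=
  Submodule.span ℝ {q | ∃ (m : ℕ) (e : Fin m → H) (κ : Fin m → ℕ), Orthonormal ℝ e ∧
    (∀ a, e a ∈ V) ∧ ∑ a, κ a = n ∧ q = hermiteProd e κ}

theorem sum_update_pred {m : ℕ} {κ : Fin m → ℕ} {a : Fin m} (ha : κ a ≠ 0) {n : ℕ}
    (h : ∑ b, κ b = n + 1) : ∑ b, Function.update κ a (κ a - 1) b = n := by
  have h1 := Finset.sum_update_of_mem (Finset.mem_univ a) κ (κ a - 1)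
  have h2 := Finset.add_sum_erase Finset.univ κ (Finset.mem_univ a)
  rw [Finset.sdiff_singleton_eq_erase] at h1
  omega

theorem dirDeriv_mem_polyChaos {n : ℕ} {V : Submodule ℝ H} {q : MvPolynomial H ℝ}
    (hq : q ∈ polyChaos (n + 1) V) (u : H) : dirDeriv u q ∈ polyChaos n V := by
  refine Submodule.span_induction (p := fun q _ => dirDeriv u q ∈ polyChaos n V) ?_ ?_ ?_ ?_ hq
  · rintro _ ⟨m, e, κ, he, hV, hκ, rfl⟩
    rw [dirDeriv_hermiteProd]
    refine Submodule.sum_mem _ fun a _ => ?_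
    by_cases ha : κ a = 0
    · simp [ha]
    · exact Submodule.smul_mem _ _ (Submodule.subset_span
        ⟨m, e, _, he, hV, sum_update_pred ha hκ, rfl⟩)
  · rw [map_zero]; exact Submodule.zero_mem _
  · intro p q _ _ hp hq; rw [map_add]; exact Submodule.add_mem _ hp hq
  · intro c p _ hp; rw [Derivation.map_smul]; exact Submodule.smul_mem _ _ hp

theorem exists_eq_C_of_mem_polyChaos_zero {V : Submodule ℝ H} {q : MvPolynomial H ℝ}
    (hq : q ∈ polyChaos 0 V) : ∃ c, q = MvPolynomial.C c := by
  refine Submodule.span_induction (p := fun q _ => ∃ c, q = MvPolynomial.C c) ?_ ?_ ?_ ?_ hq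
  · rintro _ ⟨m, e, κ, -, -, hκ, rfl⟩
    have : κ = 0 := by
      ext a
      exact (Finset.sum_eq_zero_iff.1 hκ) a (Finset.mem_univ a)
    exact ⟨1, by rw [this, hermiteProd_zero, map_one]⟩
  · exact ⟨0, by simp⟩
  · rintro _ _ _ _ ⟨c, rfl⟩ ⟨d, rfl⟩; exact ⟨c + d, by simp⟩
  · rintro c _ _ ⟨d, rfl⟩; exact ⟨c * d, by rw [MvPolynomial.smul_eq_C_mul, map_mul]⟩

theorem gradient_mem_of_mem_polyChaos {n : ℕ} {V : Submodule ℝ H} {q : MvPolynomial H ℝ}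
    (hq : q ∈ polyChaos n V) (x : H → ℝ) : gradient x q ∈ V := by
  refine Submodule.span_induction (p := fun q _ => gradient x q ∈ V) ?_ ?_ ?_ ?_ hq
  · rintro _ ⟨m, e, κ, -, hV, -, rfl⟩
    rw [gradient_hermiteProd]
    exact Submodule.sum_mem _ fun a _ => Submodule.smul_mem _ _ (hV a)
  · rw [map_zero]; exact V.zero_mem
  · intro p q _ _ hp hq; rw [map_add]; exact V.add_mem hp hq
  · intro c p _ hp; rw [map_smul]; exact V.smul_mem _ hp

theorem polyChaos_mono {n : ℕ} {V V' : Submodule ℝ H} (h : V ≤ V') :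
    polyChaos n V ≤ polyChaos n V' :=
  Submodule.span_mono fun _ ⟨m, e, κ, he, hV, hκ, hq⟩ => ⟨m, e, κ, he, fun a => h (hV a), hκ, hq⟩

variable {Ω : Type*} {W : H → Ω → ℝ}

/-- The random variable obtained by evaluating a polynomial along `W`. -/
def polyEval (W : H → Ω → ℝ) (q : MvPolynomial H ℝ) (ω : Ω) : ℝ :=
  MvPolynomial.eval (fun h => W h ω) q

/-- The gradient of a polynomial along `W`. -/
def polyGrad (W : H → Ω → ℝ) (q : MvPolynomial H ℝ) (ω : Ω) : H :=
  gradient (fun h => W h ω) q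

theorem polyGrad_mem_of_mem_polyChaos {n : ℕ} {V : Submodule ℝ H} {q : MvPolynomial H ℝ}
    (hq : q ∈ polyChaos n V) (ω : Ω) : polyGrad W q ω ∈ V :=
  gradient_mem_of_mem_polyChaos hq _

theorem isSmoothPair_poly (W : H → Ω → ℝ) (q : MvPolynomial H ℝ) :
    IsSmoothPair W (polyEval W q) (polyGrad W q) := by
  induction q using MvPolynomial.induction_on with
  | C c =>
    have := IsSmoothPair.const (W := W) c
    convert this using 1
    · ext ω; simp [polyEval]
    · ext ω; simp [polyGrad, gradient_C]
  | add p q hp hq =>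
    convert hp.add hq using 1
    · ext ω; simp [polyEval]
    · ext ω; simp [polyGrad]
  | mul_X p h hp =>
    convert hp.mul (IsSmoothPair.eval (W := W) h) using 1
    · ext ω; simp [polyEval]
    · ext ω; simp [polyGrad, gradient_mul, gradient_X, polyEval]

variable [MeasurableSpace Ω] {P : Measure Ω} [IsProbabilityMeasure P]

theorem IsIsonormal.allMoments_polyEval (hW : IsIsonormal W P) (q : MvPolynomial H ℝ) :
    AllMoments (polyEval W q) P := ((isSmoothPair_poly W q).allMoments hW).1

theorem IsIsonormal.allMoments_polyGrad (hW : IsIsonormal W P) (q : MvPolynomial H ℝ) :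
    AllMoments (polyGrad W q) P := ((isSmoothPair_poly W q).allMoments hW).2

/-- Creation and annihilation are adjoint. -/
theorem IsSmoothPair.integral_inner_mul_hermiteProd (hW : IsIsonormal W P) {F : Ω → ℝ}
    {DF : Ω → H} (hF : IsSmoothPair W F DF) {m : ℕ} {e : Fin m → H} (he : Orthonormal ℝ e)
    (κ : Fin m → ℕ) (a : Fin m) :
    ∫ ω, ⟪DF ω, e a⟫_ℝ * polyEval W (hermiteProd e κ) ω ∂P =
      ∫ ω, F ω * polyEval W (hermiteProd e (Function.update κ a (κ a + 1))) ω ∂P := by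
  rw [hF.integral_inner_mul hW (isSmoothPair_poly W _)]
  congr 1
  ext ω
  rw [hermiteProd_update_succ he]
  simp only [polyEval, polyGrad, inner_gradient, map_sub, map_mul, MvPolynomial.eval_X]

/-- The chaos of degree `n` is an eigenspace of the number operator. On a Hermite product the
gradient lowers one exponent with weight `κ a`, adjointness raises it again, and the weights add up
to `n`. -/
theorem IsSmoothPair.integral_inner_polyGrad (hW : IsIsonormal W P) {F : Ω → ℝ}
    {DF : Ω → H} (hF : IsSmoothPair W F DF) {n : ℕ} {V : Submodule ℝ H} {q : MvPolynomial H ℝ}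
    (hq : q ∈ polyChaos n V) :
    ∫ ω, ⟪DF ω, polyGrad W q ω⟫_ℝ ∂P = n * ∫ ω, F ω * polyEval W q ω ∂P := by
  obtain ⟨mF, mDF⟩ := hF.allMoments hW
  refine Submodule.span_induction (p := fun q _ => ∫ ω, ⟪DF ω, polyGrad W q ω⟫_ℝ ∂P =
    n * ∫ ω, F ω * polyEval W q ω ∂P) ?_ ?_ ?_ ?_ hq
  · rintro _ ⟨m, e, κ, he, -, hκ, rfl⟩
    have e1 : ∀ ω, ⟪DF ω, polyGrad W (hermiteProd e κ) ω⟫_ℝ = ∑ a, κ a * (⟪DF ω, e a⟫_ℝ *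
        polyEval W (hermiteProd e (Function.update κ a (κ a - 1))) ω) := fun ω => by
      rw [polyGrad, gradient_hermiteProd, inner_sum]
      refine Finset.sum_congr rfl fun a _ => ?_
      rw [inner_smul_right, polyEval]
      ring
    simp_rw [e1]
    rw [integral_finsetSum _ fun a _ => (((mDF.inner (AllMoments.const _)).mul
      (hW.allMoments_polyEval _)).integrable.const_mul _), ← hκ, Nat.cast_sum, Finset.sum_mul]
    refine Finset.sum_congr rfl fun a _ => ?_
    rw [integral_const_mul]
    -- Here `κ a - 1` is truncated, but the weight `κ a` removes the term.
    by_cases ha : κ a = 0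
    · simp [ha]
    · rw [hF.integral_inner_mul_hermiteProd hW he, Function.update_self, Function.update_idem,
        Nat.sub_add_cancel (Nat.one_le_iff_ne_zero.2 ha), Function.update_eq_self]
  · simp [polyGrad, polyEval]
  · intro p q _ _ hp hq
    simp only [polyGrad, polyEval, map_add, inner_add_right, mul_add] at hp hq ⊢
    have i1 := fun q => (mDF.inner (hW.allMoments_polyGrad q)).integrable
    have i2 := fun q => (mF.mul (hW.allMoments_polyEval q)).integrable
    simp only [polyGrad, polyEval] at i1 i2
    rw [integral_add (i1 p) (i1 q), integral_add (i2 p) (i2 q), hp, hq, mul_add]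
  · intro c q _ hq
    simp only [polyGrad, polyEval, map_smul, inner_smul_right, MvPolynomial.smul_eval] at hq ⊢
    have : ∀ ω, F ω * (c * MvPolynomial.eval (fun h => W h ω) q) =
      c * (F ω * MvPolynomial.eval (fun h => W h ω) q) := fun ω => by ring
    simp_rw [this]
    rw [integral_const_mul, integral_const_mul, hq]
    ring

end WienerPolynomials

/-! ### Moment comparison on a fixed chaos. -/

section Hypercontractivity

variable {H : Type*} [NormedAddCommGroup H] [InnerProductSpace ℝ H]

theorem gradient_pow (x : H → ℝ) (p : MvPolynomial H ℝ) (k : ℕ) :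
    gradient x (p ^ k) = (k * MvPolynomial.eval x p ^ (k - 1)) • gradient x p := by
  let := evalModule x
  let := evalModule_isScalarTower x
  have h := (MvPolynomial.mkDerivation ℝ fun h : H => h).leibniz_pow p k
  refine h.trans ?_
  change k • (MvPolynomial.eval x (p ^ (k - 1)) • gradient x p) = _
  rw [map_pow, ← Nat.cast_smul_eq_nsmul ℝ, smul_smul]

theorem norm_sum_smul_sq_le {κ : Type*} [Fintype κ] (v : κ → ℝ) (g : κ → H) :
    ‖∑ c, v c • g c‖ ^ 2 ≤ (∑ c, v c ^ 2) * ∑ c, ‖g c‖ ^ 2 := by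
  have h1 : ‖∑ c, v c • g c‖ ≤ ∑ c, |v c| * ‖g c‖ :=
    norm_sum_le_of_le _ fun c _ => by rw [norm_smul, Real.norm_eq_abs]
  calc ‖∑ c, v c • g c‖ ^ 2 ≤ (∑ c, |v c| * ‖g c‖) ^ 2 := by gcongr
    _ ≤ (∑ c, |v c| ^ 2) * ∑ c, ‖g c‖ ^ 2 := Finset.sum_mul_sq_le_sq_mul_sq _ _ _
    _ = _ := by simp only [sq_abs]

/-- A crude Young inequality: either `t ≤ δ * s` or `s ≤ δ⁻¹ * t`, and each case yields one of the
two terms. -/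
theorem pow_mul_le_add {s t δ : ℝ} (hs : 0 ≤ s) (ht : 0 ≤ t) (hδ : 0 < δ) (q : ℕ) :
    s ^ q * t ≤ δ * s ^ (q + 1) + (δ⁻¹) ^ q * t ^ (q + 1) := by
  rcases le_total t (δ * s) with h | h
  · have h1 : s ^ q * t ≤ s ^ q * (δ * s) := by gcongr
    have h2 : 0 ≤ (δ⁻¹) ^ q * t ^ (q + 1) := by positivity
    rw [pow_succ]
    linarith
  · have h1 : s ≤ δ⁻¹ * t := by
      rw [inv_mul_eq_div, le_div_iff₀ hδ]
      linarith
    have h2 : s ^ q * t ≤ (δ⁻¹ * t) ^ q * t := by gcongr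
    have h3 : 0 ≤ δ * s ^ (q + 1) := by positivity
    rw [mul_pow, mul_assoc, ← pow_succ] at h2
    linarith

variable {Ω : Type*} [MeasurableSpace Ω] {P : Measure Ω} [IsProbabilityMeasure P] {W : H → Ω → ℝ}

/-- With `S = ∑ F_c²`, the number operator identity is applied to `F_c * S ^ q` against `F_c` and
summed over `c`. The product rule yields `S ^ q * ∑ ‖DF_c‖²` and a cross term in `‖∑ F_c DF_c‖²`,
which Cauchy–Schwarz bounds by `2 q` times the same quantity. -/
theorem integral_sum_sq_pow_le_aux (hW : IsIsonormal W P) {n : ℕ} {V : Submodule ℝ H}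
    {κ : Type*} [Fintype κ] {F : κ → MvPolynomial H ℝ} (hF : ∀ c, F c ∈ polyChaos n V) (q : ℕ) :
    n * ∫ ω, (∑ c, polyEval W (F c) ω ^ 2) ^ (q + 1) ∂P ≤
      (2 * q + 1) * ∫ ω, (∑ c, polyEval W (F c) ω ^ 2) ^ q * ∑ c, ‖polyGrad W (F c) ω‖ ^ 2 ∂P := by
  set S : MvPolynomial H ℝ := ∑ c, F c ^ 2 with hS
  have hSe : ∀ ω, polyEval W S ω = ∑ c, polyEval W (F c) ω ^ 2 := fun ω => by
    simp [polyEval, hS]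
  have hSnn : ∀ ω, 0 ≤ polyEval W S ω := fun ω => by rw [hSe]; positivity
  have hSg : ∀ ω, polyGrad W S ω = (2 : ℝ) • ∑ c, polyEval W (F c) ω • polyGrad W (F c) ω :=
    fun ω => by
      simp only [polyGrad, hS, map_sum, gradient_pow, polyEval, Finset.smul_sum, smul_smul]
      simp
  have mE := hW.allMoments_polyEval
  have mG := hW.allMoments_polyGrad
  have mT : AllMoments (fun ω => ∑ c, ‖polyGrad W (F c) ω‖ ^ 2) P :=
    AllMoments.sum fun c _ => (mG (F c)).norm.pow 2
  have hIBP : ∀ c, n * ∫ ω, polyEval W (F c * S ^ q) ω * polyEval W (F c) ω ∂P =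
      ∫ ω, ⟪polyGrad W (F c * S ^ q) ω, polyGrad W (F c) ω⟫_ℝ ∂P := fun c =>
    ((isSmoothPair_poly W _).integral_inner_polyGrad hW (hF c)).symm
  have h1 : n * ∫ ω, (∑ c, polyEval W (F c) ω ^ 2) ^ (q + 1) ∂P =
      ∫ ω, ∑ c, ⟪polyGrad W (F c * S ^ q) ω, polyGrad W (F c) ω⟫_ℝ ∂P := by
    rw [integral_finsetSum _ fun c _ => ((mG _).inner (mG _)).integrable]
    simp_rw [← hIBP]
    rw [← Finset.mul_sum, ← integral_finsetSum _ fun c _ => ((mE _).mul (mE _)).integrable]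
    congr 2
    ext ω
    rw [← hSe, pow_succ, hSe ω, Finset.mul_sum]
    refine Finset.sum_congr rfl fun c _ => ?_
    rw [← hSe]
    simp only [polyEval, map_mul, map_pow]
    ring
  rw [h1, ← integral_const_mul]
  refine integral_mono (AllMoments.sum fun c _ => (mG _).inner (mG _)).integrable
    ((((AllMoments.sum fun c _ => (mE (F c)).pow 2).pow q).mul mT).integrable.const_mul _) fun ω => ?_
  simp only
  rw [← hSe]
  set s := polyEval W S ω with hs
  have e1 : ∀ c, polyGrad W (F c * S ^ q) ω =
      (polyEval W (F c) ω * (q * s ^ (q - 1))) • polyGrad W S ω + s ^ q • polyGrad W (F c) ω :=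
    fun c => by
      simp only [polyGrad, gradient_mul, gradient_pow, map_pow, smul_smul]
      rfl
  have e2 : ∑ c, ⟪polyGrad W (F c * S ^ q) ω, polyGrad W (F c) ω⟫_ℝ =
      2 * (q * s ^ (q - 1)) * ‖∑ c, polyEval W (F c) ω • polyGrad W (F c) ω‖ ^ 2 +
        s ^ q * ∑ c, ‖polyGrad W (F c) ω‖ ^ 2 := by
    rw [← real_inner_self_eq_norm_sq, Finset.mul_sum]
    conv_rhs => rw [inner_sum, Finset.mul_sum]
    rw [← Finset.sum_add_distrib]
    refine Finset.sum_congr rfl fun c _ => ?_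
    rw [e1, inner_add_left, inner_smul_left, inner_smul_left, real_inner_self_eq_norm_sq, hSg,
      inner_smul_left, inner_smul_right]
    simp only [conj_trivial]
    ring
  rw [e2]
  have hCS := norm_sum_smul_sq_le (fun c => polyEval W (F c) ω) (fun c => polyGrad W (F c) ω)
  rw [← hSe, ← hs] at hCS
  set T := ∑ c, ‖polyGrad W (F c) ω‖ ^ 2 with hT
  have hs0 : 0 ≤ s := hSnn ω
  have e3 : (q : ℝ) * s ^ (q - 1) * (s * T) = q * (s ^ q * T) := by
    rcases Nat.eq_zero_or_pos q with rfl | hq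
    · simp
    · obtain ⟨r, rfl⟩ : ∃ r, q = r + 1 := ⟨q - 1, by omega⟩
      rw [Nat.add_sub_cancel, pow_succ]
      ring
  calc _ ≤ 2 * (q * s ^ (q - 1)) * (s * T) + s ^ q * T := by gcongr
    _ = 2 * (q * s ^ (q - 1) * (s * T)) + s ^ q * T := by ring
    _ = (2 * q + 1) * (s ^ q * T) := by rw [e3]; ring

theorem norm_sq_eq_sum_inner_basis {V : Submodule ℝ H} {d : ℕ} (b : OrthonormalBasis (Fin d) ℝ V)
    {w : H} (hw : w ∈ V) : ‖w‖ ^ 2 = ∑ a, ⟪w, (b a : H)⟫_ℝ ^ 2 := by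
  have h := b.sum_sq_norm_inner_left ⟨w, hw⟩
  simp only [Submodule.coe_inner, Real.norm_eq_abs, sq_abs, Submodule.coe_norm] at h
  exact h.symm

/-- Hypercontractivity: all moments on a fixed chaos are controlled by the second one. -/
theorem exists_hypercontractive_const (q n : ℕ) :
    ∃ K : ℝ, 0 ≤ K ∧ ∀ {H : Type*} [NormedAddCommGroup H] [InnerProductSpace ℝ H]
      {Ω : Type*} [MeasurableSpace Ω] {P : Measure Ω} [IsProbabilityMeasure P] {W : H → Ω → ℝ},
      IsIsonormal W P → ∀ (V : Submodule ℝ H) [FiniteDimensional ℝ V]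
      (κ : Type) [Fintype κ] (F : κ → MvPolynomial H ℝ), (∀ c, F c ∈ polyChaos n V) →
      ∫ ω, (∑ c, polyEval W (F c) ω ^ 2) ^ (q + 1) ∂P ≤
        K * (∫ ω, ∑ c, polyEval W (F c) ω ^ 2 ∂P) ^ (q + 1) := by
  induction n with
  | zero =>
    refine ⟨1, zero_le_one, ?_⟩
    intro H _ _ Ω _ P _ W hW V _ κ _ F hF
    choose c hc using fun i => exists_eq_C_of_mem_polyChaos_zero (hF i)
    have : ∀ i ω, polyEval W (F i) ω = c i := fun i ω => by
      rw [polyEval, hc, MvPolynomial.eval_C]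
    simp [this]
  | succ n ih =>
    obtain ⟨K, hK, ih⟩ := ih
    -- Then `(2 * q + 1) * δ` is half of `n + 1`, so the moment reappearing on the right is absorbed
    -- on the left.
    set δ : ℝ := (n + 1) / (2 * (2 * q + 1)) with hδ
    have hδ0 : 0 < δ := by positivity
    set K' : ℝ := 2 * (2 * q + 1) * (δ⁻¹) ^ q / (n + 1) with hK'
    refine ⟨K' * (K * (n + 1) ^ (q + 1)), by positivity, ?_⟩
    intro H _ _ Ω _ P _ W hW V _ κ _ F hF
    set b := stdOrthonormalBasis ℝ V
    -- The gradient coordinates form a family one degree lower; this is why the induction runs over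
    -- finite families. The constant must not depend on the size of the family nor on `V`.
    set G : κ × Fin (Module.finrank ℝ V) → MvPolynomial H ℝ :=
      fun z => dirDeriv (b z.2 : H) (F z.1) with hG
    have hT : ∀ ω, ∑ c, ‖polyGrad W (F c) ω‖ ^ 2 = ∑ z, polyEval W (G z) ω ^ 2 := fun ω => by
      rw [Fintype.sum_prod_type]
      refine Finset.sum_congr rfl fun c _ => ?_
      rw [norm_sq_eq_sum_inner_basis b (polyGrad_mem_of_mem_polyChaos (hF c) ω)]
      refine Finset.sum_congr rfl fun a _ => ?_
      rw [polyGrad, inner_gradient, hG, polyEval]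
    have mE := hW.allMoments_polyEval
    have mS : AllMoments (fun ω => ∑ c, polyEval W (F c) ω ^ 2) P :=
      AllMoments.sum fun c _ => (mE (F c)).pow 2
    have mT : AllMoments (fun ω => ∑ z, polyEval W (G z) ω ^ 2) P :=
      AllMoments.sum fun z _ => (mE (G z)).pow 2
    have h1 := integral_sum_sq_pow_le_aux hW hF q
    simp_rw [hT] at h1
    have h2 : ∫ ω, (∑ c, polyEval W (F c) ω ^ 2) ^ q * ∑ z, polyEval W (G z) ω ^ 2 ∂P ≤
        δ * ∫ ω, (∑ c, polyEval W (F c) ω ^ 2) ^ (q + 1) ∂P +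
          (δ⁻¹) ^ q * ∫ ω, (∑ z, polyEval W (G z) ω ^ 2) ^ (q + 1) ∂P := by
      rw [← integral_const_mul, ← integral_const_mul, ← integral_add
        ((mS.pow _).integrable.const_mul _) ((mT.pow _).integrable.const_mul _)]
      exact integral_mono ((mS.pow q).mul mT).integrable
        (((mS.pow _).integrable.const_mul _).add ((mT.pow _).integrable.const_mul _))
        fun ω => pow_mul_le_add (by positivity) (by positivity) hδ0 q
    have h3 := ih hW V _ G fun z => dirDeriv_mem_polyChaos (hF z.1) _
    have h4 : ∫ ω, ∑ z, polyEval W (G z) ω ^ 2 ∂P =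
        (n + 1) * ∫ ω, ∑ c, polyEval W (F c) ω ^ 2 ∂P := by
      simp_rw [← hT]
      rw [integral_finsetSum _ fun c _ => (((hW.allMoments_polyGrad (F c)).norm.pow 2).integrable),
        integral_finsetSum _ fun c _ => (((mE (F c)).pow 2).integrable), Finset.mul_sum]
      refine Finset.sum_congr rfl fun c _ => ?_
      have := (isSmoothPair_poly W (F c)).integral_inner_polyGrad hW (hF c)
      simp_rw [real_inner_self_eq_norm_sq, ← pow_two] at this
      rw [this]
      push_cast
      ring
    rw [h4, mul_pow] at h3
    set A := ∫ ω, (∑ c, polyEval W (F c) ω ^ 2) ^ (q + 1) ∂P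
    set B := ∫ ω, (∑ z, polyEval W (G z) ω ^ 2) ^ (q + 1) ∂P
    set M := ∫ ω, ∑ c, polyEval W (F c) ω ^ 2 ∂P
    have h5 : A ≤ K' * B := by
      have h6 : ((n + 1 : ℕ) : ℝ) * A ≤ (2 * q + 1) * (δ * A + (δ⁻¹) ^ q * B) :=
        h1.trans (by gcongr)
      have h7 : (2 * q + 1 : ℝ) * δ = (n + 1) / 2 := by rw [hδ]; field_simp
      push_cast at h6
      have h8 : (n + 1 : ℝ) / 2 * A ≤ (2 * q + 1) * ((δ⁻¹) ^ q * B) := by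
        have : (2 * q + 1) * (δ * A + (δ⁻¹) ^ q * B) =
          (n + 1) / 2 * A + (2 * q + 1) * ((δ⁻¹) ^ q * B) := by rw [← h7]; ring
        linarith
      rw [hK', div_mul_eq_mul_div, le_div_iff₀ (by positivity)]
      linarith
    have hK'0 : 0 ≤ K' := by positivity
    calc A ≤ K' * B := h5
      _ ≤ K' * (K * ((n + 1) ^ (q + 1) * M ^ (q + 1))) := by gcongr
      _ = _ := by ring

/-- Moments of the gradient of an element of a fixed chaos. -/
theorem exists_gradient_moment_const (q n : ℕ) (hn : 1 ≤ n) :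
    ∃ K : ℝ, 0 ≤ K ∧ ∀ {H : Type*} [NormedAddCommGroup H] [InnerProductSpace ℝ H]
      {Ω : Type*} [MeasurableSpace Ω] {P : Measure Ω} [IsProbabilityMeasure P] {W : H → Ω → ℝ},
      IsIsonormal W P → ∀ (V : Submodule ℝ H) [FiniteDimensional ℝ V]
      (F : MvPolynomial H ℝ), F ∈ polyChaos n V →
      ∫ ω, (‖polyGrad W F ω‖ ^ 2) ^ (q + 1) ∂P ≤
        K * (∫ ω, polyEval W F ω ^ 2 ∂P) ^ (q + 1) := by
  obtain ⟨r, rfl⟩ : ∃ r, n = r + 1 := ⟨n - 1, by omega⟩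
  obtain ⟨K, hK, h⟩ := exists_hypercontractive_const q r
  refine ⟨K * ((r + 1 : ℕ) : ℝ) ^ (q + 1), by positivity, ?_⟩
  intro H _ _ Ω _ P _ W hW V _ F hF
  set b := stdOrthonormalBasis ℝ V
  have h1 := h hW V _ (fun a => dirDeriv (b a : H) F) fun a => dirDeriv_mem_polyChaos hF _
  have hT : ∀ ω, ∑ a, polyEval W (dirDeriv (b a : H) F) ω ^ 2 = ‖polyGrad W F ω‖ ^ 2 := fun ω => by
    rw [norm_sq_eq_sum_inner_basis b (polyGrad_mem_of_mem_polyChaos hF ω)]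
    refine Finset.sum_congr rfl fun a _ => ?_
    rw [polyGrad, inner_gradient, polyEval]
  simp_rw [hT] at h1
  have h2 := (isSmoothPair_poly W F).integral_inner_polyGrad hW hF
  simp_rw [real_inner_self_eq_norm_sq, ← pow_two] at h2
  rw [h2, mul_pow] at h1
  linarith

end Hypercontractivity

/-! ### The isometry of multiple integrals. -/

section Isometry

/-- The number of times that each value is taken by `j`. -/
def occurrences {n m : ℕ} (j : Fin n → Fin m) (a : Fin m) : ℕ :=
  (Finset.univ.filter fun i => j i = a).card

theorem sum_occurrences {n m : ℕ} (j : Fin n → Fin m) : ∑ a, occurrences j a = n := by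
  have := Finset.card_eq_sum_card_fiberwise (f := j) (s := Finset.univ) (t := Finset.univ)
    (fun _ _ => Finset.mem_univ _)
  rw [Finset.card_univ, Fintype.card_fin] at this
  exact this.symm

theorem occurrences_succ {n m : ℕ} (j : Fin (n + 1) → Fin m) :
    occurrences j = Function.update (occurrences fun i : Fin n => j i.succ) (j 0)
      (occurrences (fun i : Fin n => j i.succ) (j 0) + 1) := by
  ext a
  rw [occurrences, Fin.card_filter_univ_succ, Function.update_apply]
  by_cases h : j 0 = a
  · rw [if_pos h, if_pos h.symm, h]; rfl
  · rw [if_neg h, if_neg (Ne.symm h)]; rfl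

theorem occurrences_comp_perm {n m : ℕ} (j : Fin n → Fin m) (σ : Equiv.Perm (Fin n)) :
    occurrences (fun i => j (σ i)) = occurrences j := by
  ext a
  exact Finset.card_equiv σ (by simp)

theorem sum_comp_eq_sum_occurrences {n m : ℕ} {A : Type*} [AddCommMonoid A] (j : Fin n → Fin m)
    (G : Fin m → A) : ∑ i, G (j i) = ∑ a, occurrences j a • G a := by
  rw [← Finset.sum_fiberwise (s := Finset.univ) (g := j)]
  refine Finset.sum_congr rfl fun a _ => ?_
  rw [Finset.sum_congr rfl fun i hi => by rw [(Finset.mem_filter.1 hi).2], Finset.sum_const]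
  rfl

/-- Expansion of a permanent along its row `0`. -/
theorem sum_perm_succ {n : ℕ} (A : Fin (n + 1) → Fin (n + 1) → ℝ) :
    ∑ σ : Equiv.Perm (Fin (n + 1)), ∏ i, A i (σ i) =
      ∑ p, A 0 p * ∑ τ : Equiv.Perm (Fin n), ∏ i : Fin n, A i.succ (Equiv.swap 0 p (τ i).succ) := by
  rw [← Equiv.sum_comp Equiv.Perm.decomposeFin.symm, Fintype.sum_prod_type]
  refine Finset.sum_congr rfl fun p _ => ?_
  rw [Finset.mul_sum]
  refine Finset.sum_congr rfl fun τ _ => ?_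
  rw [Fin.prod_univ_succ, Equiv.Perm.decomposeFin_symm_apply_zero]
  simp only [Equiv.Perm.decomposeFin_symm_apply_succ]

variable {H : Type*} [NormedAddCommGroup H] [InnerProductSpace ℝ H]

/-- Summing over positions of the word `j` instead of over letters absorbs the multiplicities.
Position `i` is deleted by swapping it to the front, which matches `sum_perm_succ` term by term. -/
theorem dirDeriv_hermiteProd_occurrences {n m : ℕ} (u : H) (e : Fin m → H)
    (j : Fin (n + 1) → Fin m) :
    dirDeriv u (hermiteProd e (occurrences j)) = ∑ i, ⟪e (j i), u⟫_ℝ •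
      hermiteProd e (occurrences fun l : Fin n => j (Equiv.swap 0 i l.succ)) := by
  have h : ∀ i, occurrences (fun l : Fin n => j (Equiv.swap 0 i l.succ)) =
      Function.update (occurrences j) (j i) (occurrences j (j i) - 1) := by
    intro i
    have h1 := occurrences_succ fun l => j (Equiv.swap 0 i l)
    rw [occurrences_comp_perm, Equiv.swap_apply_left] at h1
    rw [h1, Function.update_self, Function.update_idem, Nat.add_sub_cancel, Function.update_eq_self]
  simp_rw [h]
  rw [sum_comp_eq_sum_occurrences j (fun a => ⟪e a, u⟫_ℝ •
    hermiteProd e (Function.update (occurrences j) a (occurrences j a - 1))), dirDeriv_hermiteProd]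
  refine Finset.sum_congr rfl fun a _ => ?_
  rw [← Nat.cast_smul_eq_nsmul ℝ, smul_smul]

/-- In the double sum over permutations the inner sum does not depend on the outer permutation, so
one of the two factors `1 / n!` cancels. -/
theorem factorial_mul_inner_symTensor {n : ℕ} (v w : Fin n → H) :
    (n.factorial : ℝ) * ⟪symTensor v, symTensor w⟫_ℝ =
      ∑ σ : Equiv.Perm (Fin n), ∏ i, ⟪v (σ i), w i⟫_ℝ := by
  have hn : (n.factorial : ℝ) ≠ 0 := by exact_mod_cast n.factorial_ne_zero
  rw [symTensor, symTensor, inner_smul_left, inner_smul_right, sum_inner]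
  simp_rw [inner_sum, inner_pureTensor]
  rw [Finset.sum_comm]
  have h : ∀ τ : Equiv.Perm (Fin n), ∑ σ : Equiv.Perm (Fin n), ∏ i, ⟪v (σ i), w (τ i)⟫_ℝ =
      ∑ σ : Equiv.Perm (Fin n), ∏ i, ⟪v (σ i), w i⟫_ℝ := by
    intro τ
    rw [← Equiv.sum_comp (Equiv.mulRight τ)]
    refine Finset.sum_congr rfl fun σ _ => ?_
    exact Equiv.prod_comp τ fun i => ⟪v (σ i), w i⟫_ℝ
  simp_rw [h]
  rw [Finset.sum_const, Finset.card_univ, Fintype.card_perm, Fintype.card_fin, nsmul_eq_mul]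
  simp only [conj_trivial]
  field_simp

variable {Ω : Type*} [MeasurableSpace Ω] {P : Measure Ω} [IsProbabilityMeasure P] {W : H → Ω → ℝ}

/-- Peel the letter `j 0` off one product by creation–annihilation duality. The derivative falls on
the other product, and the result is the recursive expansion of the permanent. The adjointness needs
only `e` to be orthonormal. -/
theorem integral_hermiteProd_mul_hermiteProd (hW : IsIsonormal W P) {n m m' : ℕ} {e : Fin m → H}
    {e' : Fin m' → H} (he : Orthonormal ℝ e) (j : Fin n → Fin m) (j' : Fin n → Fin m') :
    ∫ ω, polyEval W (hermiteProd e' (occurrences j')) ω *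
        polyEval W (hermiteProd e (occurrences j)) ω ∂P =
      ∑ σ : Equiv.Perm (Fin n), ∏ i, ⟪e' (j' (σ i)), e (j i)⟫_ℝ := by
  induction n with
  | zero =>
    have h : ∀ {m : ℕ} (j : Fin 0 → Fin m), occurrences j = 0 := fun j => by
      ext a; simp [occurrences]
    simp [h, hermiteProd_zero, polyEval]
  | succ n ih =>
    rw [sum_perm_succ fun i k => ⟪e' (j' k), e (j i)⟫_ℝ, occurrences_succ j,
      ← (isSmoothPair_poly W _).integral_inner_mul_hermiteProd hW he]
    have h : ∀ ω, ⟪polyGrad W (hermiteProd e' (occurrences j')) ω, e (j 0)⟫_ℝ =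
        ∑ i, ⟪e' (j' i), e (j 0)⟫_ℝ * polyEval W
          (hermiteProd e' (occurrences fun l : Fin n => j' (Equiv.swap 0 i l.succ))) ω := fun ω => by
      rw [polyGrad, inner_gradient, dirDeriv_hermiteProd_occurrences, map_sum]
      simp only [MvPolynomial.smul_eval]
      rfl
    simp_rw [h, Finset.sum_mul, mul_assoc]
    rw [integral_finsetSum _ fun i _ =>
      ((hW.allMoments_polyEval _).mul (hW.allMoments_polyEval _)).integrable.const_mul _]
    refine Finset.sum_congr rfl fun i _ => ?_
    rw [integral_const_mul, ih]

/-- The polynomial version of the basic pairs of tensors and multiple integrals. -/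
def polyMultipleIntegral (n : ℕ) : Set (TensorPower H n × MvPolynomial H ℝ) :=
  {p | ∃ (m : ℕ) (e : Fin m → H) (j : Fin n → Fin m), Orthonormal ℝ e ∧
    p.1 = symTensor (fun i => e (j i)) ∧ p.2 = hermiteProd e (occurrences j)}

theorem integral_mul_of_mem_span (hW : IsIsonormal W P) {n : ℕ}
    {p q : TensorPower H n × MvPolynomial H ℝ}
    (hp : p ∈ Submodule.span ℝ (polyMultipleIntegral (H := H) n))
    (hq : q ∈ Submodule.span ℝ (polyMultipleIntegral (H := H) n)) :
    ∫ ω, polyEval W p.2 ω * polyEval W q.2 ω ∂P = n.factorial * ⟪p.1, q.1⟫_ℝ := by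
  have hint : ∀ p q : MvPolynomial H ℝ, Integrable (fun ω => polyEval W p ω * polyEval W q ω) P :=
    fun p q => ((hW.allMoments_polyEval p).mul (hW.allMoments_polyEval q)).integrable
  have hadd : ∀ (p q : MvPolynomial H ℝ) ω, polyEval W (p + q) ω = polyEval W p ω + polyEval W q ω :=
    fun p q ω => by simp [polyEval]
  have hsmul : ∀ (c : ℝ) (q : MvPolynomial H ℝ) ω, polyEval W (c • q) ω = c * polyEval W q ω :=
    fun c q ω => by simp [polyEval]
  have hzero : ∀ ω, polyEval W (0 : MvPolynomial H ℝ) ω = 0 := fun ω => by simp [polyEval]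
  induction hp using Submodule.span_induction with
  | zero => simp [hzero]
  | add x y _ _ hx hy =>
    simp only [Prod.snd_add, Prod.fst_add, hadd, add_mul, inner_add_left]
    rw [integral_add (hint _ _) (hint _ _), hx, hy, mul_add]
  | smul c x _ hx =>
    simp only [Prod.smul_snd, Prod.smul_fst, hsmul, mul_assoc, inner_smul_left, conj_trivial]
    rw [integral_const_mul, hx]
    ring
  | mem x hx =>
    obtain ⟨m', e', j', -, hx1, hx2⟩ := hx
    induction hq using Submodule.span_induction with
    | zero => simp [hzero]
    | add y z _ _ hy hz =>
      simp only [Prod.snd_add, Prod.fst_add, hadd, mul_add, inner_add_right]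
      rw [integral_add (hint _ _) (hint _ _), hy, hz]
    | smul c y _ hy =>
      simp only [Prod.smul_snd, Prod.smul_fst, hsmul, mul_left_comm _ c, inner_smul_right]
      rw [integral_const_mul, hy]
    | mem y hy =>
      obtain ⟨m, e, j, he, hy1, hy2⟩ := hy
      rw [hx1, hx2, hy1, hy2, factorial_mul_inner_symTensor,
        integral_hermiteProd_mul_hermiteProd hW he]

theorem exists_polyMultipleIntegral_of_mem_span {Ω : Type*} {W : H → Ω → ℝ} {n : ℕ} {p : TensorPower H n × (Ω → ℝ)}
    (hp : p ∈ Submodule.span ℝ (multipleIntegralBasic W n)) :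
    ∃ q ∈ Submodule.span ℝ (polyMultipleIntegral (H := H) n), q.1 = p.1 ∧ polyEval W q.2 = p.2 := by
  induction hp using Submodule.span_induction with
  | zero => exact ⟨0, Submodule.zero_mem _, rfl, by ext ω; simp [polyEval]⟩
  | add x y _ _ hx hy =>
    obtain ⟨q, hq, h1, h2⟩ := hx
    obtain ⟨r, hr, h3, h4⟩ := hy
    refine ⟨q + r, Submodule.add_mem _ hq hr, by simp [h1, h3], ?_⟩
    ext ω
    simp [polyEval, ← h2, ← h4]
  | smul c x _ hx =>
    obtain ⟨q, hq, h1, h2⟩ := hx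
    refine ⟨c • q, Submodule.smul_mem _ _ hq, by simp [h1], ?_⟩
    ext ω
    simp [polyEval, ← h2]
  | mem x hx =>
    obtain ⟨m, e, j, he, h1, h2⟩ := hx
    refine ⟨(symTensor fun i => e (j i), hermiteProd e (occurrences j)), Submodule.subset_span
      ⟨m, e, j, he, rfl, rfl⟩, h1.symm, ?_⟩
    rw [h2]
    ext ω
    rw [polyEval, eval_hermiteProd]
    rfl

/-- Finitely many basic tensors involve finitely many vectors; the hypercontractive bound needs a
finite-dimensional `V` for its orthonormal basis. -/
theorem exists_mem_polyChaos_of_mem_span {n : ℕ} {p : TensorPower H n × MvPolynomial H ℝ}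
    (hp : p ∈ Submodule.span ℝ (polyMultipleIntegral (H := H) n)) :
    ∃ V : Submodule ℝ H, FiniteDimensional ℝ V ∧ p.2 ∈ polyChaos n V := by
  induction hp using Submodule.span_induction with
  | zero => exact ⟨⊥, inferInstance, Submodule.zero_mem _⟩
  | add x y _ _ hx hy =>
    obtain ⟨V, _, h1⟩ := hx
    obtain ⟨V', _, h2⟩ := hy
    exact ⟨V ⊔ V', inferInstance, Submodule.add_mem _ (polyChaos_mono le_sup_left h1)
      (polyChaos_mono le_sup_right h2)⟩
  | smul c x _ hx =>
    obtain ⟨V, hV, h1⟩ := hx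
    exact ⟨V, hV, Submodule.smul_mem _ _ h1⟩
  | mem x hx =>
    obtain ⟨m, e, j, he, -, h2⟩ := hx
    exact ⟨Submodule.span ℝ (Set.range e), FiniteDimensional.span_of_finite ℝ (Set.finite_range e),
      Submodule.subset_span ⟨m, e, _, he, fun a => Submodule.subset_span ⟨a, rfl⟩,
        sum_occurrences j, h2⟩⟩

end Isometry

/-! ### Closability of the derivative and the closed space of chaos triples. -/

section Closability

/-- A densely defined operator whose values lie in the domain of its adjoint is closable. -/
theorem eq_of_tendsto_of_exists_adjoint {E F : Type*} [NormedAddCommGroup E]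
    [InnerProductSpace ℝ E] [NormedAddCommGroup F] [InnerProductSpace ℝ F] {S : Set (E × F)}
    (hS : ∀ b ∈ S, ∃ m : E, ∀ a ∈ S, ⟪a.2, b.2⟫_ℝ = ⟪a.1, m⟫_ℝ) {a b : ℕ → E × F}
    (ha : ∀ k, a k ∈ S) (hb : ∀ k, b k ∈ S) {x : E} {y z : F}
    (ha1 : Tendsto (fun k => (a k).1) atTop (𝓝 x)) (ha2 : Tendsto (fun k => (a k).2) atTop (𝓝 y))
    (hb1 : Tendsto (fun k => (b k).1) atTop (𝓝 x)) (hb2 : Tendsto (fun k => (b k).2) atTop (𝓝 z)) :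
    y = z := by
  -- Both `y` and `z` pair with `c.2` as `x` does with the adjoint vector. Hence `y - z` is
  -- orthogonal to its own approximants, and so to itself.
  have key : ∀ c ∈ S, ⟪y - z, c.2⟫_ℝ = 0 := by
    intro c hc
    obtain ⟨m, hm⟩ := hS c hc
    have h1 : ⟪y, c.2⟫_ℝ = ⟪x, m⟫_ℝ := tendsto_nhds_unique (ha2.inner tendsto_const_nhds)
      ((ha1.inner tendsto_const_nhds).congr fun k => (hm _ (ha k)).symm)
    have h2 : ⟪z, c.2⟫_ℝ = ⟪x, m⟫_ℝ := tendsto_nhds_unique (hb2.inner tendsto_const_nhds)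
      ((hb1.inner tendsto_const_nhds).congr fun k => (hm _ (hb k)).symm)
    rw [inner_sub_left, h1, h2, sub_self]
  have h3 : Tendsto (fun k => ⟪y - z, (a k).2 - (b k).2⟫_ℝ) atTop (𝓝 ⟪y - z, y - z⟫_ℝ) :=
    tendsto_const_nhds.inner (ha2.sub hb2)
  have h4 : ∀ k, ⟪y - z, (a k).2 - (b k).2⟫_ℝ = 0 := fun k => by
    rw [inner_sub_right, key _ (ha k), key _ (hb k), sub_self]
  simp_rw [h4] at h3
  have h5 : ⟪y - z, y - z⟫_ℝ = 0 := tendsto_nhds_unique h3 tendsto_const_nhds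
  exact sub_eq_zero.1 (inner_self_eq_zero.1 h5)

variable {H : Type*} [NormedAddCommGroup H] [InnerProductSpace ℝ H]
  {Ω : Type*} [MeasurableSpace Ω] {P : Measure Ω} [IsProbabilityMeasure P] {W : H → Ω → ℝ}

/-- The classes of smooth functionals and their gradients. -/
def smoothPairClasses (W : H → Ω → ℝ) (P : Measure Ω) : Set (Lp ℝ 2 P × Lp H 2 P) :=
  {y | ∃ F DF, IsSmoothPair W F DF ∧ y.1 =ᵐ[P] F ∧ y.2 =ᵐ[P] DF}

theorem IsIsonormal.exists_adjoint (hW : IsIsonormal W P) :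
    ∀ b ∈ smoothPairClasses W P, ∃ m : Lp ℝ 2 P, ∀ a ∈ smoothPairClasses W P,
      ⟪a.2, b.2⟫_ℝ = ⟪a.1, m⟫_ℝ := by
  rintro b ⟨G, DG, hG, hb1, hb2⟩
  obtain ⟨M, hM, h⟩ := hG.exists_divergence hW
  refine ⟨hM.memLp_two.toLp M, ?_⟩
  rintro a ⟨F, DF, hF, ha1, ha2⟩
  rw [L2.inner_def, L2.inner_def]
  have e1 : ∫ ω, ⟪a.2 ω, b.2 ω⟫_ℝ ∂P = ∫ ω, ⟪DF ω, DG ω⟫_ℝ ∂P := by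
    refine integral_congr_ae ?_
    filter_upwards [ha2, hb2] with ω h1 h2
    rw [h1, h2]
  have e2 : ∫ ω, ⟪a.1 ω, hM.memLp_two.toLp M ω⟫_ℝ ∂P = ∫ ω, F ω * M ω ∂P := by
    refine integral_congr_ae ?_
    filter_upwards [ha1, hM.memLp_two.coeFn_toLp] with ω h1 h2
    rw [h1, h2]
    simp [mul_comm]
  rw [e1, e2, h F DF hF]

/-- The triples `(f, I_n(f), D I_n(f))` where `f` is a finite combination of basic tensors. -/
def chaosTriples (W : H → Ω → ℝ) (P : Measure Ω) (n : ℕ) :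
    Submodule ℝ (TensorPower H n × Lp ℝ 2 P × Lp H 2 P) where
  carrier := {z | ∃ q ∈ Submodule.span ℝ (polyMultipleIntegral (H := H) n),
    q.1 = z.1 ∧ z.2.1 =ᵐ[P] polyEval W q.2 ∧ z.2.2 =ᵐ[P] polyGrad W q.2}
  zero_mem' := by
    refine ⟨0, Submodule.zero_mem _, rfl, ?_, ?_⟩
    · filter_upwards [Lp.coeFn_zero ℝ 2 P] with ω h
      simpa [polyEval] using h
    · filter_upwards [Lp.coeFn_zero H 2 P] with ω h
      simpa [polyGrad] using h
  add_mem' := by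
    rintro y z ⟨q, hq, h1, h2, h3⟩ ⟨r, hr, h4, h5, h6⟩
    refine ⟨q + r, Submodule.add_mem _ hq hr, by simp [h1, h4], ?_, ?_⟩
    · filter_upwards [Lp.coeFn_add y.2.1 z.2.1, h2, h5] with ω a b c
      refine a.trans ?_
      rw [Pi.add_apply, b, c]
      simp [polyEval]
    · filter_upwards [Lp.coeFn_add y.2.2 z.2.2, h3, h6] with ω a b c
      refine a.trans ?_
      rw [Pi.add_apply, b, c]
      simp [polyGrad]
  smul_mem' := by
    rintro c z ⟨q, hq, h1, h2, h3⟩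
    refine ⟨c • q, Submodule.smul_mem _ _ hq, by simp [h1], ?_, ?_⟩
    · filter_upwards [Lp.coeFn_smul c z.2.1, h2] with ω a b
      refine a.trans ?_
      rw [Pi.smul_apply, b]
      simp [polyEval]
    · filter_upwards [Lp.coeFn_smul c z.2.2, h3] with ω a b
      refine a.trans ?_
      rw [Pi.smul_apply, b]
      simp [polyGrad]

/-- The first identity is the isometry; the second adds the eigenvalue `n` of the number operator.
-/
theorem norm_sq_of_mem_chaosTriples (hW : IsIsonormal W P) {n : ℕ}
    {z : TensorPower H n × Lp ℝ 2 P × Lp H 2 P} (hz : z ∈ chaosTriples W P n) :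
    ‖z.2.1‖ ^ 2 = n.factorial * ‖z.1‖ ^ 2 ∧ ‖z.2.2‖ ^ 2 = n * (n.factorial * ‖z.1‖ ^ 2) := by
  obtain ⟨q, hq, h1, h2, h3⟩ := hz
  have e := integral_mul_of_mem_span hW hq hq
  rw [real_inner_self_eq_norm_sq, h1] at e
  constructor
  · rw [← e, ← real_inner_self_eq_norm_sq, L2.inner_def]
    refine integral_congr_ae ?_
    filter_upwards [h2] with ω h
    rw [h]
    simp [pow_two]
  · obtain ⟨V, _, hV⟩ := exists_mem_polyChaos_of_mem_span hq
    rw [← e, ← (isSmoothPair_poly W q.2).integral_inner_polyGrad hW hV,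
      ← real_inner_self_eq_norm_sq, L2.inner_def]
    refine integral_congr_ae ?_
    filter_upwards [h3] with ω h
    rw [h]

theorem norm_sq_of_mem_closure_chaosTriples (hW : IsIsonormal W P) {n : ℕ}
    {z : TensorPower H n × Lp ℝ 2 P × Lp H 2 P} (hz : z ∈ (chaosTriples W P n).topologicalClosure) :
    ‖z.2.1‖ ^ 2 = n.factorial * ‖z.1‖ ^ 2 ∧ ‖z.2.2‖ ^ 2 = n * (n.factorial * ‖z.1‖ ^ 2) := by
  have hc : IsClosed {z : TensorPower H n × Lp ℝ 2 P × Lp H 2 P |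
      ‖z.2.1‖ ^ 2 = n.factorial * ‖z.1‖ ^ 2 ∧ ‖z.2.2‖ ^ 2 = n * (n.factorial * ‖z.1‖ ^ 2)} :=
    (isClosed_eq (by fun_prop) (by fun_prop)).inter (isClosed_eq (by fun_prop) (by fun_prop))
  exact closure_minimal (fun z hz => norm_sq_of_mem_chaosTriples hW hz) hc hz

/-- A multiple integral in the domain of the Malliavin derivative is, with its derivative, a limit
of Hermite polynomials and their gradients. -/
theorem mem_closure_chaosTriples [CompleteSpace H] (hW : IsIsonormal W P) {n : ℕ}
    {f : TensorPower H n} {X : Ω → ℝ} {DX : Ω → H} (hX : IsMultipleIntegral W P n f X)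
    (hDX : IsMalliavinDerivative W P X DX) :
    (f, hX.1.toLp X, hDX.2.1.toLp DX) ∈ (chaosTriples W P n).topologicalClosure := by
  obtain ⟨mX, p, hp, hp1, hp2⟩ := hX
  obtain ⟨-, mDX, r, hr, hr1, hr2⟩ := hDX
  choose q hq hq1 hq2 using fun k => exists_polyMultipleIntegral_of_mem_span (hp k)
  set z : ℕ → TensorPower H n × Lp ℝ 2 P × Lp H 2 P := fun k =>
    ((q k).1, (hW.allMoments_polyEval (q k).2).memLp_two.toLp _,
      (hW.allMoments_polyGrad (q k).2).memLp_two.toLp _) with hz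
  have hzmem : ∀ k, z k ∈ chaosTriples W P n := fun k =>
    ⟨q k, hq k, rfl, MemLp.coeFn_toLp (hW.allMoments_polyEval (q k).2).memLp_two,
      MemLp.coeFn_toLp (hW.allMoments_polyGrad (q k).2).memLp_two⟩
  have hz1 : Tendsto (fun k => (z k).1) atTop (𝓝 f) := by
    simpa only [hz, hq1] using hp1
  have hz2 : Tendsto (fun k => (z k).2.1) atTop (𝓝 (mX.toLp X)) := by
    refine (Lp.tendsto_Lp_iff_tendsto_eLpNorm'' _ (fun k =>
      (hW.allMoments_polyEval (q k).2).memLp_two) X mX).2 ?_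
    simp only [hq2]
    exact hp2
  -- The gradients are Cauchy because their squared distances are `n * n!` times those of the
  -- kernels. The `+ 1` in `c` keeps it positive when `n = 0`.
  obtain ⟨y, hy⟩ : ∃ y, Tendsto (fun k => (z k).2.2) atTop (𝓝 y) := by
    refine cauchySeq_tendsto_of_complete (Metric.cauchySeq_iff.2 fun ε hε => ?_)
    have hc := hz1.cauchySeq
    rw [Metric.cauchySeq_iff] at hc
    set c : ℝ := n * n.factorial + 1 with hcdef
    have hc0 : 0 < c := by positivity
    obtain ⟨N, hN⟩ := hc (ε / √c) (by positivity)
    refine ⟨N, fun k hk l hl => ?_⟩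
    have h1 := hN k hk l hl
    have h2 := (norm_sq_of_mem_chaosTriples hW (Submodule.sub_mem _ (hzmem k) (hzmem l))).2
    rw [dist_eq_norm, lt_div_iff₀ (by positivity)] at h1
    rw [dist_eq_norm]
    have h3 : ‖(z k).2.2 - (z l).2.2‖ ^ 2 < ε ^ 2 := by
      calc ‖(z k).2.2 - (z l).2.2‖ ^ 2 = n * n.factorial * ‖(z k).1 - (z l).1‖ ^ 2 := by
            rw [← mul_assoc] at h2; exact h2
        _ ≤ c * ‖(z k).1 - (z l).1‖ ^ 2 := by gcongr; linarith
        _ = (‖(z k).1 - (z l).1‖ * √c) ^ 2 := by rw [mul_pow, Real.sq_sqrt hc0.le]; ring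
        _ < ε ^ 2 := by gcongr
    exact lt_of_pow_lt_pow_left₀ 2 hε.le h3
  have hrs := fun k => IsSmoothPair.of_cylindrical (hr k)
  have hr1' : Tendsto (fun k => ((hrs k).allMoments hW).1.memLp_two.toLp (r k).1) atTop
      (𝓝 (mX.toLp X)) :=
    (Lp.tendsto_Lp_iff_tendsto_eLpNorm'' _ (fun k => ((hrs k).allMoments hW).1.memLp_two) X mX).2 hr1
  have hr2' : Tendsto (fun k => ((hrs k).allMoments hW).2.memLp_two.toLp (r k).2) atTop
      (𝓝 (mDX.toLp DX)) :=
    (Lp.tendsto_Lp_iff_tendsto_eLpNorm'' _ (fun k => ((hrs k).allMoments hW).2.memLp_two) DX mDX).2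
      hr2
  -- The Hermite and the cylindrical approximations of `X` have the same limit, so closability
  -- forces their gradients to have the same limit.
  have hyD : y = mDX.toLp DX :=
    eq_of_tendsto_of_exists_adjoint (hW.exists_adjoint) (a := fun k => (z k).2)
      (b := fun k => (((hrs k).allMoments hW).1.memLp_two.toLp (r k).1,
        ((hrs k).allMoments hW).2.memLp_two.toLp (r k).2))
      (fun k => ⟨_, _, isSmoothPair_poly W (q k).2,
        MemLp.coeFn_toLp (hW.allMoments_polyEval (q k).2).memLp_two,
        MemLp.coeFn_toLp (hW.allMoments_polyGrad (q k).2).memLp_two⟩)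
      (fun k => ⟨_, _, hrs k, MemLp.coeFn_toLp ((hrs k).allMoments hW).1.memLp_two,
        MemLp.coeFn_toLp ((hrs k).allMoments hW).2.memLp_two⟩) hz2 hy hr1' hr2'
  rw [hyD] at hy
  exact mem_closure_of_tendsto (hz1.prodMk_nhds (hz2.prodMk_nhds hy))
    (Eventually.of_forall hzmem)

/-- Hypercontractivity gives the bound on finite combinations. It extends to the closure by Fatou
along an almost everywhere convergent subsequence, the right side being continuous in the kernel. -/
theorem exists_lintegral_norm_pow_le (n : ℕ) (hn : 1 ≤ n) (q : ℕ) (hW : IsIsonormal W P) :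
    ∃ K : ℝ, 0 ≤ K ∧ ∀ z ∈ (chaosTriples W P n).topologicalClosure,
      ∫⁻ ω, ‖z.2.2 ω‖ₑ ^ (2 * (q + 1)) ∂P ≤ ENNReal.ofReal (K * (‖z.1‖ ^ 2) ^ (q + 1)) := by
  obtain ⟨K, hK, hmom⟩ := exists_gradient_moment_const q n hn
  refine ⟨K * (n.factorial : ℝ) ^ (q + 1), by positivity, fun z hz => ?_⟩
  have h0 : ∀ z ∈ chaosTriples W P n, ∫⁻ ω, ‖z.2.2 ω‖ₑ ^ (2 * (q + 1)) ∂P ≤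
      ENNReal.ofReal (K * (n.factorial : ℝ) ^ (q + 1) * (‖z.1‖ ^ 2) ^ (q + 1)) := by
    rintro z ⟨r, hr, h1, h2, h3⟩
    obtain ⟨V, _, hV⟩ := exists_mem_polyChaos_of_mem_span hr
    have h4 := hmom hW V r.2 hV
    have h5 := integral_mul_of_mem_span hW hr hr
    simp_rw [← pow_two] at h5
    rw [h5, real_inner_self_eq_norm_sq, h1, mul_pow, ← mul_assoc] at h4
    refine le_trans (le_of_eq ?_) (ENNReal.ofReal_le_ofReal h4)
    rw [ofReal_integral_eq_lintegral_ofReal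
      (((hW.allMoments_polyGrad r.2).norm.pow 2).pow (q + 1)).integrable
      (ae_of_all _ fun ω => by positivity)]
    refine lintegral_congr_ae ?_
    filter_upwards [h3] with ω h
    rw [h, ← pow_mul, ENNReal.ofReal_pow (norm_nonneg _), ofReal_norm]
  obtain ⟨y, hy, hyz⟩ := mem_closure_iff_seq_limit.1 hz
  have hy1 : Tendsto (fun k => (y k).1) atTop (𝓝 z.1) :=
    (continuous_fst.tendsto _).comp hyz
  have hy2 : Tendsto (fun k => (y k).2.2) atTop (𝓝 z.2.2) :=
    ((continuous_snd.comp continuous_snd).tendsto _).comp hyz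
  obtain ⟨ns, hns, hae⟩ := (tendstoInMeasure_of_tendsto_Lp hy2).exists_seq_tendsto_ae
  have hlim : ∀ᵐ ω ∂P, ‖z.2.2 ω‖ₑ ^ (2 * (q + 1)) ≤
      liminf (fun k => ‖(y (ns k)).2.2 ω‖ₑ ^ (2 * (q + 1))) atTop := by
    filter_upwards [hae] with ω hω
    exact (ENNReal.Tendsto.pow hω.enorm).liminf_eq.ge
  calc ∫⁻ ω, ‖z.2.2 ω‖ₑ ^ (2 * (q + 1)) ∂P
      ≤ ∫⁻ ω, liminf (fun k => ‖(y (ns k)).2.2 ω‖ₑ ^ (2 * (q + 1))) atTop ∂P :=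
        lintegral_mono_ae hlim
    _ ≤ liminf (fun k => ∫⁻ ω, ‖(y (ns k)).2.2 ω‖ₑ ^ (2 * (q + 1)) ∂P) atTop :=
        lintegral_liminf_le' fun k => ((Lp.aestronglyMeasurable _).enorm.pow_const _)
    _ ≤ liminf (fun k => ENNReal.ofReal
          (K * (n.factorial : ℝ) ^ (q + 1) * (‖(y (ns k)).1‖ ^ 2) ^ (q + 1))) atTop :=
        liminf_le_liminf (Eventually.of_forall fun k => h0 _ (hy _))
    _ = _ := by
        refine Tendsto.liminf_eq (ENNReal.tendsto_ofReal ?_)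
        exact (((hy1.comp hns.tendsto_atTop).norm.pow 2).pow (q + 1)).const_mul _

end Closability

/-! ### Young integrals under linear maps, and `L²` against pathwise integrals. -/

section YoungTransfer

variable {E F : Type*} [NormedAddCommGroup E] [NormedSpace ℝ E] [NormedAddCommGroup F]
  [NormedSpace ℝ F]

theorem HasYoungIntegral.congr {g : ℝ → ℝ} {x y : ℝ → E} {a b : ℝ} {I : E}
    (h : HasYoungIntegral g x a b I) (hxy : ∀ t ∈ Set.Icc a b, x t = y t) :
    HasYoungIntegral g y a b I := by
  intro ε hε
  obtain ⟨δ, hδ, H⟩ := h ε hε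
  refine ⟨δ, hδ, fun N t ξ h1 h2 h3 h4 h5 => ?_⟩
  have ht : ∀ i, x (t i) = y (t i) := fun i =>
    hxy _ ⟨h2 ▸ h1 (Fin.zero_le i), h3 ▸ h1 (Fin.le_last i)⟩
  simpa only [ht] using H N t ξ h1 h2 h3 h4 h5

theorem HasYoungIntegral.map {g : ℝ → ℝ} {x : ℝ → E} {a b : ℝ} {I : E}
    (h : HasYoungIntegral g x a b I) (L : E →L[ℝ] F) :
    HasYoungIntegral g (fun t => L (x t)) a b (L I) := by
  intro ε hε
  have hc : 0 < ‖L‖ + 1 := by positivity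
  obtain ⟨δ, hδ, H⟩ := h (ε / (‖L‖ + 1)) (by positivity)
  refine ⟨δ, hδ, fun N t ξ h1 h2 h3 h4 h5 => ?_⟩
  have h6 := H N t ξ h1 h2 h3 h4 h5
  rw [lt_div_iff₀ hc] at h6
  simp only [← map_sub, ← map_smul, ← map_sum]
  refine (L.le_opNorm _).trans_lt (lt_of_le_of_lt ?_ h6)
  rw [mul_comm]
  gcongr
  linarith

theorem HasYoungIntegral.youngIntegral_spec {g : ℝ → ℝ} {x : ℝ → E} {a b : ℝ}
    (h : ∃ I, HasYoungIntegral g x a b I) :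
    HasYoungIntegral g x a b (youngIntegral g x a b) := by
  rw [youngIntegral, dif_pos h]
  exact h.choose_spec

/-- The left-point Riemann sum of `∫_0^1 g dx` over the partition into `k + 1` equal intervals. -/
def uniformRiemannSum (g : ℝ → ℝ) (x : ℝ → E) (k : ℕ) : E :=
  ∑ i : Fin (k + 1), g ((i : ℕ) / ((k : ℝ) + 1)) •
    (x (((i : ℕ) + 1) / ((k : ℝ) + 1)) - x ((i : ℕ) / ((k : ℝ) + 1)))

theorem HasYoungIntegral.tendsto_uniformRiemannSum {g : ℝ → ℝ} {x : ℝ → E} {I : E}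
    (h : HasYoungIntegral g x 0 1 I) : Tendsto (uniformRiemannSum g x) atTop (𝓝 I) := by
  rw [Metric.tendsto_atTop]
  intro ε hε
  obtain ⟨δ, hδ, H⟩ := h ε hε
  obtain ⟨K, hK⟩ := exists_nat_one_div_lt hδ
  refine ⟨K, fun k hk => ?_⟩
  have hk0 : (0 : ℝ) < (k : ℝ) + 1 := by positivity
  have hkK : (1 : ℝ) / ((k : ℝ) + 1) < δ := (Nat.one_div_le_one_div hk).trans_lt hK
  have := H (k + 1) (fun i => (i : ℕ) / ((k : ℝ) + 1)) (fun i => (i : ℕ) / ((k : ℝ) + 1))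
    (fun i j hij => by
      have : ((i : ℕ) : ℝ) ≤ (j : ℕ) := by exact_mod_cast hij
      simp only
      gcongr) (by simp) (by simp [hk0.ne'])
    (fun i => ⟨by simp, by simp; gcongr; linarith⟩)
    (fun i => by
      simp only [Fin.val_succ, Fin.val_castSucc, Nat.cast_add, Nat.cast_one]
      rw [← sub_div]
      simpa using hkK)
  rw [dist_eq_norm]
  simpa only [uniformRiemannSum, Fin.val_succ, Fin.val_castSucc, Nat.cast_add, Nat.cast_one] using
    this

/-- A Young integral in `L²` is almost surely the pathwise Young integral. -/
theorem HasYoungIntegral.youngIntegral_ae_eq {Ω : Type*} [MeasurableSpace Ω] {P : Measure Ω}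
    {g : ℝ → ℝ} {Y : ℝ → Ω → E} {y : ℝ → Lp E 2 P} {I : Lp E 2 P}
    (hI : HasYoungIntegral g y 0 1 I) (hy : ∀ t ∈ Set.Icc (0 : ℝ) 1, y t =ᵐ[P] Y t)
    (hY : ∀ᵐ ω ∂P, ∃ J, HasYoungIntegral g (fun t => Y t ω) 0 1 J) :
    (fun ω => youngIntegral g (fun t => Y t ω) 0 1) =ᵐ[P] I := by
  obtain ⟨ns, hns, hae⟩ :=
    (tendstoInMeasure_of_tendsto_Lp hI.tendsto_uniformRiemannSum).exists_seq_tendsto_ae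
  have hsum : ∀ k, (⇑(uniformRiemannSum g y k : Lp E 2 P) : Ω → E) =ᵐ[P]
      fun ω => uniformRiemannSum g (fun t => Y t ω) k := by
    intro k
    have hk0 : (0 : ℝ) < (k : ℝ) + 1 := by positivity
    have hterm : ∀ i : Fin (k + 1), (g ((i : ℕ) / ((k : ℝ) + 1)) •
        (y (((i : ℕ) + 1) / ((k : ℝ) + 1)) - y ((i : ℕ) / ((k : ℝ) + 1))) : Lp E 2 P) =ᵐ[P]
        fun ω => g ((i : ℕ) / ((k : ℝ) + 1)) •
          (Y (((i : ℕ) + 1) / ((k : ℝ) + 1)) ω - Y ((i : ℕ) / ((k : ℝ) + 1)) ω) := by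
      intro i
      have hi : ((i : ℕ) : ℝ) + 1 ≤ k + 1 := by exact_mod_cast i.2
      have h1 := hy (((i : ℕ) + 1) / ((k : ℝ) + 1)) ⟨by positivity, (div_le_one hk0).2 hi⟩
      have h2 := hy ((i : ℕ) / ((k : ℝ) + 1))
        ⟨by positivity, (div_le_one hk0).2 (by linarith)⟩
      filter_upwards [Lp.coeFn_smul (g ((i : ℕ) / ((k : ℝ) + 1)))
        (y (((i : ℕ) + 1) / ((k : ℝ) + 1)) - y ((i : ℕ) / ((k : ℝ) + 1))),
        Lp.coeFn_sub (y (((i : ℕ) + 1) / ((k : ℝ) + 1))) (y ((i : ℕ) / ((k : ℝ) + 1))), h1, h2]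
        with ω a b c d
      rw [a, Pi.smul_apply, b, Pi.sub_apply, c, d]
    have hfs : ⇑(uniformRiemannSum g y k : Lp E 2 P) =ᵐ[P] ∑ i : Fin (k + 1),
        ((g ((i : ℕ) / ((k : ℝ) + 1)) •
          (y (((i : ℕ) + 1) / ((k : ℝ) + 1)) - y ((i : ℕ) / ((k : ℝ) + 1))) : Lp E 2 P) : Ω → E) :=
      Lp.coeFn_finsetSum _ _
    filter_upwards [hfs, ae_all_iff.2 hterm] with ω a b
    rw [a, Finset.sum_apply, uniformRiemannSum]
    exact Finset.sum_congr rfl fun i _ => b i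
  -- At almost every point the same uniform Riemann sums tend to the `L²` limit along `ns` and to
  -- the pathwise integral.
  filter_upwards [hae, ae_all_iff.2 hsum, hY] with ω h1 h2 h3
  have h4 := (HasYoungIntegral.youngIntegral_spec h3).tendsto_uniformRiemannSum
  refine tendsto_nhds_unique (h4.comp hns.tendsto_atTop) (h1.congr fun k => ?_)
  rw [h2]
  rfl

end YoungTransfer

/-! ### Kolmogorov's continuity criterion. -/

section Kolmogorov

variable {E : Type*} [NormedAddCommGroup E] {Ω : Type*} [MeasurableSpace Ω] {P : Measure Ω}

/-- Kolmogorov's criterion for a process that is known to be continuous. -/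
theorem ae_exists_holderUnit {Y : ℝ → Ω → E} {p : ℕ} (hp : p ≠ 0) {K α ρ : ℝ} (hK : 0 ≤ K)
    (hρ : 0 < ρ) (hα : 1 + p * ρ < α)
    (hmeas : ∀ t ∈ Set.Icc (0 : ℝ) 1, AEStronglyMeasurable (Y t) P)
    (hmom : ∀ s t, 0 ≤ s → s < t → t ≤ 1 →
      ∫⁻ ω, ‖Y t ω - Y s ω‖ₑ ^ p ∂P ≤ ENNReal.ofReal (K * (t - s) ^ α))
    (hcont : ∀ᵐ ω ∂P, ContinuousOn (fun t => Y t ω) (Set.Icc 0 1)) :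
    ∀ᵐ ω ∂P, ∃ B : ℝ, 0 ≤ B ∧ HolderUnit (fun t => Y t ω) B ρ := by
  set c : ℕ → ℝ := fun m => (2 ^ ρ) ^ m with hc
  have hc0 : ∀ m, 0 < c m := fun m => by positivity
  set D : ℕ → ℕ → Ω → E := fun m k ω =>
    Y (((k + 1 : ℕ) : ℝ) / 2 ^ m) ω - Y ((k : ℝ) / 2 ^ m) ω with hD
  have hmem : ∀ m k : ℕ, k < 2 ^ m → ((k + 1 : ℕ) : ℝ) / 2 ^ m ≤ 1 := fun m k hk => by
    rw [div_le_one (by positivity)]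
    exact_mod_cast hk
  have hlt : ∀ m k : ℕ, (k : ℝ) / 2 ^ m < ((k + 1 : ℕ) : ℝ) / 2 ^ m := fun m k => by
    gcongr
    exact_mod_cast k.lt_succ_self
  have hDm : ∀ m k, k < 2 ^ m → AEStronglyMeasurable (D m k) P := fun m k hk =>
    (hmeas _ ⟨by positivity, hmem m k hk⟩).sub
      (hmeas _ ⟨by positivity, (hlt m k).le.trans (hmem m k hk)⟩)
  -- The weight `c m = 2 ^ (m ρ)` makes the level-`m` mean at most `K * q ^ m` with `q < 1`. The
  -- total is then almost surely finite and bounds every dyadic increment at once.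
  set S : ℕ → Ω → ℝ≥0∞ := fun m ω =>
    ∑ k ∈ Finset.range (2 ^ m), (ENNReal.ofReal (c m) * ‖D m k ω‖ₑ) ^ p with hS
  have hSm : ∀ m, AEMeasurable (S m) P := fun m =>
    Finset.aemeasurable_fun_sum _ fun k hk =>
      (((hDm m k (Finset.mem_range.1 hk)).enorm).const_mul _).pow_const _
  set q : ℝ := 2 ^ (1 + p * ρ - α) with hq
  have hq1 : q < 1 := Real.rpow_lt_one_of_one_lt_of_neg (by norm_num) (by linarith)
  have hq0 : 0 < q := by positivity
  have hbound : ∀ m, ∫⁻ ω, S m ω ∂P ≤ ENNReal.ofReal (K * q ^ m) := by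
    intro m
    rw [lintegral_finsetSum' _ fun k hk =>
      (((hDm m k (Finset.mem_range.1 hk)).enorm).const_mul _).pow_const _]
    have hterm : ∀ k ∈ Finset.range (2 ^ m),
        ∫⁻ ω, (ENNReal.ofReal (c m) * ‖D m k ω‖ₑ) ^ p ∂P ≤
          ENNReal.ofReal (c m ^ p * (K * (1 / 2 ^ m) ^ α)) := by
      intro k hk
      have h1 := hmom _ _ (by positivity) (hlt m k) (hmem m k (Finset.mem_range.1 hk))
      have e : ((k + 1 : ℕ) : ℝ) / 2 ^ m - (k : ℝ) / 2 ^ m = 1 / 2 ^ m := by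
        rw [← sub_div]; simp
      rw [e] at h1
      simp_rw [mul_pow]
      rw [lintegral_const_mul' _ _ (by simp), ENNReal.ofReal_mul (by positivity),
        ENNReal.ofReal_pow (hc0 m).le]
      gcongr
    refine (Finset.sum_le_sum hterm).trans (le_of_eq ?_)
    rw [Finset.sum_const, Finset.card_range, nsmul_eq_mul, ← ENNReal.ofReal_natCast,
      ← ENNReal.ofReal_mul (by positivity)]
    congr 1
    have e1 : q ^ m = 2 ^ m * (c m ^ p * (1 / 2 ^ m) ^ α) := by
      have h2 : (0 : ℝ) < 2 := by norm_num
      rw [hq, hc, one_div, Real.inv_rpow (by positivity), ← Real.rpow_neg (by positivity)]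
      simp only [← Real.rpow_natCast]
      simp only [← Real.rpow_mul h2.le]
      rw [← Real.rpow_add h2, ← Real.rpow_add h2]
      congr 1
      ring
    rw [e1]
    push_cast
    ring
  have htot : ∫⁻ ω, ∑' m, S m ω ∂P ≠ ∞ := by
    rw [lintegral_tsum hSm]
    refine ne_top_of_le_ne_top ?_ (ENNReal.tsum_le_tsum hbound)
    have hsum : Summable fun m : ℕ => K * q ^ m := (summable_geometric_of_lt_one hq0.le hq1).mul_left _
    rw [← ENNReal.ofReal_tsum_of_nonneg (fun m => by positivity) hsum]
    exact ENNReal.ofReal_ne_top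
  filter_upwards [ae_lt_top' (AEMeasurable.tsum hSm) htot, hcont] with ω hω hcω
  set T := ∑' m, S m ω with hT
  -- The constant `1 + T` suffices because `u ≤ 1 + u ^ p` for `u ≥ 0`.
  refine holderUnit_of_dyadic (M := 1 + T.toReal) (by positivity) hρ hcω fun m k hk => ?_
  have h1 : (ENNReal.ofReal (c m) * ‖D m k ω‖ₑ) ^ p ≤ T :=
    (Finset.single_le_sum (f := fun k => (ENNReal.ofReal (c m) * ‖D m k ω‖ₑ) ^ p)
      (fun _ _ => zero_le) (Finset.mem_range.2 hk)).trans (ENNReal.le_tsum m)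
  have h2 : (c m * ‖D m k ω‖) ^ p ≤ T.toReal := by
    have := ENNReal.toReal_mono hω.ne h1
    rwa [ENNReal.toReal_pow, ENNReal.toReal_mul, ENNReal.toReal_ofReal (hc0 m).le,
      toReal_enorm] at this
  have h3 : c m * ‖D m k ω‖ ≤ 1 + T.toReal := by
    have hT0 : 0 ≤ T.toReal := ENNReal.toReal_nonneg
    rcases le_total (c m * ‖D m k ω‖) 1 with h | h
    · linarith
    · linarith [le_self_pow₀ h hp]
  have h4 : ((2 : ℝ) ^ (-ρ)) ^ m = (c m)⁻¹ := by
    rw [Real.rpow_neg (by norm_num), inv_pow]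
  rw [h4, ← div_eq_mul_inv, le_div_iff₀ (hc0 m), mul_comm]
  exact h3

end Kolmogorov

/-! ### The path of triples and the regularity of the derivatives. -/

section ChaosPath

/-- If `θ > 2`, telescoping over `k + 1` equal steps bounds `‖f 1 - f 0‖` by a negative power of `k
+ 1`, contradicting its positivity. In the main theorem this yields `τ > 0`. -/
theorem KernelRegularity.le_two {K : Type*} [NormedAddCommGroup K] [InnerProductSpace ℝ K]
    {f : ℝ → K} {θ : ℝ} (h : KernelRegularity f θ) : θ ≤ 2 := by
  obtain ⟨-, -, C, hC, h⟩ := h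
  by_contra! hθ
  have hpos := (h 0 1 le_rfl one_pos le_rfl).1
  have hbound : ∀ k : ℕ, ‖f 1 - f 0‖ ≤ C * ((k : ℝ) + 1) ^ (-(θ / 2 - 1)) := by
    intro k
    have hk : (0 : ℝ) < (k : ℝ) + 1 := by positivity
    have htel := Finset.sum_range_sub (fun i : ℕ => f ((i : ℝ) / ((k : ℝ) + 1))) (k + 1)
    have e1 : ((k + 1 : ℕ) : ℝ) / ((k : ℝ) + 1) = 1 := by
      rw [div_eq_one_iff_eq hk.ne']; simp
    simp only [e1, Nat.cast_zero, zero_div] at htel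
    rw [← htel]
    refine (norm_sum_le_of_le (n := fun _ => C * (1 / ((k : ℝ) + 1)) ^ (θ / 2)) _
      fun i hi => ?_).trans (le_of_eq ?_)
    · have hi' : ((i + 1 : ℕ) : ℝ) ≤ k + 1 := by exact_mod_cast Finset.mem_range.1 hi
      have := (h ((i : ℝ) / ((k : ℝ) + 1)) (((i + 1 : ℕ) : ℝ) / ((k : ℝ) + 1)) (by positivity)
        (by gcongr; simp) ((div_le_one hk).2 hi')).2
      rwa [← sub_div, Nat.cast_succ, add_sub_cancel_left, abs_of_pos (by positivity),
        ← Nat.cast_succ] at this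
    · rw [Finset.sum_const, Finset.card_range, nsmul_eq_mul, Nat.cast_succ, one_div,
        Real.inv_rpow hk.le, ← Real.rpow_neg hk.le,
        show -(θ / 2 - 1) = -(θ / 2) + 1 by ring, Real.rpow_add_one hk.ne']
      ring
  have hlim : Tendsto (fun k : ℕ => C * ((k : ℝ) + 1) ^ (-(θ / 2 - 1))) atTop (𝓝 (C * 0)) :=
    ((tendsto_rpow_neg_atTop (by linarith)).comp
      (tendsto_atTop_add_const_right _ 1 tendsto_natCast_atTop_atTop)).const_mul C
  have := ge_of_tendsto' hlim hbound
  linarith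

theorem KernelRegularity.exists_holderUnit {K : Type*} [NormedAddCommGroup K]
    [InnerProductSpace ℝ K] {f : ℝ → K} {θ : ℝ} (h : KernelRegularity f θ) :
    ∃ C, 0 < C ∧ HolderUnit f C (θ / 2) := by
  obtain ⟨-, hθ, C, hC, h⟩ := h
  refine ⟨C, hC, fun s t h0 hst h1 => ?_⟩
  rcases hst.eq_or_lt with rfl | hlt
  · simp [Real.zero_rpow (by linarith : θ / 2 ≠ 0)]
  · have := (h s t h0 hlt h1).2
    rwa [abs_of_pos (sub_pos.2 hlt)] at this

theorem integral_norm_sq_eq_norm_sq {E : Type*} [NormedAddCommGroup E] [InnerProductSpace ℝ E]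
    {Ω : Type*} [MeasurableSpace Ω] {P : Measure Ω}
    (y : Lp E 2 P) {Y : Ω → E} (h : y =ᵐ[P] Y) : ∫ ω, ‖Y ω‖ ^ 2 ∂P = ‖y‖ ^ 2 := by
  rw [← real_inner_self_eq_norm_sq, L2.inner_def]
  refine integral_congr_ae ?_
  filter_upwards [h] with ω hω
  rw [hω, real_inner_self_eq_norm_sq]

variable {H : Type*} [NormedAddCommGroup H] [InnerProductSpace ℝ H]
  {Ω : Type*} [MeasurableSpace Ω] {P : Measure Ω} [IsProbabilityMeasure P] {W : H → Ω → ℝ}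

/-- The product carries the maximum norm. The constant dominates `n!` and `n * n!` and is at least
`1`, so it also dominates their square roots. Thus the path of triples is as regular as the kernels.
-/
theorem norm_le_of_mem_closure_chaosTriples (hW : IsIsonormal W P) {n : ℕ}
    {z : TensorPower H n × Lp ℝ 2 P × Lp H 2 P} (hz : z ∈ (chaosTriples W P n).topologicalClosure) :
    ‖z‖ ≤ (n.factorial + n * n.factorial + 1) * ‖z.1‖ := by
  obtain ⟨h1, h2⟩ := norm_sq_of_mem_closure_chaosTriples hW hz
  set c : ℝ := n.factorial + n * n.factorial + 1 with hc
  have hf : (0 : ℝ) ≤ n.factorial := by positivity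
  have hnf : (0 : ℝ) ≤ n * n.factorial := by positivity
  have hc1 : 1 ≤ c := by linarith
  have hcc : c ≤ c ^ 2 := by nlinarith
  have h0 := norm_nonneg z.1
  have key : ∀ {a : ℝ}, 0 ≤ a → a ^ 2 ≤ c * ‖z.1‖ ^ 2 → a ≤ c * ‖z.1‖ := fun ha h => by
    refine (pow_le_pow_iff_left₀ ha (by positivity) two_ne_zero).1 ?_
    rw [mul_pow]
    exact h.trans (by gcongr)
  rw [Prod.norm_def, Prod.norm_def]
  refine max_le (by nlinarith) (max_le (key (norm_nonneg _) ?_) (key (norm_nonneg _) ?_))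
  · rw [h1]; gcongr; linarith
  · rw [h2, ← mul_assoc]; gcongr; linarith

theorem exists_chaosPath [CompleteSpace H] (hW : IsIsonormal W P) {n : ℕ}
    {f : ℝ → TensorPower H n} {X : ℝ → Ω → ℝ} {DX : ℝ → Ω → H}
    (hX : ∀ t ∈ Set.Icc (0 : ℝ) 1, IsMultipleIntegral W P n (f t) (X t))
    (hDX : ∀ t ∈ Set.Icc (0 : ℝ) 1, IsMalliavinDerivative W P (X t) (DX t)) :
    ∃ z : ℝ → (chaosTriples W P n).topologicalClosure, ∀ t ∈ Set.Icc (0 : ℝ) 1,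
      (z t).1.1 = f t ∧ (z t).1.2.1 =ᵐ[P] X t ∧ (z t).1.2.2 =ᵐ[P] DX t := by
  classical
  refine ⟨fun t => if h : t ∈ Set.Icc (0 : ℝ) 1 then
    ⟨_, mem_closure_chaosTriples hW (hX t h) (hDX t h)⟩ else 0, fun t h => ?_⟩
  simp only [dif_pos h]
  exact ⟨trivial, (hX t h).1.coeFn_toLp, (hDX t h).2.1.coeFn_toLp⟩

/-- The Malliavin derivatives of a continuous chaos process have Hölder continuous paths. -/
theorem ae_exists_holderUnit_of_chaosPath (hW : IsIsonormal W P) {n : ℕ} (hn : 1 ≤ n)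
    {f : ℝ → TensorPower H n} {DX : ℝ → Ω → H} {θ ρ : ℝ} (hreg : KernelRegularity f θ)
    (hρ0 : 0 < ρ) (hρ : ρ < θ / 2) (hDXcont : ∀ᵐ ω ∂P, ContinuousOn (fun t => DX t ω) (Set.Icc 0 1))
    {z : ℝ → (chaosTriples W P n).topologicalClosure}
    (hz : ∀ t ∈ Set.Icc (0 : ℝ) 1, (z t).1.1 = f t ∧ (z t).1.2.2 =ᵐ[P] DX t) :
    ∀ᵐ ω ∂P, ∃ B : ℝ, 0 ≤ B ∧ HolderUnit (fun t => DX t ω) B ρ := by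
  obtain ⟨C, hC, hf⟩ := hreg.exists_holderUnit
  -- Kolmogorov's criterion with power `2 * (q + 1)` and exponent `(q + 1) * θ` requires `(q + 1) *
  -- (θ - 2 * ρ) > 1`.
  obtain ⟨q, hq⟩ := exists_nat_gt (1 / (θ - 2 * ρ))
  have hd : 0 < θ - 2 * ρ := by linarith
  rw [div_lt_iff₀ hd] at hq
  obtain ⟨K, hK, hmom⟩ := exists_lintegral_norm_pow_le n hn q hW
  refine ae_exists_holderUnit (p := 2 * (q + 1)) (K := K * C ^ (2 * (q + 1)))
    (α := (q + 1) * θ) (by omega) (by positivity) hρ0 (by push_cast; nlinarith)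
    (fun t ht => (Lp.aestronglyMeasurable (z t).1.2.2).congr (hz t ht).2) ?_ hDXcont
  intro s t h0 hst h1
  obtain ⟨hs1, hs2⟩ := hz s ⟨h0, hst.le.trans h1⟩
  obtain ⟨ht1, ht2⟩ := hz t ⟨h0.trans hst.le, h1⟩
  have h := hmom _ (z t - z s).2
  have e : ∫⁻ ω, ‖DX t ω - DX s ω‖ₑ ^ (2 * (q + 1)) ∂P =
      ∫⁻ ω, ‖(z t - z s).1.2.2 ω‖ₑ ^ (2 * (q + 1)) ∂P := by
    refine lintegral_congr_ae ?_
    filter_upwards [Lp.coeFn_sub (z t).1.2.2 (z s).1.2.2, hs2, ht2] with ω a b c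
    have : (z t - z s).1.2.2 ω = DX t ω - DX s ω := by
      refine a.trans ?_
      rw [Pi.sub_apply, b, c]
    rw [this]
  rw [e]
  refine h.trans (ENNReal.ofReal_le_ofReal ?_)
  have e1 : (z t - z s).1.1 = f t - f s := by rw [← hs1, ← ht1]; rfl
  have hts : 0 < t - s := sub_pos.2 hst
  rw [e1, ← pow_mul, mul_assoc]
  gcongr
  calc ‖f t - f s‖ ^ (2 * (q + 1)) ≤ (C * (t - s) ^ (θ / 2)) ^ (2 * (q + 1)) := by
        gcongr
        exact hf s t h0 hst.le h1
    _ = _ := by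
        rw [mul_pow, ← Real.rpow_mul_natCast hts.le]
        congr 2
        push_cast
        ring

end ChaosPath

end WienerChaos

end

/-! ### The main theorem. -/

theorem mainTheorem9
    {H : Type*} [NormedAddCommGroup H] [InnerProductSpace ℝ H] [CompleteSpace H]
    [TopologicalSpace.SeparableSpace H]
    {Ω : Type*} [MeasurableSpace Ω] (P : Measure Ω) [IsProbabilityMeasure P]
    -- the isonormal process and the continuous chaos process `X_t = I_n(f_t)`
    (W : H → Ω → ℝ) (hW : WienerChaos.IsIsonormal W P)
    (n : ℕ) (hn : 1 ≤ n)
    (f : ℝ → WienerChaos.TensorPower H n) (X : ℝ → Ω → ℝ)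
    (hX : ∀ t ∈ Set.Icc (0 : ℝ) 1, WienerChaos.IsMultipleIntegral W P n (f t) (X t))
    (hXcont : ∀ᵐ ω ∂P, ContinuousOn (fun t => X t ω) (Set.Icc 0 1))
    -- the process of Malliavin derivatives, in a continuous version
    (DX : ℝ → Ω → H)
    (hDX : ∀ t ∈ Set.Icc (0 : ℝ) 1, WienerChaos.IsMalliavinDerivative W P (X t) (DX t))
    (hDXcont : ∀ᵐ ω ∂P, ContinuousOn (fun t => DX t ω) (Set.Icc 0 1))
    -- the assumptions on the kernels
    (θ β : ℝ) (hβ0 : 0 < β) (hβ1 : β < 1)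
    (hreg : WienerChaos.KernelRegularity f θ)
    (hnondet : WienerChaos.KernelNondeterminism f β)
    (hrow : WienerChaos.KernelNonnegRowSums f)
    -- the integrand
    (ρ : ℝ) (hρ : ρ < θ / 2) (τ : ℝ≥0) (hτρ : 1 < (τ : ℝ) + ρ)
    (g : ℝ → ℝ) (hg : MemHolder τ ((Set.Icc (0 : ℝ) 1).domRestrict g))
    (hg0 : nnHolderNorm τ ((Set.Icc (0 : ℝ) 1).domRestrict g) ≠ 0)
    -- the lower bound on the variance of the increments
    (η C : ℝ) (hη : 0 < η) (hC : 0 < C)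
    (hlower : ∀ s t : ℝ, 0 ≤ s → s < t → t ≤ 1 →
      C * |t - s| ^ η ≤ ∫ ω, (X t ω - X s ω) ^ 2 ∂P) :
    (∀ᵐ ω ∂P, ∃ I : H, WienerChaos.HasYoungIntegral g (fun t => DX t ω) 0 1 I) ∧
    MemLp (fun ω => WienerChaos.youngIntegral g (fun t => DX t ω) 0 1) 2 P ∧
    (⨆ r : Set.Icc (0 : ℝ) 1, |g r|) ≤
      max
        (2 / (√n * √β) * (∫ ω, X 1 ω ^ 2 ∂P) ^ (-(1 / 2) : ℝ) *
          (∫ ω, ‖WienerChaos.youngIntegral g (fun t => DX t ω) 0 1‖ ^ 2 ∂P) ^ (1 / 2 : ℝ))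
        (2 / (n * β * C) ^ ((τ : ℝ) / (2 * τ + η)) *
          (∫ ω, ‖WienerChaos.youngIntegral g (fun t => DX t ω) 0 1‖ ^ 2 ∂P)
            ^ ((τ : ℝ) / (2 * τ + η)) *
          (nnHolderNorm τ ((Set.Icc (0 : ℝ) 1).domRestrict g) : ℝ) ^ (η / (2 * τ + η))) := by
  have hθ := hreg.le_two
  have hθ1 : 1 < θ := hreg.2.1
  have hτ : 0 < (τ : ℝ) := by linarith
  set G : ℝ := (nnHolderNorm τ ((Set.Icc (0 : ℝ) 1).domRestrict g) : ℝ) with hG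
  have hG0 : 0 < G := by
    rw [hG]
    exact_mod_cast pos_iff_ne_zero.2 hg0
  have hgH : WienerChaos.HolderUnit g G τ := by
    intro s t h0 hst h1
    have := hg.holderWith.dist_le ⟨t, h0.trans hst, h1⟩ ⟨s, h0, hst.trans h1⟩
    rw [Subtype.dist_eq, Real.dist_eq t s, abs_of_nonneg (sub_nonneg.2 hst)] at this
    rwa [← dist_eq_norm]
  obtain ⟨z, hz⟩ := WienerChaos.exists_chaosPath hW hX hDX
  obtain ⟨C₀, hC₀, hf⟩ := hreg.exists_holderUnit
  have hzsub : ∀ s ∈ Set.Icc (0 : ℝ) 1, ∀ t ∈ Set.Icc (0 : ℝ) 1,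
      (z t - z s).1.1 = f t - f s := fun s hs t ht => by
    rw [← (hz s hs).1, ← (hz t ht).1]; rfl
  set c : ℝ := n.factorial + n * n.factorial + 1 with hc
  have hzH : WienerChaos.HolderUnit z (c * C₀) (θ / 2) := by
    intro s t h0 hst h1
    have h2 := WienerChaos.norm_le_of_mem_closure_chaosTriples hW (z t - z s).2
    rw [hzsub s ⟨h0, hst.trans h1⟩ t ⟨h0.trans hst, h1⟩, ← hc] at h2
    rw [mul_assoc]
    refine h2.trans ?_
    gcongr
    exact hf s t h0 hst h1
  -- One integral in the closed space of triples. Its kernel component is `∫ g df` and its last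
  -- component is `∫ g dDX` in `L²`; membership in that space ties their norms.
  obtain ⟨J, hJ⟩ := WienerChaos.exists_hasYoungIntegral hG0.le (by positivity : 0 ≤ c * C₀) hτ
    (by linarith : 0 < θ / 2) (by linarith) hgH hzH
  have hpath : ∀ᵐ ω ∂P, ∃ I : H, WienerChaos.HasYoungIntegral g (fun t => DX t ω) 0 1 I := by
    -- The sign of `ρ` is not assumed. Taking the maximum with `θ / 4` gives a positive exponent and
    -- keeps the sum with `τ` above `1`.
    have hmax : max ρ (θ / 4) < θ / 2 := max_lt hρ (by linarith)
    have hmax0 : 0 < max ρ (θ / 4) := lt_max_of_lt_right (by linarith)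
    filter_upwards [WienerChaos.ae_exists_holderUnit_of_chaosPath hW hn hreg hmax0 hmax hDXcont
      fun t ht => ⟨(hz t ht).1, (hz t ht).2.2⟩] with ω ⟨B, hB, hω⟩
    obtain ⟨J', hJ'⟩ := WienerChaos.exists_hasYoungIntegral hG0.le hB hτ hmax0
      (by linarith [le_max_left ρ (θ / 4)]) hgH hω
    exact ⟨_, hJ' 0 1 le_rfl zero_le_one le_rfl⟩
  have hint : (fun ω => WienerChaos.youngIntegral g (fun t => DX t ω) 0 1) =ᵐ[P]
      (J 1 - J 0).1.2.2 :=
    ((hJ 0 1 le_rfl zero_le_one le_rfl).map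
      ((ContinuousLinearMap.snd ℝ (Lp ℝ 2 P) (Lp H 2 P)).comp
        ((ContinuousLinearMap.snd ℝ (WienerChaos.TensorPower H n) _).comp
          (WienerChaos.chaosTriples W P n).topologicalClosure.subtypeL))).youngIntegral_ae_eq (fun t ht => (hz t ht).2.2) hpath
  have hY : ∫ ω, ‖WienerChaos.youngIntegral g (fun t => DX t ω) 0 1‖ ^ 2 ∂P =
      n * (n.factorial * ‖(J 1 - J 0).1.1‖ ^ 2) := by
    rw [WienerChaos.integral_norm_sq_eq_norm_sq _ hint.symm]
    exact (WienerChaos.norm_sq_of_mem_closure_chaosTriples hW (J 1 - J 0).2).2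
  refine ⟨hpath, (memLp_congr_ae hint).2 (Lp.memLp _), ?_⟩
  rw [hY]
  set Y : ℝ := n * (n.factorial * ‖(J 1 - J 0).1.1‖ ^ 2) with hYdef
  have hV : ∀ s ∈ Set.Icc (0 : ℝ) 1, ∀ t ∈ Set.Icc (0 : ℝ) 1,
      ∫ ω, (X t ω - X s ω) ^ 2 ∂P = n.factorial * ‖f t - f s‖ ^ 2 := by
    intro s hs t ht
    have h1 : (z t - z s).1.2.1 =ᵐ[P] fun ω => X t ω - X s ω := by
      filter_upwards [Lp.coeFn_sub (z t).1.2.1 (z s).1.2.1, (hz s hs).2.1, (hz t ht).2.1]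
        with ω a b c
      refine a.trans ?_
      rw [Pi.sub_apply, b, c]
    have h2 := WienerChaos.integral_norm_sq_eq_norm_sq _ h1
    simp only [Real.norm_eq_abs, sq_abs] at h2
    rw [h2, (WienerChaos.norm_sq_of_mem_closure_chaosTriples hW (z t - z s).2).1, hzsub s hs t ht]
  -- Holds because `f 0 = 0`.
  have hV1 : ∫ ω, X 1 ω ^ 2 ∂P = ∫ ω, (X 1 ω - X 0 ω) ^ 2 ∂P := by
    have h2 := WienerChaos.integral_norm_sq_eq_norm_sq _ (hz 1 (by simp)).2.1
    simp only [Real.norm_eq_abs, sq_abs] at h2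
    rw [h2, (WienerChaos.norm_sq_of_mem_closure_chaosTriples hW (z 1).2).1, (hz 1 (by simp)).1,
      hV 0 (by simp) 1 (by simp), hreg.1, sub_zero]
  have hn0 : (0 : ℝ) < n := by exact_mod_cast hn
  have hJf : ∀ a b, 0 ≤ a → a ≤ b → b ≤ 1 →
      WienerChaos.HasYoungIntegral g f a b (J b - J a).1.1 := fun a b h0 hab h1 =>
    ((hJ a b h0 hab h1).map
      ((ContinuousLinearMap.fst ℝ (WienerChaos.TensorPower H n) _).comp (WienerChaos.chaosTriples W P n).topologicalClosure.subtypeL)).congr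
      fun t ht => (hz t ⟨h0.trans ht.1, ht.2.trans h1⟩).1
  have hlow : ∀ s t b, 0 ≤ s → s < t → t ≤ 1 → 0 < b →
      ((∀ q ∈ Set.Icc s t, b ≤ g q) ∨ (∀ q ∈ Set.Icc s t, b ≤ -g q)) →
      n * β * (b ^ 2 * ∫ ω, (X t ω - X s ω) ^ 2 ∂P) ≤ Y := by
    intro s t b h0 hst h1 hb hgb
    have i1 := hJf 0 s le_rfl h0 (hst.le.trans h1)
    have i2 := hJf s t h0 hst.le h1
    have i3 := hJf t 1 (h0.trans hst.le) h1 le_rfl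
    have hsum : (J s - J 0).1.1 + (J t - J s).1.1 + (J 1 - J t).1.1 = (J 1 - J 0).1.1 := by
      have : (J 1 - J 0) = (J s - J 0) + (J t - J s) + (J 1 - J t) := by abel
      rw [this]; rfl
    have hmain : β * (b ^ 2 * ‖f t - f s‖ ^ 2) ≤ ‖(J 1 - J 0).1.1‖ ^ 2 := by
      rcases hgb with h | h
      · rw [← hsum]
        exact hnondet.norm_young_ge hβ0 hrow h0 hst.le h1 hb i1 i2 i3 h
      -- When `g ≤ -b`, integrate `-g` instead; the norm of the total is unchanged.
      · have := hnondet.norm_young_ge hβ0 hrow h0 hst.le h1 hb i1.neg i2.neg i3.neg h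
        rwa [← neg_add, ← neg_add, norm_neg, hsum] at this
    rw [hV s ⟨h0, hst.le.trans h1⟩ t ⟨h0.trans hst.le, h1⟩, hYdef]
    calc n * β * (b ^ 2 * (n.factorial * ‖f t - f s‖ ^ 2))
        = n * (n.factorial * (β * (b ^ 2 * ‖f t - f s‖ ^ 2))) := by ring
      _ ≤ _ := by gcongr
  rw [hV1, ← Real.sqrt_mul hn0.le]
  exact ciSup_le fun r => WienerChaos.abs_le_max_of_local_lower_bound
    (V := fun s t => ∫ ω, (X t ω - X s ω) ^ 2 ∂P) (mul_pos hn0 hβ0) hG0 hτ hη hC hgH hlower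
    hlow r.2
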